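/- **Setting.** Let $G$ be a connected real Lie group with Lie algebra $\mathfrak g$ (left-invariant vector fields), and let $D\subset\mathfrak g$ be a bracket-generating subspace: with $V^0=0$, $V^1=D$, $V^{i+1}=V^i+[D,V^i]$ one has $V^m=\mathfrak g$ for some $m$. Let $$\mathfrak n(\mathfrak g,D)=\bigoplus_{i\ge 1}V^i/V^{i-1},\qquad [x+V^{i-1},\,y+V^{j-1}]_n=[x,y]+V^{i+j-1}\quad(x\in V^i,\ y\in V^j),$$ and let the nilpotentisation $N(G,D)$ be the simply connected Lie group with Lie algebra $\mathfrak n(\mathfrak g,D)$, identified with $\mathfrak n(\mathfrak g,D)$ by its exponential map, so that its product is given by the (finite) Baker–Campbell–Hausdorff formula. Fix a direct sum decomposition $\mathfrak g=\bigoplus_{i\ge1} W_i$ with $V^i=\bigoplus_{j\le i}W_j$ for all $i$, put $\delta_\varepsilon(\sum x_i)=\sum\varepsilon^i x_i$ ($x_i\in W_i$, $\varepsilon>0$), and identify $\mathfrak g$ with $\mathfrak n(\mathfrak g,D)$ by $\theta(\sum x_i)=\sum (x_i+V^{i-1})$; write $X\cdot_n Y=\theta^{-1}(\theta X\cdot\theta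 Y)$ for the product of $N(G,D)$ transported to $\mathfrak g$. Let $\log G$ be the local group $\mathfrak g$, near $0$, with $X\cdot_{\mathfrak g}Y=\log_G(\exp_G X\,\exp_G Y)$, with the uniformity of the vector space and the dilatations $\delta_\varepsilon$; give $G$ the uniformity of its left-invariant Riemannian distances and the dilatations $\tilde\delta_\varepsilon(\exp_G X)=\exp_G(\delta_\varepsilon X)$ near the neutral element $e$. A local group (with uniformly continuous operations near its neutral element $e$) with a local action $\delta$ of $(0,\infty)$ is said to satisfy H0, H1, H2 if, uniformly near $e$ as $\varepsilon\to0$: $\delta_\varepsilon x\to e$; $\ \delta_\varepsilon^{-1}((\delta_\varepsilon x)(\delta_\varepsilon y))$ converges, to a limit called $\beta(x,y)$; and $\delta_\varepsilon^{-1}((\delta_\varepsilon x)^{-1})\to x^{-1}$. Its virtual tangent space $VT_e$ at $e$ is then the local group with the operation $\beta$; equivalently, it is formed by the infinitesimal left translations $L_x:y\mapsto\beta(x,y)$ under composition. **Theorem.** For every such decomposition: 1. $\log G$ with $\delta_\varepsilon$, and $G$ with $\tilde\delta_\varepsilon$, are local groups with local actions of $(0,\infty)$ that satisfy H0, H1,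 H2, and $VT_0\log G$ and $VT_eG$ are local groups. 2. $N(G,D)=VT_0\log G$ as local groups: for all $X,Y\in\mathfrak g$ the limit $$\beta(X,Y)=\lim_{\varepsilon\to0}\delta_\varepsilon^{-1}\bigl(\delta_\varepsilon X\cdot_{\mathfrak g}\delta_\varepsilon Y\bigr)$$ exists and equals $X\cdot_nY$, and $\theta$ is an isomorphism of local uniform groups from $VT_0\log G$ to $N(G,D)$. In terms of translations, $X\mapsto L_X$ is injective on $\mathfrak g$ and $L_X\circ L_Y=L_{X\cdot_nY}$ for all $X,Y\in\mathfrak g$. 3. $VT_eG$ is isomorphic to $N(G,D)$: the map $\theta\circ\log_G$ is an isomorphism of local uniform groups from $VT_eG$ to $N(G,D)$. -/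

import Mathlib

open Filter Topology Set
open scoped Manifold ContDiff DirectSum

noncomputable section

section Algebra

variable {L : Type*} [LieRing L] [LieAlgebra ℝ L]

/-- The filtration `V⁰ = 0`, `V¹ = D`, `Vⁱ⁺¹ = Vⁱ + [D, Vⁱ]` of a Lie algebra. -/
def lieFiltration (D : Submodule ℝ L) : ℕ → Submodule ℝ L
  | 0 => ⊥
  | 1 => D
  | i + 2 => lieFiltration D (i + 1) ⊔
      Submodule.span ℝ {z | ∃ d ∈ D, ∃ v ∈ lieFiltration D (i + 1), ⁅d, v⁆ = z}

/-- `D` generates the Lie algebra: the filtration reaches the whole algebra. -/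
def BracketGenerating (D : Submodule ℝ L) : Prop :=
  ∃ m : ℕ, lieFiltration D m = ⊤

theorem lieFiltration_le_succ (D : Submodule ℝ L) (i : ℕ) :
    lieFiltration D i ≤ lieFiltration D (i + 1) := by
  cases i with
  | zero => exact bot_le
  | succ i => exact le_sup_left

theorem lieFiltration_mono (D : Submodule ℝ L) : Monotone (lieFiltration D) :=
  monotone_nat_of_le_succ (lieFiltration_le_succ D)

theorem lie_mem_lieFiltration_succ (D : Submodule ℝ L) {d y : L} (hd : d ∈ D) (j : ℕ)
    (hy : y ∈ lieFiltration D j) : ⁅d, y⁆ ∈ lieFiltration D (j + 1) := by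
  cases j with
  | zero =>
    have : y = 0 := hy
    rw [this, lie_zero]; exact zero_mem _
  | succ j => exact Submodule.mem_sup_right (Submodule.subset_span ⟨d, hd, y, hy, rfl⟩)

theorem lie_mem_lieFiltration (D : Submodule ℝ L) (i : ℕ) :
    ∀ (j : ℕ) {x y : L}, x ∈ lieFiltration D i → y ∈ lieFiltration D j →
      ⁅x, y⁆ ∈ lieFiltration D (i + j) := by
  induction i with
  | zero =>
    intro j x y hx _
    have : x = 0 := hx
    rw [this, zero_lie]; exact zero_mem _
  | succ i ih =>
    intro j x y hx hy
    cases i with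
    | zero => rw [Nat.zero_add, Nat.add_comm]; exact lie_mem_lieFiltration_succ D hx j hy
    | succ i =>
      obtain ⟨a, ha, b, hb, rfl⟩ := Submodule.mem_sup.1 hx
      rw [add_lie]
      refine add_mem (lieFiltration_mono D (by omega) (ih j ha hy)) ?_
      clear hx
      induction hb using Submodule.span_induction with
      | mem z hz =>
        obtain ⟨d, hd, v, hv, rfl⟩ := hz
        rw [lie_lie]
        refine sub_mem ?_ ?_
        · exact lieFiltration_mono D (by omega)
            (lie_mem_lieFiltration_succ D hd _ (ih j hv hy))
        · exact lieFiltration_mono D (by omega)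
            (ih (j + 1) hv (lie_mem_lieFiltration_succ D hd _ hy))
      | zero => rw [zero_lie]; exact zero_mem _
      | add u v _ _ hu hv => rw [add_lie]; exact add_mem hu hv
      | smul c u _ hu => rw [smul_lie]; exact Submodule.smul_mem _ c hu

/-- `Vⁱ⁻¹` as a subspace of `Vⁱ` (with `V⁰⁻¹ = V⁰ = 0` for `i = 0`). -/
abbrev prevStep (D : Submodule ℝ L) (i : ℕ) : Submodule ℝ (lieFiltration D i) :=
  (lieFiltration D (i - 1)).submoduleOf (lieFiltration D i)

/-- The homogeneous piece `V_i = Vⁱ / Vⁱ⁻¹` (zero for `i = 0`). -/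
def GradedPiece (D : Submodule ℝ L) (i : ℕ) : Type _ := lieFiltration D i ⧸ prevStep D i

namespace GradedPiece

variable (D : Submodule ℝ L) (i : ℕ)

instance : AddCommGroup (GradedPiece D i) :=
  inferInstanceAs (AddCommGroup (lieFiltration D i ⧸ prevStep D i))

instance : Module ℝ (GradedPiece D i) :=
  inferInstanceAs (Module ℝ (lieFiltration D i ⧸ prevStep D i))

/-- The projection `Vⁱ → Vⁱ / Vⁱ⁻¹`. -/
def mk : lieFiltration D i →ₗ[ℝ] GradedPiece D i := (prevStep D i).mkQ

variable {D i}

theorem mk_surjective : Function.Surjective (mk D i) := Submodule.mkQ_surjective (prevStep D i)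

theorem mk_eq_zero_iff (x : lieFiltration D i) :
    mk D i x = 0 ↔ (x : L) ∈ lieFiltration D (i - 1) :=
  Submodule.Quotient.mk_eq_zero (prevStep D i)

/-- A linear map that vanishes on `Vⁱ⁻¹` factors through `Vⁱ / Vⁱ⁻¹`. -/
def lift {M : Type*} [AddCommGroup M] [Module ℝ M] (f : lieFiltration D i →ₗ[ℝ] M)
    (hf : ∀ x : lieFiltration D i, (x : L) ∈ lieFiltration D (i - 1) → f x = 0) :
    GradedPiece D i →ₗ[ℝ] M :=
  (prevStep D i).liftQ f hf

end GradedPiece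

/-- The vector space `𝔫(𝔤, D) = ⨁ᵢ Vⁱ / Vⁱ⁻¹`. -/
abbrev NilAlgebra (D : Submodule ℝ L) : Type _ := ⨁ i : ℕ, GradedPiece D i

namespace NilAlgebra

variable (D : Submodule ℝ L)

/-- The class in `Vⁱ / Vⁱ⁻¹ ⊆ 𝔫(𝔤, D)` of an element of `Vⁱ`. -/
def cls (i : ℕ) : lieFiltration D i →ₗ[ℝ] NilAlgebra D :=
  (DirectSum.lof ℝ ℕ (GradedPiece D) i).comp (GradedPiece.mk D i)

variable {D} in
theorem cls_congr {i j : ℕ} (h : i = j) {x y : L} (hxy : x = y) (hx : x ∈ lieFiltration D i)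
    (hy : y ∈ lieFiltration D j) : cls D i ⟨x, hx⟩ = cls D j ⟨y, hy⟩ := by
  subst h; subst hxy; rfl

variable {D} in
theorem cls_eq_zero {i : ℕ} {x : L} (hx : x ∈ lieFiltration D i)
    (h : x ∈ lieFiltration D (i - 1)) : cls D i ⟨x, hx⟩ = 0 := by
  rw [cls, LinearMap.comp_apply, (GradedPiece.mk_eq_zero_iff _).2 h, map_zero]

/-- The bilinear map `Vⁱ × Vʲ → 𝔫(𝔤, D)`, `(x, y) ↦ [x, y] + Vⁱ⁺ʲ⁻¹`. -/
def preBracket (i j : ℕ) :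
    lieFiltration D i →ₗ[ℝ] lieFiltration D j →ₗ[ℝ] NilAlgebra D :=
  LinearMap.mk₂ ℝ
    (fun x y => cls D (i + j) ⟨⁅(x : L), (y : L)⁆, lie_mem_lieFiltration D i j x.2 y.2⟩)
    (fun x x' y => by
      rw [← map_add]; congr 1; ext; simp)
    (fun c x y => by
      rw [← map_smul]; congr 1; ext; simp)
    (fun x y y' => by
      rw [← map_add]; congr 1; ext; simp)
    (fun c x y => by
      rw [← map_smul]; congr 1; ext; simp)

theorem preBracket_eq_zero_left {i j : ℕ} (x : lieFiltration D i)
    (hx : (x : L) ∈ lieFiltration D (i - 1)) : preBracket D i j x = 0 := by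
  ext1 y
  refine cls_eq_zero _ ?_
  rcases Nat.eq_zero_or_pos i with rfl | hi
  · have : (x : L) = 0 := hx
    rw [this, zero_lie]; exact zero_mem _
  · exact lieFiltration_mono D (by omega) (lie_mem_lieFiltration D (i - 1) j hx y.2)

theorem preBracket_eq_zero_right {i j : ℕ} (y : lieFiltration D j)
    (hy : (y : L) ∈ lieFiltration D (j - 1)) : (preBracket D i j).flip y = 0 := by
  ext1 x
  refine cls_eq_zero _ ?_
  rcases Nat.eq_zero_or_pos j with rfl | hj
  · have : (y : L) = 0 := hy
    rw [this, lie_zero]; exact zero_mem _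
  · exact lieFiltration_mono D (by omega) (lie_mem_lieFiltration D i (j - 1) x.2 hy)

/-- The bracket with an element of `Vⁱ`, on `Vʲ/Vʲ⁻¹`. -/
def halfBracket (i j : ℕ) : lieFiltration D i →ₗ[ℝ] GradedPiece D j →ₗ[ℝ] NilAlgebra D :=
  LinearMap.flip (GradedPiece.lift (preBracket D i j).flip (preBracket_eq_zero_right D))

/-- The bracket `Vⁱ/Vⁱ⁻¹ × Vʲ/Vʲ⁻¹ → Vⁱ⁺ʲ/Vⁱ⁺ʲ⁻¹` induced on the homogeneous pieces. -/
def pieceBracket (i j : ℕ) : GradedPiece D i →ₗ[ℝ] GradedPiece D j →ₗ[ℝ] NilAlgebra D :=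
  GradedPiece.lift (halfBracket D i j) fun x hx => by
    refine LinearMap.ext fun q => ?_
    obtain ⟨y, rfl⟩ := GradedPiece.mk_surjective q
    exact LinearMap.congr_fun (preBracket_eq_zero_left D (j := j) x hx) y

/-- The bracket `[·,·]ₙ` of `𝔫(𝔤, D)`, as a bilinear map. -/
def bracketMap : NilAlgebra D →ₗ[ℝ] NilAlgebra D →ₗ[ℝ] NilAlgebra D :=
  DirectSum.toModule ℝ ℕ (NilAlgebra D →ₗ[ℝ] NilAlgebra D) fun i =>
    LinearMap.flip (DirectSum.toModule ℝ ℕ (GradedPiece D i →ₗ[ℝ] NilAlgebra D) fun j =>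
      LinearMap.flip (pieceBracket D i j))

instance : Bracket (NilAlgebra D) (NilAlgebra D) := ⟨fun x y => bracketMap D x y⟩

variable {D}

/-- `[x̂, ŷ]ₙ` is the class of `[x, y]`. -/
theorem cls_lie_cls {i j : ℕ} {x y : L} (hx : x ∈ lieFiltration D i) (hy : y ∈ lieFiltration D j) :
    ⁅cls D i ⟨x, hx⟩, cls D j ⟨y, hy⟩⁆ =
      cls D (i + j) ⟨⁅x, y⁆, lie_mem_lieFiltration D i j hx hy⟩ := by
  change bracketMap D (cls D i ⟨x, hx⟩) (cls D j ⟨y, hy⟩) = _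
  unfold bracketMap cls
  rw [LinearMap.comp_apply, LinearMap.comp_apply]
  rw [DirectSum.toModule_lof, LinearMap.flip_apply, DirectSum.toModule_lof]
  rfl

theorem induction_cls {p : NilAlgebra D → Prop} (h0 : p 0)
    (hc : ∀ (i : ℕ) (x : L) (hx : x ∈ lieFiltration D i), p (cls D i ⟨x, hx⟩))
    (ha : ∀ x y, p x → p y → p (x + y)) (x : NilAlgebra D) : p x := by
  refine DirectSum.induction_on (β := GradedPiece D) (motive := p) x h0 ?_ ha
  intro i q
  obtain ⟨v, rfl⟩ := GradedPiece.mk_surjective q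
  exact hc i v.1 v.2

theorem lie_add_left (x y z : NilAlgebra D) : ⁅x + y, z⁆ = ⁅x, z⁆ + ⁅y, z⁆ := by
  change bracketMap D (x + y) z = bracketMap D x z + bracketMap D y z
  rw [map_add, LinearMap.add_apply]

theorem lie_add_right (x y z : NilAlgebra D) : ⁅x, y + z⁆ = ⁅x, y⁆ + ⁅x, z⁆ :=
  map_add (bracketMap D x) y z

theorem lie_zero_left (x : NilAlgebra D) : ⁅(0 : NilAlgebra D), x⁆ = 0 := by
  change bracketMap D 0 x = 0
  rw [map_zero, LinearMap.zero_apply]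

theorem lie_zero_right (x : NilAlgebra D) : ⁅x, (0 : NilAlgebra D)⁆ = 0 :=
  map_zero (bracketMap D x)

theorem lie_add_lie_swap (x y : NilAlgebra D) : ⁅x, y⁆ + ⁅y, x⁆ = 0 := by
  induction x using induction_cls with
  | h0 => rw [lie_zero_left, lie_zero_right, add_zero]
  | hc i x hx =>
    induction y using induction_cls with
    | h0 => rw [lie_zero_left, lie_zero_right, add_zero]
    | hc j y hy =>
      rw [cls_lie_cls, cls_lie_cls, cls_congr (add_comm j i) (lie_skew y x).symm _
        (neg_mem (lie_mem_lieFiltration D i j hx hy)), ← map_add]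
      convert map_zero (cls D (i + j))
      exact Subtype.ext (add_neg_cancel _)
    | ha a b ha hb => rw [lie_add_left, lie_add_right, add_add_add_comm, ha, hb, add_zero]
  | ha a b ha hb => rw [lie_add_left, lie_add_right, add_add_add_comm, ha, hb, add_zero]

/-- `𝔫(𝔤, D)` is a Lie algebra. -/
instance : LieRing (NilAlgebra D) where
  add_lie := lie_add_left
  lie_add := lie_add_right
  lie_self x := by
    induction x using induction_cls with
    | h0 => rw [lie_zero_left]
    | hc i x hx =>
      rw [cls_lie_cls]
      convert map_zero (cls D (i + i))
      simp
    | ha a b ha hb => rw [lie_add_left, lie_add_right, lie_add_right, ha, hb, zero_add, add_zero, lie_add_lie_swap]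
  leibniz_lie x y z := by
    induction x using induction_cls with
    | h0 => simp only [lie_zero_left, lie_zero_right, add_zero]
    | hc i x hx =>
      induction y using induction_cls with
      | h0 => simp only [lie_zero_left, lie_zero_right, add_zero]
      | hc j y hy =>
        induction z using induction_cls with
        | h0 => simp only [lie_zero_right, add_zero]
        | hc k z hz =>
          simp only [cls_lie_cls]
          have h1 := lie_mem_lieFiltration D j (i + k) hy (lie_mem_lieFiltration D i k hx hz)
          have h2 := lie_mem_lieFiltration D (i + j) k (lie_mem_lieFiltration D i j hx hy) hz
          have e1 : j + (i + k) = i + (j + k) := by omega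
          have e2 : i + j + k = i + (j + k) := by omega
          rw [cls_congr e1 rfl h1 (e1 ▸ h1), cls_congr e2 rfl h2 (e2 ▸ h2), ← map_add]
          congr 1
          ext
          exact leibniz_lie x y z
        | ha a b ha hb => simp only [lie_add_right, ha, hb]; abel
      | ha a b ha hb => simp only [lie_add_left, lie_add_right, ha, hb]; abel
    | ha a b ha hb => simp only [lie_add_left, lie_add_right, ha, hb]; abel

instance : LieAlgebra ℝ (NilAlgebra D) where
  lie_smul c x y := map_smul (bracketMap D x) c y

end NilAlgebra

/-! ### The Baker-Campbell-Hausdorff product -/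

/-- The right-nested bracket `[a₁, [a₂, [ … , a_s] … ]]` of a word `a₁ a₂ … a_s`. -/
def nestedBracket : List L → L
  | [] => 0
  | [a] => a
  | a :: b :: l => ⁅a, nestedBracket (b :: l)⁆

/-- The term of Dynkin's form of the Baker-Campbell-Hausdorff formula attached to the exponents
`(r₁, s₁), …, (r_k, s_k)`. -/
def bchTerm (x y : L) (l : List (ℕ × ℕ)) : L :=
  ((-1 : ℝ) ^ (l.length - 1) /
      (l.length * (l.map fun p => p.1 + p.2).sum *
        (l.map fun p => p.1.factorial * p.2.factorial).prod : ℕ)) •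
    nestedBracket (l.flatMap fun p => List.replicate p.1 x ++ List.replicate p.2 y)

/-- The Baker-Campbell-Hausdorff product. In a nilpotent Lie algebra, the only case
in which it is used, only finitely many terms of the sum are non-zero. -/
def bchMul (x y : L) : L :=
  ∑ᶠ l ∈ {l : List (ℕ × ℕ) | l ≠ [] ∧ (0, 0) ∉ l}, bchTerm x y l

/-! ### Graded complements and dilatations -/

/-- A direct sum decomposition `𝔤 = ⨁ Wᵢ` with `Vⁱ = ⨁_{j ≤ i} Wⱼ` (so `W₀ = 0`). -/
structure Strata (D : Submodule ℝ L) where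
  W : ℕ → Submodule ℝ L
  internal : DirectSum.IsInternal W
  filtration_eq : ∀ i, lieFiltration D i = ⨆ j, ⨆ _ : j ≤ i, W j

namespace Strata

variable {D : Submodule ℝ L} (S : Strata D)

/-- The decomposition `x = ∑ xᵢ`, `xᵢ ∈ Wᵢ`, as a linear isomorphism. -/
def decomp : L ≃ₗ[ℝ] ⨁ i, S.W i :=
  (LinearEquiv.ofBijective (DirectSum.coeLinearMap S.W) S.internal).symm

/-- The dilatation `δ_ε x = ∑ εⁱ xᵢ`. -/
def dil (ε : ℝ) : L →ₗ[ℝ] L :=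
  (DirectSum.toModule ℝ ℕ L fun i => ε ^ i • (S.W i).subtype).comp S.decomp.toLinearMap

theorem le_filtration (i : ℕ) : S.W i ≤ lieFiltration D i := by
  rw [S.filtration_eq i]
  exact le_iSup₂_of_le i le_rfl le_rfl

/-- The natural map `Wᵢ → Vⁱ / Vⁱ⁻¹`. -/
def pieceMap (i : ℕ) : S.W i →ₗ[ℝ] GradedPiece D i :=
  (GradedPiece.mk D i).comp (Submodule.inclusion (S.le_filtration i))

theorem pieceMap_bijective (i : ℕ) : Function.Bijective (S.pieceMap i) := by
  constructor
  · rw [← LinearMap.ker_eq_bot, LinearMap.ker_eq_bot']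
    intro x hx
    have h : (x : L) ∈ lieFiltration D (i - 1) :=
      (GradedPiece.mk_eq_zero_iff _).1 hx
    ext
    rcases Nat.eq_zero_or_pos i with rfl | hi
    · exact h
    · have hd := S.internal.submodule_iSupIndep i
      refine (Submodule.disjoint_def.1 hd) x x.2 ?_
      rw [S.filtration_eq] at h
      refine (iSup₂_le fun j hj => ?_ : (⨆ j, ⨆ _ : j ≤ i - 1, S.W j) ≤ _) h
      exact le_iSup₂_of_le j (by omega) le_rfl
  · intro q
    obtain ⟨v, rfl⟩ := GradedPiece.mk_surjective q
    rcases Nat.eq_zero_or_pos i with rfl | hi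
    · refine ⟨0, ?_⟩
      rw [map_zero]
      exact ((GradedPiece.mk_eq_zero_iff v).2 v.2).symm
    · have hle : lieFiltration D i ≤ lieFiltration D (i - 1) ⊔ S.W i := by
        rw [S.filtration_eq i, S.filtration_eq (i - 1)]
        refine iSup₂_le fun j hj => ?_
        rcases Nat.lt_or_ge j i with h | h
        · exact le_sup_of_le_left (le_iSup₂_of_le j (by omega) le_rfl)
        · obtain rfl : j = i := by omega
          exact le_sup_right
      obtain ⟨a, ha, w, hw, hv⟩ := Submodule.mem_sup.1 (hle v.2)
      refine ⟨⟨w, hw⟩, ?_⟩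
      rw [← sub_eq_zero, pieceMap, LinearMap.comp_apply, ← map_sub, GradedPiece.mk_eq_zero_iff]
      change w - (v : L) ∈ lieFiltration D (i - 1)
      rw [← hv, sub_add_cancel_right]
      exact neg_mem ha

/-- The identification of `𝔤` with `𝔫(𝔤, D)`: `x = ∑ xᵢ` corresponds to `∑ (xᵢ + Vⁱ⁻¹)`. -/
def ident : L ≃ₗ[ℝ] NilAlgebra D :=
  S.decomp.trans (DFinsupp.mapRange.linearEquiv fun i =>
    LinearEquiv.ofBijective (S.pieceMap i) (S.pieceMap_bijective i))

end Strata

end Algebra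
/-! ### Local groups, dilatations and the virtual tangent space -/

/-- The data of a local group: a uniform space with a neutral element, a product and an inverse.
Only the germs of the operations at the neutral element matter. -/
structure LocalGroupData (X : Type*) where
  unif : UniformSpace X
  one : X
  mul : X → X → X
  inv : X → X

namespace LocalGroupData

variable {X Y : Type*} (P : LocalGroupData X) (Q : LocalGroupData Y)

/-- The axioms of a uniform group hold near the neutral element. With the product uniformity on
`X × X`, uniform continuity of the operation and of `x ↦ (x, x⁻¹)` is uniform continuity of the
product and of the inverse. -/
def IsLocalGroup : Prop :=
  letI := P.unif
  ∃ U ∈ 𝓝 P.one,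
    (∀ x ∈ U, ∀ y ∈ U, ∀ z ∈ U, P.mul (P.mul x y) z = P.mul x (P.mul y z)) ∧
    (∀ x ∈ U, P.mul P.one x = x ∧ P.mul x P.one = x) ∧
    (∀ x ∈ U, P.mul (P.inv x) x = P.one ∧ P.mul x (P.inv x) = P.one) ∧
    UniformContinuousOn (fun p : X × X => P.mul p.1 p.2) (U ×ˢ U) ∧
    UniformContinuousOn P.inv U

/-- `δ` is a local action of the multiplicative group `(0, ∞)` on the pointed space `(X, 1)`. -/
def IsLocalAction (δ : ℝ → X → X) : Prop :=
  letI := P.unif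
  (∃ T ∈ 𝓝 (1 : ℝ), ∃ U ∈ 𝓝 P.one,
    UniformContinuousOn (fun p : ℝ × X => δ p.1 p.2) (T ×ˢ U)) ∧
  (∀ ε > 0, Tendsto (δ ε) (𝓝 P.one) (𝓝 P.one)) ∧
  (∀ ε > 0, ∀ η > 0, ∀ᶠ x in 𝓝 P.one, δ (ε * η⁻¹) x = δ ε (δ η⁻¹ x))

/-- `β(x, y) = lim_{ε → 0} δ_ε⁻¹ ((δ_ε x) (δ_ε y))`, where `δ_ε⁻¹ = δ_{1/ε}`. -/
def virtualMul (δ : ℝ → X → X) (x y : X) : X :=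
  letI := P.unif
  haveI : Nonempty X := ⟨P.one⟩
  limUnder (𝓝[>] (0 : ℝ)) fun ε => δ ε⁻¹ (P.mul (δ ε x) (δ ε y))

/-- The hypotheses under which the virtual tangent space is defined: a local group with a local
action of `(0, ∞)` that satisfies (H0), (H1), (H2), all limits being uniform near the neutral
element. -/
structure HasVirtualTangent (δ : ℝ → X → X) : Prop where
  isLocalGroup : P.IsLocalGroup
  isLocalAction : P.IsLocalAction δ
  h0 : letI := P.unif
    ∃ U ∈ 𝓝 P.one, TendstoUniformlyOn δ (fun _ => P.one) (𝓝[>] (0 : ℝ)) U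
  h1 : letI := P.unif
    ∃ U ∈ 𝓝 P.one, TendstoUniformlyOn
      (fun (ε : ℝ) (p : X × X) => δ ε⁻¹ (P.mul (δ ε p.1) (δ ε p.2)))
      (fun p => P.virtualMul δ p.1 p.2) (𝓝[>] (0 : ℝ)) (U ×ˢ U)
  h2 : letI := P.unif
    ∃ U ∈ 𝓝 P.one, TendstoUniformlyOn
      (fun (ε : ℝ) (x : X) => δ ε⁻¹ (P.inv (δ ε x))) P.inv (𝓝[>] (0 : ℝ)) U

/-- The virtual tangent space at the neutral element, as the local group `(X, β)`: a point `x`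
stands for the infinitesimal left translation `y ↦ β(x, y)`. -/
def virtualTangent (δ : ℝ → X → X) : LocalGroupData X where
  unif := P.unif
  one := P.one
  mul := P.virtualMul δ
  inv := P.inv

/-- The infinitesimal left translation `L_x : y ↦ β(x, y)`. -/
def virtualTranslation (δ : ℝ → X → X) (x : X) : X → X :=
  fun y => P.virtualMul δ x y

/-- `f` is an isomorphism of local uniform groups, from a neighbourhood of the neutral element
of `P` to a neighbourhood of the neutral element of `Q`. -/
def IsLocalIso (f : X → Y) : Prop :=
  letI := P.unif
  letI := Q.unif
  f P.one = Q.one ∧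
  (∀ᶠ p in 𝓝 (P.one, P.one), f (P.mul p.1 p.2) = Q.mul (f p.1) (f p.2)) ∧
  ∃ U ∈ 𝓝 P.one, ∃ V ∈ 𝓝 Q.one, ∃ g : Y → X,
    MapsTo f U V ∧ MapsTo g V U ∧ InvOn g f U V ∧
    UniformContinuousOn f U ∧ UniformContinuousOn g V

end LocalGroupData

/-! ### The nilpotentisation as a group -/

section Nilpotentisation

variable {L : Type*} [LieRing L] [LieAlgebra ℝ L]

/-- `N(G, D)`: the simply connected Lie group with Lie algebra `𝔫(𝔤, D)`, identified with
`𝔫(𝔤, D)` by its exponential map, so that the group operation is given by the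
Baker-Campbell-Hausdorff formula. It carries the vector space topology and uniformity. -/
def nilpotentisation (D : Submodule ℝ L) : LocalGroupData (NilAlgebra D) where
  unif :=
    letI : TopologicalSpace (NilAlgebra D) := moduleTopology ℝ (NilAlgebra D)
    haveI : IsModuleTopology ℝ (NilAlgebra D) := ⟨rfl⟩
    haveI : IsTopologicalAddGroup (NilAlgebra D) := IsModuleTopology.topologicalAddGroup ℝ _
    IsTopologicalAddGroup.leftUniformSpace (NilAlgebra D)
  one := 0
  mul := bchMul
  inv := fun x => -x

end Nilpotentisation

/-! ### Lie groups -/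

section LieGroup

variable {E : Type*} [NormedAddCommGroup E] [NormedSpace ℝ E] [FiniteDimensional ℝ E]
  {G : Type*} [TopologicalSpace G] [ChartedSpace E G] [Group G]

instance completeSpace_of_finiteDimensional_real : CompleteSpace E :=
  FiniteDimensional.complete ℝ E

instance leInfty_minSmoothness_three : ENat.LEInfty (minSmoothness ℝ 3) :=
  ⟨by rw [minSmoothness_of_isRCLikeNormedField]; exact ENat.LEInfty.out⟩

variable (E G) in
/-- The Lie algebra of `G`. -/
abbrev LieAlg : Type _ := GroupLieAlgebra 𝓘(ℝ, E) G

variable [LieGroup 𝓘(ℝ, E) ∞ G]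

/-- Left-invariant vector fields are complete. -/
theorem exists_isMIntegralCurve_mulInvariantVectorField (X : LieAlg E G) :
    ∃ γ : ℝ → G, γ 0 = 1 ∧ IsMIntegralCurve (I := 𝓘(ℝ, E)) γ (mulInvariantVectorField X) := by
  have : IsTopologicalGroup G := topologicalGroup_of_lieGroup 𝓘(ℝ, E) ∞
  have : T1Space G := ChartedSpace.t1Space E G
  have : IsManifold 𝓘(ℝ, E) 1 G := IsManifold.of_le (n := ∞) (by exact_mod_cast le_top)
  have hv : ContMDiff 𝓘(ℝ, E) (𝓘(ℝ, E).prod 𝓘(ℝ, E)) 1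
      (fun g : G => (mulInvariantVectorField X g : TangentBundle 𝓘(ℝ, E) G)) :=
    (contMDiff_mulInvariantVectorField X).of_le (le_trans (by norm_num) le_minSmoothness)
  obtain ⟨γ, h0, hγ⟩ := exists_isMIntegralCurveAt_of_contMDiffAt_boundaryless (t₀ := 0)
    (hv.contMDiffAt (x := 1))
  obtain ⟨ε, hε, hγ⟩ := isMIntegralCurveAt_iff'.1 hγ
  refine exists_isMIntegralCurve_of_isMIntegralCurveOn hv hε (fun g => ?_) 1
  refine ⟨fun t => g * γ t, by simp [h0], ?_⟩
  intro t ht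
  have ht' : t ∈ Metric.ball (0 : ℝ) ε := by rwa [Real.ball_eq_Ioo, zero_sub, zero_add]
  have h1 := (hγ t ht').mono (s := Ioo (-ε) ε) (by rw [Real.ball_eq_Ioo, zero_sub, zero_add])
  have hd : ∀ a b : G, MDifferentiableAt 𝓘(ℝ, E) 𝓘(ℝ, E) (fun x => a * x) b := fun a _ =>
    (contMDiff_mul_left (I := 𝓘(ℝ, E)) (n := ∞) (a := a)).contMDiffAt.mdifferentiableAt (by simp)
  have h2 := (hd g (γ t)).hasMFDerivAt
  have h3 := h2.comp_hasMFDerivWithinAt t h1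
  have h4 : mulInvariantVectorField X (g * γ t) =
      mfderiv 𝓘(ℝ, E) 𝓘(ℝ, E) (fun x => g * x) (γ t) (mulInvariantVectorField X (γ t)) := by
    have hc : HasMFDerivAt 𝓘(ℝ, E) 𝓘(ℝ, E) ((fun x => g * x) ∘ (fun x => γ t * x)) (1 : G)
        ((mfderiv 𝓘(ℝ, E) 𝓘(ℝ, E) (fun x => g * x) (γ t * 1)).comp
          (mfderiv 𝓘(ℝ, E) 𝓘(ℝ, E) (fun x => γ t * x) 1)) :=
      (hd g (γ t * 1)).hasMFDerivAt.comp (1 : G) (hd (γ t) 1).hasMFDerivAt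
    have he : (fun x => g * x) ∘ (fun x => γ t * x) = fun x => g * γ t * x := by
      ext x; exact (mul_assoc _ _ _).symm
    rw [he] at hc
    have hm := hc.mfderiv
    have hr : mulInvariantVectorField X (g * γ t) =
        mfderiv 𝓘(ℝ, E) 𝓘(ℝ, E) (fun x => g * x) (γ t * 1) (mulInvariantVectorField X (γ t)) :=
      congrArg (fun A : E →L[ℝ] E => A X) hm
    have hk : ∀ h : G, h = γ t → (mfderiv 𝓘(ℝ, E) 𝓘(ℝ, E) (fun x => g * x) h : E →L[ℝ] E) =
        (mfderiv 𝓘(ℝ, E) 𝓘(ℝ, E) (fun x => g * x) (γ t) : E →L[ℝ] E) := by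
      rintro _ rfl; rfl
    exact hr.trans (congrArg (fun A : E →L[ℝ] E => A (mulInvariantVectorField X (γ t)))
      (hk _ (mul_one _)))
  refine (congrArg (fun A : ℝ →L[ℝ] E => HasMFDerivWithinAt 𝓘(ℝ, ℝ) 𝓘(ℝ, E)
    (fun t => g * γ t) (Ioo (-ε) ε) t A) ?_).mpr h3
  refine ContinuousLinearMap.ext fun r => ?_
  have h5 := (mfderiv 𝓘(ℝ, E) 𝓘(ℝ, E) (fun x => g * x) (γ t)).map_smul r
    (mulInvariantVectorField X (γ t))
  refine Eq.trans ?_ h5.symm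
  exact congrArg (fun w : E => r • w) h4

/-- The exponential map of `G`: `exp X = γ 1`, where `γ` is the integral curve, with `γ 0 = 1`, of
the left-invariant vector field of `X`. -/
def lieExp (X : LieAlg E G) : G :=
  (exists_isMIntegralCurve_mulInvariantVectorField X).choose 1

open Classical in
variable (E G) in
/-- The logarithm of `G`: a local inverse of the exponential map, sending a neighbourhood of `1` in
`G` to a neighbourhood of `0`. Its germ at `1` does not depend on the choice. -/
def lieLog : G → LieAlg E G :=
  if h : ∃ e : OpenPartialHomeomorph (LieAlg E G) G, 0 ∈ e.source ∧ EqOn e lieExp e.source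
  then h.choose.symm else fun _ => 0

variable (E G) in
/-- `G` as a uniform group, with the uniformity of its left-invariant Riemannian distances, which
is the left uniformity of the topological group. -/
def lieLocalGroup : LocalGroupData G where
  unif :=
    haveI : IsTopologicalGroup G := topologicalGroup_of_lieGroup 𝓘(ℝ, E) ∞
    IsTopologicalGroup.leftUniformSpace G
  one := 1
  mul := fun x y => x * y
  inv := fun x => x⁻¹

variable (E G) in
/-- The local group `log G`: the Lie algebra, with the operation `log (exp X exp Y)` and the
uniformity of the vector space. -/
def logLocalGroup : LocalGroupData (LieAlg E G) where
  unif := IsTopologicalAddGroup.leftUniformSpace (LieAlg E G)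
  one := 0
  mul := fun X Y => lieLog E G (lieExp X * lieExp Y)
  inv := fun X => lieLog E G (lieExp X)⁻¹

/-- The dilatations `exp X ↦ exp (δ_ε X)` of `G` near the neutral element. -/
def Strata.groupDil {D : Submodule ℝ (LieAlg E G)} (S : Strata D) (ε : ℝ) (g : G) : G :=
  lieExp (S.dil ε (lieLog E G g))

end LieGroup
end

/-!
The path `Z t = log (exp (t X) exp (t Y))` satisfies
`((exp (ad Z) - 1) / ad Z) Z' = X + exp (t ad X) Y`, by the formula for the derivative of the
exponential map, and `exp (ad Z) = exp (t ad X) exp (t ad Y)`. Inverting `(exp (ad Z) - 1) / ad Z`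
by the series of `log (1 + N) / N`, truncated at order `K`, and integrating over `[0, 1]` gives an
expression in the bracket alone, Poincaré's form of the Baker-Campbell-Hausdorff product, which
approximates `log (exp X exp Y)` up to a term of order greater than `K` in `(X, Y)`.

The conjugation by `δ_ε` changes the bracket into a bracket which depends polynomially on `ε` and is
the bracket of `𝔫(𝔤, D)` at `ε = 0`, because `[V^i, V^j] ⊆ V^(i + j)`. As `δ_ε x` is `O(ε)`, while
`δ_ε⁻¹` has norm `O(ε^(-m))`, the remainder of order greater than `m` disappears in the limit: the
rescaled products converge, locally uniformly, to the truncated integral product of the bracket of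
`𝔫(𝔤, D)`. Nilpotency makes the truncation exact, and the expansion of the integral is Dynkin's
formula, which defines the product of `N(G, D)`. The limit product inherits the laws of a group from
the local group `log G`, and a local homeomorphism inverse to `log_G` moves everything to `G`.
-/

/-! ### Exponentials and truncated logarithms in a real Banach algebra -/

section BanachAlgebra

open NormedSpace

variable {A : Type*} [NormedRing A] [NormedAlgebra ℝ A]

/-- The truncation of the power series of `log (1 + N) / N` to the powers `N ^ k` with `k < K`. -/
noncomputable def logTrunc (K : ℕ) (N : A) : A :=
  ∑ k ∈ Finset.range K, ((-1 : ℝ) ^ k / (k + 1 : ℝ)) • N ^ k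

theorem continuous_logTrunc (K : ℕ) : Continuous (logTrunc K : A → A) := by
  unfold logTrunc
  fun_prop

theorem logTrunc_units_conj (K : ℕ) (u : Aˣ) (N : A) :
    logTrunc K (↑u * N * ↑u⁻¹) = u * logTrunc K N * ↑u⁻¹ := by
  simp only [logTrunc, Finset.mul_sum, Finset.sum_mul, ← Units.conj_pow, mul_smul_comm,
    smul_mul_assoc]

theorem commute_exp_smul_sub_one (a : A) (s : ℝ) : Commute a (exp (s • a) - 1) :=
  ((Commute.refl a).smul_right s).exp_right.sub_right (Commute.one_right a)

/-- The primitive `∫₀ˢ exp (u a) du` of the one-parameter group generated by `a`. At `s = 1` it is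
the sum of the series `(exp a - 1) / a`. -/
noncomputable def expInt (a : A) (s : ℝ) : A := ∫ u in (0 : ℝ)..s, exp (u • a)

theorem expInt_zero_right (a : A) : expInt a 0 = 0 := intervalIntegral.integral_same

variable [CompleteSpace A]

theorem continuous_exp_comp {X : Type*} [TopologicalSpace X] {f : X → A} (hf : Continuous f) :
    Continuous fun x => exp (f x) :=
  letI : NormedAlgebra ℚ A := NormedAlgebra.restrictScalars ℚ ℝ A
  exp_continuous.comp hf

theorem hasDerivAt_expInt (a : A) (s : ℝ) : HasDerivAt (expInt a) (exp (s • a)) s :=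
  ((continuous_exp_comp (f := fun u : ℝ => u • a) (by fun_prop)).integral_hasStrictDerivAt
    0 s).hasDerivAt

theorem expInt_zero_one : expInt (0 : A) 1 = 1 := by simp [expInt]

theorem continuous_expInt_one : Continuous fun a : A => expInt a 1 :=
  intervalIntegral.continuous_parametric_intervalIntegral_of_continuous'
    (f := fun (a : A) (u : ℝ) => exp (u • a)) (continuous_exp_comp (by fun_prop)) 0 1

theorem mul_expInt (a : A) (s : ℝ) : a * expInt a s = exp (s • a) - 1 := by
  have hcont : Continuous fun u : ℝ => exp (u • a) := continuous_exp_comp (by fun_prop)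
  calc a * expInt a s = ∫ u in (0 : ℝ)..s, a * exp (u • a) :=
        ((ContinuousLinearMap.mul ℝ A a).intervalIntegral_comp_comm
          (hcont.intervalIntegrable _ _)).symm
    _ = exp (s • a) - exp ((0 : ℝ) • a) :=
        intervalIntegral.integral_eq_sub_of_hasDerivAt
          (fun t _ => hasDerivAt_exp_smul_const' a t)
          ((continuous_const.mul hcont).intervalIntegrable _ _)
    _ = exp (s • a) - 1 := by rw [zero_smul, exp_zero]

theorem hasDerivAt_pow_mul_expInt (a : A) (k : ℕ) (s : ℝ) :
    HasDerivAt (fun s : ℝ => (exp (s • a) - 1) ^ k * expInt a s)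
      ((k + 1 : ℝ) • ((exp (s • a) - 1) ^ k * exp (s • a))) s := by
  induction k with
  | zero => simpa using hasDerivAt_expInt a s
  | succ k ih =>
    have hmul := ((hasDerivAt_exp_smul_const a s).sub_const 1).mul ih
    set N : A := exp (s • a) - 1 with hN
    have hexp : Commute (exp (s • a)) N := (Commute.refl _).sub_right (Commute.one_right _)
    have hfirst : exp (s • a) * a * (N ^ k * expInt a s) = N ^ (k + 1) * exp (s • a) := by
      calc exp (s • a) * a * (N ^ k * expInt a s)
          = exp (s • a) * (a * N ^ k) * expInt a s := by simp only [mul_assoc]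
        _ = exp (s • a) * (N ^ k * a) * expInt a s := by
            rw [((commute_exp_smul_sub_one a s).pow_right k).eq]
        _ = exp (s • a) * (N ^ k * (a * expInt a s)) := by simp only [mul_assoc]
        _ = N ^ (k + 1) * exp (s • a) := by
            rw [mul_expInt, ← hN, ← pow_succ, (hexp.pow_right _).eq]
    convert! hmul using 1
    · funext u
      simp only [Pi.mul_apply, pow_succ', mul_assoc]
    · rw [hfirst, mul_smul_comm, ← mul_assoc, ← pow_succ']
      push_cast
      module

theorem hasDerivAt_logTrunc_mul_expInt (K : ℕ) (a : A) (s : ℝ) :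
    HasDerivAt (fun s : ℝ => logTrunc K (exp (s • a) - 1) * expInt a s)
      (1 - (-(exp (s • a) - 1)) ^ K) s := by
  have hsum := HasDerivAt.fun_sum (u := Finset.range K) fun k _ =>
    (hasDerivAt_pow_mul_expInt a k s).const_smul ((-1 : ℝ) ^ k / (k + 1 : ℝ))
  have hcomm : Commute (exp (s • a)) (exp (s • a) - 1) :=
    (Commute.refl _).sub_right (Commute.one_right _)
  convert! hsum using 1
  · funext u
    simp only [logTrunc, Finset.sum_mul, smul_mul_assoc, Pi.smul_apply]
  · rw [← mul_neg_geom_sum, Finset.mul_sum]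
    refine Finset.sum_congr rfl fun k _ => ?_
    rw [smul_smul, div_mul_cancel₀ _ (by positivity), neg_pow, sub_neg_eq_add, add_sub_cancel,
      ← (hcomm.pow_right k).eq]
    rcases Nat.even_or_odd k with hk | hk <;> simp [hk.neg_one_pow]

theorem logTrunc_mul_expInt (K : ℕ) (a : A) :
    logTrunc K (exp a - 1) * expInt a 1 =
      1 - ∫ s in (0 : ℝ)..1, (-(exp (s • a) - 1)) ^ K := by
  have hcont : Continuous fun s : ℝ => (-(exp (s • a) - 1)) ^ K :=
    ((continuous_exp_comp (by fun_prop)).sub continuous_const).neg.pow K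
  have h := intervalIntegral.integral_eq_sub_of_hasDerivAt (a := 0) (b := 1)
    (fun s _ => hasDerivAt_logTrunc_mul_expInt K a s)
    ((continuous_const.sub hcont).intervalIntegrable _ _)
  rw [intervalIntegral.integral_sub intervalIntegrable_const (hcont.intervalIntegrable _ _)] at h
  simpa [expInt_zero_right] using h.symm

theorem eventually_norm_exp_sub_one_le : ∀ᶠ a in 𝓝 (0 : A), ‖exp a - 1‖ ≤ 2 * ‖a‖ := by
  have h := (hasStrictFDerivAt_exp_zero (𝕂 := ℝ) (𝔸 := A)).hasFDerivAt.isLittleO.def one_pos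
  filter_upwards [h] with a ha
  have ha' : ‖exp a - 1 - a‖ ≤ ‖a‖ := by simpa using ha
  calc ‖exp a - 1‖ = ‖(exp a - 1 - a) + a‖ := by rw [sub_add_cancel]
    _ ≤ 2 * ‖a‖ := by linarith [norm_add_le (exp a - 1 - a) a]

end BanachAlgebra

/-! ### Linear flows and their perturbations -/

section LinearFlow

variable {E : Type*} [NormedAddCommGroup E] [NormedSpace ℝ E]

theorem norm_le_exp_mul_of_norm_deriv_le {f f' : ℝ → E} {δ K ε : ℝ} (hK : 1 ≤ K) (hε : 0 ≤ ε)
    (hf : ∀ s ∈ Icc (0 : ℝ) 1, HasDerivAt f (f' s) s) (h0 : ‖f 0‖ ≤ δ)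
    (bound : ∀ s ∈ Icc (0 : ℝ) 1, ‖f' s‖ ≤ K * ‖f s‖ + ε) :
    ∀ s ∈ Icc (0 : ℝ) 1, ‖f s‖ ≤ Real.exp K * (δ + ε) := by
  intro s hs
  have hδ : 0 ≤ δ := (norm_nonneg _).trans h0
  have hgronwall := norm_le_gronwallBound_of_norm_deriv_right_le (a := 0) (b := 1)
    (fun t ht => (hf t ht).continuousAt.continuousWithinAt)
    (fun t ht => (hf t (Ico_subset_Icc_self ht)).hasDerivWithinAt) h0
    (fun t ht => bound t (Ico_subset_Icc_self ht)) s hs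
  rw [gronwallBound_of_K_ne_0 (by positivity), sub_zero] at hgronwall
  have hexp : Real.exp (K * s) ≤ Real.exp K := Real.exp_le_exp.2 (by nlinarith [hs.1, hs.2])
  calc ‖f s‖ ≤ δ * Real.exp (K * s) + ε / K * (Real.exp (K * s) - 1) := hgronwall
    _ ≤ δ * Real.exp K + ε * Real.exp K := by
      gcongr
      · have : (1 : ℝ) ≤ Real.exp (K * s) := Real.one_le_exp (by nlinarith [hs.1])
        linarith
      · exact div_le_self hε hK
      · linarith
    _ = Real.exp K * (δ + ε) := by ring

theorem norm_le_of_perturbed_linear_flow {a : E →L[ℝ] E} {R : E → E → E} {c : ℝ → E} {h : E}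
    (hR : ∀ s ∈ Icc (0 : ℝ) 1, ‖R (c s) h‖ ≤ ‖c s‖ + ‖h‖)
    (hc : ∀ s ∈ Icc (0 : ℝ) 1, HasDerivAt c (a (c s) + h + R (c s) h) s) :
    ∀ s ∈ Icc (0 : ℝ) 1, ‖c s‖ ≤ Real.exp (‖a‖ + 1) * (‖c 0‖ + 2 * ‖h‖) := by
  refine norm_le_exp_mul_of_norm_deriv_le (by linarith [norm_nonneg a]) (by positivity) hc le_rfl
    fun s hs => ?_
  calc ‖a (c s) + h + R (c s) h‖ ≤ ‖a (c s)‖ + ‖h‖ + ‖R (c s) h‖ := norm_add₃_le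
    _ ≤ ‖a‖ * ‖c s‖ + ‖h‖ + (‖c s‖ + ‖h‖) := by
      gcongr
      exacts [a.le_opNorm _, hR s hs]
    _ = (‖a‖ + 1) * ‖c s‖ + 2 * ‖h‖ := by ring

variable [CompleteSpace E]

theorem hasDerivAt_linear_flow (a : E →L[ℝ] E) (x h : E) (s : ℝ) :
    HasDerivAt (fun s : ℝ => NormedSpace.exp (s • a) x + expInt a s h)
      (a (NormedSpace.exp (s • a) x + expInt a s h) + h) s := by
  have hderiv := ((hasDerivAt_exp_smul_const' a s).clm_apply (hasDerivAt_const s x)).add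
    ((hasDerivAt_expInt a s).clm_apply (hasDerivAt_const s h))
  have hmul : a (expInt a s h) = NormedSpace.exp (s • a) h - h :=
    DFunLike.congr_fun (mul_expInt a s) h
  convert! hderiv using 1
  simp only [map_add, hmul, mul_apply_eq_comp, map_zero, add_zero]
  abel

theorem norm_sub_linear_flow_le {a : E →L[ℝ] E} {c c' : ℝ → E} {h : E} {K η : ℝ}
    (hK : 1 ≤ K) (ha : ‖a‖ ≤ K) (hη : 0 ≤ η)
    (hc : ∀ s ∈ Icc (0 : ℝ) 1, HasDerivAt c (c' s) s)
    (bound : ∀ s ∈ Icc (0 : ℝ) 1, ‖c' s - (a (c s) + h)‖ ≤ η) :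
    ‖c 1 - (NormedSpace.exp a (c 0) + expInt a 1 h)‖ ≤ Real.exp K * η := by
  let d : ℝ → E := fun s => NormedSpace.exp (s • a) (c 0) + expInt a s h
  have hd : ∀ s, HasDerivAt d (a (d s) + h) s := hasDerivAt_linear_flow a (c 0) h
  have h0 : d 0 = c 0 := by simp [d, expInt_zero_right]
  have hgronwall := norm_le_exp_mul_of_norm_deriv_le (f := fun s => c s - d s)
    (f' := fun s => c' s - (a (d s) + h)) (δ := 0) hK hη
    (fun s hs => (hc s hs).sub (hd s)) (by simp [h0]) (fun s hs => ?_) 1 (by simp)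
  · simpa [d] using hgronwall
  · calc ‖c' s - (a (d s) + h)‖ = ‖a (c s - d s) + (c' s - (a (c s) + h))‖ := by
          congr 1
          rw [map_sub]
          abel
      _ ≤ ‖a (c s - d s)‖ + ‖c' s - (a (c s) + h)‖ := norm_add_le _ _
      _ ≤ K * ‖c s - d s‖ + η := add_le_add (a.le_of_opNorm_le ha _) (bound s hs)

/-- `f` is the time-one map, in terms of the initial value and of the parameter `h`, of the equation
`c' = a c + h + R (c, h)`. -/
theorem hasFDerivAt_of_perturbed_linear_flow {a : E →L[ℝ] E} {R : E → E → E} {f : E × E → E}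
    {ρ : ℝ} (hρ : ∀ x h : E, ‖x‖ < ρ → ‖R x h‖ ≤ ‖x‖ + ‖h‖)
    (hR : ∀ η > 0, ∀ᶠ x in 𝓝 (0 : E), ∀ h, ‖R x h‖ ≤ η * (‖x‖ + ‖h‖)) (hf : f 0 = 0)
    (hflow : ∀ᶠ p in 𝓝 (0 : E × E), ∃ c : ℝ → E, c 0 = p.1 ∧ c 1 = f p ∧
      ∀ s ∈ Icc (0 : ℝ) 1, ‖c s‖ < ρ ∧ HasDerivAt c (a (c s) + p.2 + R (c s) p.2) s) :
    HasFDerivAt f ((NormedSpace.exp a).coprod (expInt a 1)) 0 := by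
  set K : ℝ := ‖a‖ + 1
  have hK : 1 ≤ K := le_add_of_nonneg_left (norm_nonneg a)
  set C : ℝ := 3 * Real.exp K
  have hC : 0 < C := by positivity
  refine HasFDerivAt.of_isLittleO (Asymptotics.IsLittleO.of_bound fun η₀ hη₀ => ?_)
  set η : ℝ := η₀ / (Real.exp K * (C + 1))
  have hη : 0 < η := by positivity
  obtain ⟨δ, hδ, hRδ⟩ := Metric.eventually_nhds_iff.1 (hR η hη)
  have hsmall : ∀ᶠ p in 𝓝 (0 : E × E), C * ‖p‖ < δ :=
    (Continuous.tendsto' (by fun_prop) _ _ (by simp)).eventually_lt_const hδ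
  filter_upwards [hsmall, hflow] with p hp ⟨c, hc0, hc1, hc⟩
  have hbound : ∀ s ∈ Icc (0 : ℝ) 1, ‖c s‖ ≤ C * ‖p‖ := fun s hs =>
    calc ‖c s‖ ≤ Real.exp K * (‖p.1‖ + 2 * ‖p.2‖) := hc0 ▸ norm_le_of_perturbed_linear_flow
          (fun s hs => hρ _ _ (hc s hs).1) (fun s hs => (hc s hs).2) s hs
      _ ≤ Real.exp K * (‖p‖ + 2 * ‖p‖) := by gcongr; exacts [norm_fst_le p, norm_snd_le p]
      _ = C * ‖p‖ := by ring
  have hclose := norm_sub_linear_flow_le (h := p.2) (η := η * ((C + 1) * ‖p‖)) hK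
    (le_add_of_nonneg_right zero_le_one) (by positivity) (fun s hs => (hc s hs).2)
    (fun s hs => ?_)
  · rw [hf, sub_zero, sub_zero, ContinuousLinearMap.coprod_apply, ← hc0, ← hc1]
    refine hclose.trans_eq ?_
    simp only [η]
    field_simp
  · rw [add_sub_cancel_left]
    refine (hRδ (by rw [dist_zero_right]; exact (hbound s hs).trans_lt hp) p.2).trans ?_
    gcongr
    linarith [hbound s hs, norm_snd_le p]

end LinearFlow

/-! ### Groups with a chart and an exponential map at the identity -/

/-- A chart at the identity of a topological group, sending `1` to `0`, in which the product is of
class `C²` near the origin. -/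
structure GroupChart (E G : Type*) [NormedAddCommGroup E] [NormedSpace ℝ E] [TopologicalSpace G]
    [Group G] where
  chart : OpenPartialHomeomorph G E
  one_mem : 1 ∈ chart.source
  map_one : chart 1 = 0
  contDiffAt_mul :
    ContDiffAt ℝ 2 (fun p : E × E => chart (chart.symm p.1 * chart.symm p.2)) 0

namespace GroupChart

variable {E G : Type*} [NormedAddCommGroup E] [NormedSpace ℝ E] [TopologicalSpace G]
  [Group G] (M : GroupChart E G)

/-- The product of the group read in the chart. -/
def mul (p : E × E) : E := M.chart (M.chart.symm p.1 * M.chart.symm p.2)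

theorem symm_zero : M.chart.symm 0 = 1 := by
  rw [← M.map_one, M.chart.left_inv M.one_mem]

theorem zero_mem_target : (0 : E) ∈ M.chart.target := by
  rw [← M.map_one]
  exact M.chart.map_source M.one_mem

theorem target_mem_nhds {x : E} (hx : x ∈ M.chart.target) : M.chart.target ∈ 𝓝 x :=
  M.chart.open_target.mem_nhds hx

theorem source_mem_nhds {g : G} (hx : g ∈ M.chart.source) : M.chart.source ∈ 𝓝 g :=
  M.chart.open_source.mem_nhds hx

theorem mul_zero_left {x : E} (hx : x ∈ M.chart.target) : M.mul (0, x) = x := by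
  simp [mul, M.symm_zero, M.chart.right_inv hx]

theorem mul_zero_right {x : E} (hx : x ∈ M.chart.target) : M.mul (x, 0) = x := by
  simp [mul, M.symm_zero, M.chart.right_inv hx]

theorem eventually_differentiableAt_mul : ∀ᶠ p in 𝓝 (0 : E × E), DifferentiableAt ℝ M.mul p := by
  filter_upwards [M.contDiffAt_mul.eventually (by simp)] with p hp
  exact hp.differentiableAt (by simp)

/-- `M.left x v` is the value at `x` of the left-invariant vector field equal to `v` at `0`, read
in the chart. -/
noncomputable def left (x : E) : E →L[ℝ] E :=
  (fderiv ℝ M.mul (x, 0)).comp (ContinuousLinearMap.inr ℝ E E)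

/-- `M.right x v` is the value at `x` of the right-invariant vector field equal to `v` at `0`, read
in the chart. -/
noncomputable def right (x : E) : E →L[ℝ] E :=
  (fderiv ℝ M.mul (0, x)).comp (ContinuousLinearMap.inl ℝ E E)

theorem fderiv_mul_zero_left {x : E} (hx : x ∈ M.chart.target)
    (hd : DifferentiableAt ℝ M.mul (0, x)) (v : E) : fderiv ℝ M.mul (0, x) (0, v) = v := by
  have hcomp : HasFDerivAt (fun y : E => M.mul (0, y))
      ((fderiv ℝ M.mul (0, x)).comp (ContinuousLinearMap.inr ℝ E E)) x :=
    hd.hasFDerivAt.comp x (hasFDerivAt_prodMk_right 0 x)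
  have hid : HasFDerivAt (fun y : E => M.mul (0, y)) (ContinuousLinearMap.id ℝ E) x := by
    refine (hasFDerivAt_id x).congr_of_eventuallyEq ?_
    filter_upwards [M.target_mem_nhds hx] with y hy using M.mul_zero_left hy
  exact DFunLike.congr_fun (hcomp.unique hid) v

theorem fderiv_mul_zero_right {x : E} (hx : x ∈ M.chart.target)
    (hd : DifferentiableAt ℝ M.mul (x, 0)) (v : E) : fderiv ℝ M.mul (x, 0) (v, 0) = v := by
  have hcomp : HasFDerivAt (fun y : E => M.mul (y, 0))
      ((fderiv ℝ M.mul (x, 0)).comp (ContinuousLinearMap.inl ℝ E E)) x :=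
    HasFDerivAt.comp (g := M.mul) (f := fun y : E => (y, (0 : E))) x hd.hasFDerivAt
      (hasFDerivAt_prodMk_left x (0 : E))
  have hid : HasFDerivAt (fun y : E => M.mul (y, 0)) (ContinuousLinearMap.id ℝ E) x := by
    refine (hasFDerivAt_id x).congr_of_eventuallyEq ?_
    filter_upwards [M.target_mem_nhds hx] with y hy using M.mul_zero_right hy
  exact DFunLike.congr_fun (hcomp.unique hid) v

theorem left_zero : M.left 0 = 1 := by
  ext v
  exact M.fderiv_mul_zero_left M.zero_mem_target M.eventually_differentiableAt_mul.self_of_nhds v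

theorem right_zero : M.right 0 = 1 := by
  ext v
  exact M.fderiv_mul_zero_right M.zero_mem_target M.eventually_differentiableAt_mul.self_of_nhds v

theorem contDiffAt_fderiv_mul : ContDiffAt ℝ 1 (fderiv ℝ M.mul) 0 :=
  M.contDiffAt_mul.fderiv_right (by norm_num)

theorem contDiffAt_left : ContDiffAt ℝ 1 M.left 0 := by
  have hfderiv : ContDiffAt ℝ 1 (fun x : E => fderiv ℝ M.mul (x, 0)) 0 :=
    ContDiffAt.comp (g := fderiv ℝ M.mul) (f := fun x : E => (x, (0 : E))) 0
      M.contDiffAt_fderiv_mul (by fun_prop)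
  exact hfderiv.clm_comp contDiffAt_const

theorem contDiffAt_right : ContDiffAt ℝ 1 M.right 0 := by
  have hfderiv : ContDiffAt ℝ 1 (fun x : E => fderiv ℝ M.mul (0, x)) 0 :=
    ContDiffAt.comp (g := fderiv ℝ M.mul) (f := fun x : E => ((0 : E), x)) 0
      M.contDiffAt_fderiv_mul (by fun_prop)
  exact hfderiv.clm_comp contDiffAt_const

/-- The adjoint action `M.ad Z c = [Z, c]` on the tangent space at the identity. The conjugation by
`x` has derivative `M.right x ∘ (M.left x)⁻¹` at `0`, so to first order in `x` it is the identity
plus the derivative of `M.right - M.left`. -/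
noncomputable def ad : E →L[ℝ] E →L[ℝ] E :=
  (fderiv ℝ (fun x => M.right x - M.left x) 0).flip

theorem hasFDerivAt_right_sub_left :
    HasFDerivAt (fun x => M.right x - M.left x) M.ad.flip 0 := by
  rw [ad, ContinuousLinearMap.flip_flip]
  exact ((M.contDiffAt_right.differentiableAt (by simp)).sub
    (M.contDiffAt_left.differentiableAt (by simp))).hasFDerivAt

theorem ad_apply (X Y : E) :
    M.ad X Y = fderiv ℝ M.left 0 X Y - fderiv ℝ M.left 0 Y X := by
  have hfderiv : HasFDerivAt (fderiv ℝ M.mul) (fderiv ℝ (fderiv ℝ M.mul) 0) 0 :=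
    (M.contDiffAt_fderiv_mul.differentiableAt (by simp)).hasFDerivAt
  have hleft : HasFDerivAt M.left _ 0 :=
    (HasFDerivAt.comp (g := fderiv ℝ M.mul) (f := fun x : E => (x, (0 : E))) (0 : E) hfderiv
      (hasFDerivAt_prodMk_left (𝕜 := ℝ) (0 : E) (0 : E))).clm_comp (hasFDerivAt_const _ _)
  have hright : HasFDerivAt M.right _ 0 :=
    (HasFDerivAt.comp (g := fderiv ℝ M.mul) (f := fun x : E => ((0 : E), x)) (0 : E) hfderiv
      (hasFDerivAt_prodMk_right (𝕜 := ℝ) (0 : E) (0 : E))).clm_comp (hasFDerivAt_const _ _)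
  have hsymm : IsSymmSndFDerivAt ℝ M.mul 0 := M.contDiffAt_mul.isSymmSndFDerivAt (by simp)
  rw [ad, (hright.fun_sub hleft).fderiv, hleft.fderiv]
  simp [hsymm.eq (0, Y) (X, 0)]

/-- The remainder of the velocity `M.right x (Z + h) - M.left x Z` of the curve
`exp (t (Z + h)) · y · exp (- t Z)` after its linearization `M.ad Z x + h`. -/
noncomputable def remainder (Z x h : E) : E :=
  (M.right x - M.left x - M.ad.flip x) Z + (M.right x - 1) h

theorem right_add_left_neg (Z x h : E) :
    M.right x (Z + h) + M.left x (-Z) = M.ad Z x + h + M.remainder Z x h := by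
  simp only [remainder, sub_apply, map_add, map_neg, one_apply_eq_self,
    ContinuousLinearMap.flip_apply]
  abel

theorem eventually_norm_remainder_le {η : ℝ} (hη : 0 < η) :
    ∀ᶠ x in 𝓝 (0 : E), ∀ Z h, ‖Z‖ ≤ 1 → ‖M.remainder Z x h‖ ≤ η * (‖x‖ + ‖h‖) := by
  have hright : ∀ᶠ x in 𝓝 (0 : E), dist (M.right x) 1 < η := by
    have hcont := M.contDiffAt_right.continuousAt
    rw [ContinuousAt, M.right_zero] at hcont
    exact hcont.eventually (Metric.ball_mem_nhds _ hη)
  filter_upwards [M.hasFDerivAt_right_sub_left.isLittleO.def hη, hright] with x hdiff hone Z h hZ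
  have hdiff' : ‖M.right x - M.left x - M.ad.flip x‖ ≤ η * ‖x‖ := by
    simpa [M.right_zero, M.left_zero] using hdiff
  rw [dist_eq_norm] at hone
  calc ‖M.remainder Z x h‖ ≤ ‖(M.right x - M.left x - M.ad.flip x) Z‖ + ‖(M.right x - 1) h‖ :=
        norm_add_le _ _
    _ ≤ η * ‖x‖ * ‖Z‖ + η * ‖h‖ := add_le_add
        ((M.right x - M.left x - M.ad.flip x).le_of_opNorm_le hdiff' Z)
        ((M.right x - 1).le_of_opNorm_le hone.le h)
    _ ≤ η * ‖x‖ * 1 + η * ‖h‖ := by gcongr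
    _ = η * (‖x‖ + ‖h‖) := by ring

theorem symm_comp_mul_eventuallyEq [IsTopologicalGroup G] {x : E} (hx : x ∈ M.chart.target) :
    (M.chart.symm ∘ fun y : E => M.mul (x, y)) =ᶠ[𝓝 0]
      fun y => M.chart.symm x * M.chart.symm y := by
  have hprod : Tendsto (fun y : E => M.chart.symm x * M.chart.symm y) (𝓝 0)
      (𝓝 (M.chart.symm x)) := by
    have hsymm := M.chart.symm.continuousAt M.zero_mem_target
    rw [ContinuousAt, M.symm_zero] at hsymm
    simpa using (tendsto_const_nhds (x := M.chart.symm x)).mul hsymm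
  filter_upwards [hprod.eventually (M.chart.open_source.mem_nhds (M.chart.map_target hx))] with y hy
  exact M.chart.left_inv hy

end GroupChart

/-- A chart at the identity of a group together with an exponential map: `t ↦ exp (t X)` is a
one-parameter group with velocity `X` at `0` in the chart, and `exp` is continuous at `0`. -/
structure ExpChart (E G : Type*) [NormedAddCommGroup E] [NormedSpace ℝ E] [TopologicalSpace G]
    [Group G] extends GroupChart E G where
  exp : E → G
  exp_add_smul : ∀ (X : E) (s t : ℝ), exp ((s + t) • X) = exp (s • X) * exp (t • X)
  continuousAt_exp : ContinuousAt exp 0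
  hasDerivAt_exp : ∀ X : E, HasDerivAt (fun t : ℝ => chart (exp (t • X))) X 0

namespace ExpChart

variable {E G : Type*} [NormedAddCommGroup E] [NormedSpace ℝ E] [TopologicalSpace G]
  [Group G] (M : ExpChart E G)

theorem exp_zero : M.exp 0 = 1 := by
  simpa using M.exp_add_smul 0 0 0

theorem exp_neg (X : E) : M.exp (-X) = (M.exp X)⁻¹ := by
  have hmul := M.exp_add_smul X (-1) 1
  rw [neg_add_cancel, zero_smul, M.exp_zero, neg_one_smul, one_smul] at hmul
  exact eq_inv_of_mul_eq_one_left hmul.symm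

theorem tendsto_exp : Tendsto M.exp (𝓝 0) (𝓝 1) := by
  simpa [ContinuousAt, M.exp_zero] using M.continuousAt_exp

theorem tendsto_exp_smul (X : E) : Tendsto (fun t : ℝ => M.exp (t • X)) (𝓝 0) (𝓝 1) :=
  M.tendsto_exp.comp (Continuous.tendsto' (by fun_prop) _ _ (by simp))

theorem eventually_exp_mem_source : ∀ᶠ Z in 𝓝 (0 : E), M.exp Z ∈ M.chart.source :=
  M.tendsto_exp.eventually (M.source_mem_nhds M.one_mem)

theorem tendsto_chart_exp : Tendsto (fun Z => M.chart (M.exp Z)) (𝓝 0) (𝓝 0) := by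
  have hcont := M.chart.continuousAt M.one_mem
  rw [ContinuousAt, M.map_one] at hcont
  exact hcont.comp M.tendsto_exp

theorem hasDerivAt_mul_mul_chart_exp {x : E} (hx : x ∈ M.chart.target)
    (hr : DifferentiableAt ℝ M.mul (0, x)) (hl : DifferentiableAt ℝ M.mul (x, 0)) (A B : E) :
    HasDerivAt (fun t : ℝ =>
        M.mul (M.chart (M.exp (t • A)), M.mul (x, M.chart (M.exp (t • B)))))
      (M.right x A + M.left x B) 0 := by
  have hB : HasDerivAt (fun t : ℝ => M.mul (x, M.chart (M.exp (t • B)))) (M.left x B) 0 := by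
    have hl' : HasFDerivAt M.mul (fderiv ℝ M.mul (x, 0))
        ((fun t : ℝ => (x, M.chart (M.exp (t • B)))) 0) := by
      simpa [M.exp_zero, M.map_one] using hl.hasFDerivAt
    exact hl'.comp_hasDerivAt (0 : ℝ) ((hasDerivAt_const _ x).prodMk (M.hasDerivAt_exp B))
  have hr' : HasFDerivAt M.mul (fderiv ℝ M.mul (0, x))
      ((fun t : ℝ => (M.chart (M.exp (t • A)), M.mul (x, M.chart (M.exp (t • B))))) 0) := by
    simpa [M.exp_zero, M.map_one, M.mul_zero_right hx] using hr.hasFDerivAt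
  have hsplit : fderiv ℝ M.mul (0, x) (A, M.left x B) = M.right x A + M.left x B := by
    have hsum : (A, M.left x B) = (A, (0 : E)) + ((0 : E), M.left x B) := by simp
    rw [hsum, map_add, M.fderiv_mul_zero_left hx hr]
    rfl
  rw [← hsplit]
  exact hr'.comp_hasDerivAt (0 : ℝ) ((M.hasDerivAt_exp A).prodMk hB)

/-- The map `(y, h) ↦ exp (Z + h) · y · exp (- Z)` read in the chart. Its partial derivatives at `0`
are those of the conjugation by `exp Z` and of `W ↦ exp W · exp (- Z)` at `W = Z`. -/
def twistedConj (Z : E) (p : E × E) : E :=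
  M.chart (M.exp (Z + p.2) * M.chart.symm p.1 * M.exp (-Z))

theorem twistedConj_zero (Z : E) : M.twistedConj Z 0 = 0 := by
  simp [twistedConj, M.symm_zero, M.exp_neg, M.map_one]

theorem hasFDerivAt_exp_mul_exp_neg {Z : E} (hZ : HasFDerivAt (M.twistedConj Z)
      ((NormedSpace.exp (M.ad Z)).coprod (expInt (M.ad Z) 1)) 0) :
    HasFDerivAt (fun W : E => M.chart (M.exp W * M.exp (-Z))) (expInt (M.ad Z) 1) Z := by
  have hincl : HasFDerivAt (fun W : E => ((0 : E), W - Z)) (ContinuousLinearMap.inr ℝ E E) Z :=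
    (hasFDerivAt_const (0 : E) Z).prodMk ((hasFDerivAt_id Z).sub_const Z)
  have hcomp := HasFDerivAt.comp (f := fun W : E => ((0 : E), W - Z)) Z
    (g := M.twistedConj Z) (by rw [sub_self]; exact hZ) hincl
  convert! hcomp using 1
  · funext W; simp [twistedConj, M.symm_zero]
  · ext v; simp

theorem hasFDerivAt_conj {Z : E} (hZ : HasFDerivAt (M.twistedConj Z)
      ((NormedSpace.exp (M.ad Z)).coprod (expInt (M.ad Z) 1)) 0) :
    HasFDerivAt (fun y : E => M.chart (M.exp Z * M.chart.symm y * M.exp (-Z)))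
      (NormedSpace.exp (M.ad Z)) 0 := by
  have hcomp := HasFDerivAt.comp (f := fun y : E => (y, (0 : E))) 0
    (g := M.twistedConj Z) hZ (hasFDerivAt_prodMk_left 0 0)
  convert! hcomp using 1
  · funext W; simp [twistedConj]
  · ext v; simp

theorem tendsto_expInt_ad [CompleteSpace E] :
    Tendsto (fun Z => expInt (M.ad Z) 1) (𝓝 0) (𝓝 1) :=
  (continuous_expInt_one.comp M.ad.continuous).tendsto' _ _ (by simp [expInt_zero_one])

section IsTopologicalGroup

variable [IsTopologicalGroup G]

theorem hasDerivAt_exp_smul_mul_mul_exp_smul {A B : E} {g : G} {s : ℝ}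
    (hs : M.exp (s • A) * g * M.exp (s • B) ∈ M.chart.source)
    (hr : DifferentiableAt ℝ M.mul (0, M.chart (M.exp (s • A) * g * M.exp (s • B))))
    (hl : DifferentiableAt ℝ M.mul (M.chart (M.exp (s • A) * g * M.exp (s • B)), 0)) :
    HasDerivAt (fun t : ℝ => M.chart (M.exp (t • A) * g * M.exp (t • B)))
      (M.right (M.chart (M.exp (s • A) * g * M.exp (s • B))) A +
        M.left (M.chart (M.exp (s • A) * g * M.exp (s • B))) B) s := by
  set k : G := M.exp (s • A) * g * M.exp (s • B) with hk
  have hzero : HasDerivAt (fun t : ℝ => M.chart (M.exp (t • A) * k * M.exp (t • B)))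
      (M.right (M.chart k) A + M.left (M.chart k) B) 0 := by
    refine (M.hasDerivAt_mul_mul_chart_exp (M.chart.map_source hs) hr hl A B).congr_of_eventuallyEq
      ?_
    have hkB : Tendsto (fun t : ℝ => k * M.exp (t • B)) (𝓝 0) (𝓝 k) := by
      simpa using tendsto_const_nhds.mul (M.tendsto_exp_smul B)
    filter_upwards [(M.tendsto_exp_smul A).eventually (M.source_mem_nhds M.one_mem),
      (M.tendsto_exp_smul B).eventually (M.source_mem_nhds M.one_mem),
      hkB.eventually (M.source_mem_nhds hs)] with t hA hB hkB
    simp only [GroupChart.mul]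
    rw [M.chart.left_inv hs, M.chart.left_inv hA, M.chart.left_inv hB, M.chart.left_inv hkB,
      mul_assoc]
  rw [← sub_self s] at hzero
  convert! hzero.comp_sub_const s s using 1
  funext t
  have hA : M.exp (t • A) = M.exp ((t - s) • A) * M.exp (s • A) := by
    rw [← M.exp_add_smul, sub_add_cancel]
  have hB : M.exp (t • B) = M.exp (s • B) * M.exp ((t - s) • B) := by
    rw [← M.exp_add_smul, add_sub_cancel]
  rw [hA, hB, hk]
  simp only [mul_assoc]

theorem eventually_exp_smul_mul_mul_exp_smul_mem {U : Set G} (hU : U ∈ 𝓝 1) :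
    ∀ᶠ q in 𝓝 (0 : E × E × E), ∀ s ∈ Icc (0 : ℝ) 1,
      M.exp (s • q.1) * M.chart.symm q.2.1 * M.exp (s • q.2.2) ∈ U := by
  have hexp₁ : Tendsto (fun q : E × E × E => M.exp q.1) (𝓝 0) (𝓝 1) :=
    M.tendsto_exp.comp (Continuous.tendsto' (by fun_prop) _ _ (by simp))
  have hexp₂ : Tendsto (fun q : E × E × E => M.exp q.2.2) (𝓝 0) (𝓝 1) :=
    M.tendsto_exp.comp (Continuous.tendsto' (by fun_prop) _ _ (by simp))
  have hsymm : Tendsto (fun q : E × E × E => M.chart.symm q.2.1) (𝓝 0) (𝓝 1) := by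
    have hcont := M.chart.symm.continuousAt M.zero_mem_target
    rw [ContinuousAt, M.symm_zero] at hcont
    exact hcont.comp (Continuous.tendsto' (by fun_prop) _ _ (by simp))
  have hprod : Tendsto (fun q : E × E × E => M.exp q.1 * M.chart.symm q.2.1 * M.exp q.2.2)
      (𝓝 0) (𝓝 1) := by
    simpa using (hexp₁.mul hsymm).mul hexp₂
  obtain ⟨r, hr, hball⟩ := Metric.eventually_nhds_iff.1 (hprod.eventually hU)
  filter_upwards [Metric.ball_mem_nhds 0 hr] with q hq s hs
  refine @hball (s • q.1, q.2.1, s • q.2.2) ?_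
  have hsmul : ∀ v : E, ‖s • v‖ ≤ ‖v‖ := fun v => by
    rw [norm_smul, Real.norm_of_nonneg hs.1]
    exact mul_le_of_le_one_left (norm_nonneg v) hs.2
  rw [mem_ball_zero_iff] at hq
  rw [dist_zero_right]
  exact (max_le_max (hsmul _) (max_le_max le_rfl (hsmul _))).trans_lt hq

theorem eventually_exp_mul_exp_neg_mem_source :
    ∀ᶠ Z in 𝓝 (0 : E), ∀ᶠ W in 𝓝 Z, M.exp W * M.exp (-Z) ∈ M.chart.source := by
  have hexp : Tendsto (fun q : E × E => M.exp (q.1 + q.2) * M.exp (-q.1)) (𝓝 (0, 0)) (𝓝 1) := by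
    have hadd : Tendsto (fun q : E × E => M.exp (q.1 + q.2)) (𝓝 (0, 0)) (𝓝 1) :=
      M.tendsto_exp.comp (Continuous.tendsto' (by fun_prop) _ _ (by simp))
    have hneg : Tendsto (fun q : E × E => M.exp (-q.1)) (𝓝 (0, 0)) (𝓝 1) :=
      M.tendsto_exp.comp (Continuous.tendsto' (by fun_prop) _ _ (by simp))
    simpa using hadd.mul hneg
  filter_upwards [(hexp.eventually (M.source_mem_nhds M.one_mem)).curry_nhds] with Z hZ
  have hsub : Tendsto (fun W : E => W - Z) (𝓝 Z) (𝓝 0) :=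
    Continuous.tendsto' (by fun_prop) _ _ (sub_self Z)
  filter_upwards [hsub.eventually hZ] with W hW
  rwa [add_sub_cancel] at hW

variable [CompleteSpace E]

/-- The curve `exp (s (Z + h)) · y · exp (- s Z)` leads from `y` to `M.twistedConj Z (y, h)`, and in
the chart it solves `c' = [Z, c] + h + o (|c| + |h|)`. -/
theorem eventually_hasFDerivAt_twistedConj :
    ∀ᶠ Z in 𝓝 (0 : E), HasFDerivAt (M.twistedConj Z)
      ((NormedSpace.exp (M.ad Z)).coprod (expInt (M.ad Z) 1)) 0 := by
  have hdiffr : ∀ᶠ x in 𝓝 (0 : E), DifferentiableAt ℝ M.mul (0, x) :=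
    (Continuous.tendsto' (f := fun x : E => ((0 : E), x)) (by fun_prop) 0 0 rfl).eventually
      M.eventually_differentiableAt_mul
  have hdiffl : ∀ᶠ x in 𝓝 (0 : E), DifferentiableAt ℝ M.mul (x, 0) :=
    (Continuous.tendsto' (f := fun x : E => (x, (0 : E))) (by fun_prop) 0 0 rfl).eventually
      M.eventually_differentiableAt_mul
  obtain ⟨ρ, hρ, hball⟩ := Metric.eventually_nhds_iff.1
    ((M.eventually_norm_remainder_le one_pos).and (hdiffr.and hdiffl))
  simp only [dist_zero_right, one_mul] at hball
  have hchart : ∀ᶠ g in 𝓝 (1 : G), ‖M.chart g‖ < ρ := by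
    have hcont := M.chart.continuousAt M.one_mem
    rw [ContinuousAt, M.map_one] at hcont
    simpa using hcont.eventually (Metric.ball_mem_nhds _ hρ)
  have hends : Tendsto (fun w : E × E × E => (w.1 + w.2.2, w.2.1, -w.1)) (𝓝 (0, 0)) (𝓝 0) :=
    Continuous.tendsto' (by fun_prop) _ _ (by simp)
  have hcurve := (hends.eventually (M.eventually_exp_smul_mul_mul_exp_smul_mem
    (inter_mem (M.source_mem_nhds M.one_mem) hchart))).curry_nhds
  filter_upwards [hcurve, Metric.closedBall_mem_nhds (0 : E) one_pos] with Z htube hZ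
  rw [mem_closedBall_zero_iff] at hZ
  refine hasFDerivAt_of_perturbed_linear_flow (R := M.remainder Z)
    (fun x h hx => (hball hx).1 Z h hZ)
    (fun η hη => (M.eventually_norm_remainder_le hη).mono fun x hx h => hx Z h hZ)
    (M.twistedConj_zero Z) ?_
  have htarget : ∀ᶠ p in 𝓝 (0 : E × E), p.1 ∈ M.chart.target :=
    continuous_fst.continuousAt.eventually (M.target_mem_nhds M.zero_mem_target)
  filter_upwards [htube, htarget] with p hp hp₁
  refine ⟨fun s => M.chart (M.exp (s • (Z + p.2)) * M.chart.symm p.1 * M.exp (s • -Z)), ?_, ?_,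
    fun s hs => ⟨(hp s hs).2, ?_⟩⟩
  · simp [M.exp_zero, M.chart.right_inv hp₁]
  · simp [twistedConj]
  · obtain ⟨-, hr, hl⟩ := hball (hp s hs).2
    simpa only [M.right_add_left_neg] using
      M.hasDerivAt_exp_smul_mul_mul_exp_smul (hp s hs).1 hr hl

theorem eventually_hasFDerivAt_chart_exp :
    ∀ᶠ Z in 𝓝 (0 : E), HasFDerivAt (fun Z => M.chart (M.exp Z))
      ((M.right (M.chart (M.exp Z))).comp (expInt (M.ad Z) 1)) Z := by
  have hdiff : ∀ᶠ Z in 𝓝 (0 : E), DifferentiableAt ℝ M.mul (0, M.chart (M.exp Z)) :=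
    (tendsto_const_nhds.prodMk_nhds M.tendsto_chart_exp).eventually
      M.eventually_differentiableAt_mul
  filter_upwards [M.eventually_exp_mul_exp_neg_mem_source, hdiff,
    M.eventually_hasFDerivAt_twistedConj, M.eventually_exp_mem_source] with Z hsource hmul hZ hexp
  have hmul' : HasFDerivAt M.mul (fderiv ℝ M.mul (0, M.chart (M.exp Z)))
      (M.chart (M.exp Z * M.exp (-Z)), M.chart (M.exp Z)) := by
    simpa [M.exp_neg, M.map_one] using hmul.hasFDerivAt
  have hcomp : HasFDerivAt
      (fun W => M.mul (M.chart (M.exp W * M.exp (-Z)), M.chart (M.exp Z)))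
      ((M.right (M.chart (M.exp Z))).comp (expInt (M.ad Z) 1)) Z :=
    HasFDerivAt.comp (g := M.mul)
      (f := fun W => (M.chart (M.exp W * M.exp (-Z)), M.chart (M.exp Z))) Z hmul'
      ((M.hasFDerivAt_exp_mul_exp_neg hZ).prodMk (hasFDerivAt_const _ _))
  refine hcomp.congr_of_eventuallyEq ?_
  filter_upwards [hsource] with W hW
  rw [GroupChart.mul, M.chart.left_inv hW, M.chart.left_inv hexp, M.exp_neg, inv_mul_cancel_right]

theorem hasStrictFDerivAt_chart_exp :
    HasStrictFDerivAt (fun Z => M.chart (M.exp Z)) (1 : E →L[ℝ] E) 0 := by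
  have hright : Tendsto (fun Z => M.right (M.chart (M.exp Z))) (𝓝 0) (𝓝 1) := by
    have hcont := M.contDiffAt_right.continuousAt
    rw [ContinuousAt, M.right_zero] at hcont
    exact hcont.comp M.tendsto_chart_exp
  have hcont : ContinuousAt
      (fun Z => (M.right (M.chart (M.exp Z))).comp (expInt (M.ad Z) 1)) 0 := by
    refine ContinuousAt.clm_comp ?_ ?_
    · simpa [ContinuousAt, M.exp_zero, M.map_one, M.right_zero] using hright
    · exact (continuous_expInt_one.comp M.ad.continuous).continuousAt
  simpa [M.exp_zero, M.map_one, M.right_zero, expInt_zero_one, ContinuousLinearMap.one_def]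
    using hasStrictFDerivAt_of_hasFDerivAt_of_continuousAt M.eventually_hasFDerivAt_chart_exp hcont

theorem exists_openPartialHomeomorph_exp :
    ∃ e : OpenPartialHomeomorph E G, 0 ∈ e.source ∧ EqOn e M.exp e.source := by
  have hderiv : HasStrictFDerivAt (fun Z => M.chart (M.exp Z))
    ((ContinuousLinearEquiv.refl ℝ E : E ≃L[ℝ] E) : E →L[ℝ] E) 0 := M.hasStrictFDerivAt_chart_exp
  let e := (hderiv.toOpenPartialHomeomorph _).trans M.chart.symm
  obtain ⟨U, hU, hUo, h0⟩ := mem_nhds_iff.1 M.eventually_exp_mem_source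
  refine ⟨e.restrOpen U hUo, ?_, ?_⟩
  · rw [OpenPartialHomeomorph.restrOpen_source]
    refine ⟨?_, h0⟩
    rw [OpenPartialHomeomorph.trans_source]
    refine ⟨hderiv.mem_toOpenPartialHomeomorph_source, ?_⟩
    simpa [M.exp_zero, M.map_one] using M.zero_mem_target
  · intro Z hZ
    rw [OpenPartialHomeomorph.restrOpen_source] at hZ
    exact M.chart.left_inv (hU hZ.2)

end IsTopologicalGroup

end ExpChart

/-! ### The Baker-Campbell-Hausdorff formula with remainder -/

section BchInt

variable {E : Type*} [NormedAddCommGroup E] [NormedSpace ℝ E]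

/-- The integrand of `bchInt`: a truncated form of the velocity of `t ↦ log (exp (t X) exp (t Y))`,
in terms of the bracket `ad` alone. -/
noncomputable def bchIntegrand (ad : E →L[ℝ] E →L[ℝ] E) (K : ℕ) (X Y : E) (t : ℝ) : E :=
  logTrunc K (NormedSpace.exp (t • ad X) * NormedSpace.exp (t • ad Y) - 1)
    (X + NormedSpace.exp (t • ad X) Y)

/-- The Baker-Campbell-Hausdorff product of the bracket `ad` in Poincaré's integral form, with the
logarithmic series truncated at order `K`. It is exact if `ad` is nilpotent of step `K`. -/
noncomputable def bchInt (ad : E →L[ℝ] E →L[ℝ] E) (K : ℕ) (X Y : E) : E :=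
  ∫ t in (0 : ℝ)..1, bchIntegrand ad K X Y t

theorem norm_clm_pow_le {a : E →L[ℝ] E} {c : ℝ} (ha : ‖a‖ ≤ c) (K : ℕ) : ‖a ^ K‖ ≤ c ^ K := by
  rcases K.eq_zero_or_pos with rfl | hK
  · rw [pow_zero, pow_zero]
    exact ContinuousLinearMap.norm_id_le
  · exact (norm_pow_le' a hK).trans (pow_le_pow_left₀ (norm_nonneg a) ha K)

theorem norm_smul_le_of_mem_Icc {t : ℝ} (ht : t ∈ Icc (0 : ℝ) 1) (x : E) : ‖t • x‖ ≤ ‖x‖ := by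
  rw [norm_smul, Real.norm_of_nonneg ht.1]
  exact mul_le_of_le_one_left (norm_nonneg x) ht.2

theorem eventually_forall_smul_of_eventually {P : E → Prop} (hP : ∀ᶠ x in 𝓝 0, P x) :
    ∀ᶠ x in 𝓝 (0 : E), ∀ t ∈ Icc (0 : ℝ) 1, P (t • x) := by
  obtain ⟨r, hr, hball⟩ := Metric.eventually_nhds_iff.1 hP
  filter_upwards [Metric.ball_mem_nhds 0 hr] with x hx t ht
  refine hball ?_
  rw [dist_zero_right]
  exact (norm_smul_le_of_mem_Icc ht x).trans_lt (mem_ball_zero_iff.1 hx)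

variable [CompleteSpace E]

theorem continuous_bchIntegrand {T : Type*} [TopologicalSpace T] {K : ℕ}
    {B : T → E →L[ℝ] E →L[ℝ] E} {x y : T → E} {t : T → ℝ} (hB : Continuous B) (hx : Continuous x)
    (hy : Continuous y) (ht : Continuous t) :
    Continuous fun p => bchIntegrand (B p) K (x p) (y p) (t p) := by
  have hexpx : Continuous fun p => NormedSpace.exp (t p • B p (x p)) :=
    continuous_exp_comp (by fun_prop)
  have hexpy : Continuous fun p => NormedSpace.exp (t p • B p (y p)) :=
    continuous_exp_comp (by fun_prop)
  exact ((continuous_logTrunc K).comp ((hexpx.mul hexpy).sub continuous_const)).clm_apply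
    (hx.add (hexpx.clm_apply hy))

theorem continuous_bchInt {T : Type*} [TopologicalSpace T] {K : ℕ}
    {B : T → E →L[ℝ] E →L[ℝ] E} {x y : T → E} (hB : Continuous B) (hx : Continuous x)
    (hy : Continuous y) : Continuous fun p => bchInt (B p) K (x p) (y p) :=
  intervalIntegral.continuous_parametric_intervalIntegral_of_continuous'
    (continuous_bchIntegrand (T := T × ℝ) (hB.comp continuous_fst) (hx.comp continuous_fst)
      (hy.comp continuous_fst) continuous_snd) 0 1

theorem units_apply_bchIntegrand (u : (E →L[ℝ] E)ˣ) {B ad : E →L[ℝ] E →L[ℝ] E}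
    (hu : ∀ X Y, u.1 (B X Y) = ad (u.1 X) (u.1 Y)) (K : ℕ) (X Y : E) (t : ℝ) :
    u.1 (bchIntegrand B K X Y t) = bchIntegrand ad K (u.1 X) (u.1 Y) t := by
  let _ : NormedAlgebra ℚ (E →L[ℝ] E) := NormedAlgebra.restrictScalars ℚ ℝ _
  have hinv : ∀ v : E, (↑u⁻¹ : E →L[ℝ] E) (u.1 v) = v := DFunLike.congr_fun u.inv_mul
  have hconj : ∀ X, ad (u.1 X) = u * B X * ↑u⁻¹ := fun X => by
    ext v
    have hv : u.1 ((↑u⁻¹ : E →L[ℝ] E) v) = v := DFunLike.congr_fun u.mul_inv v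
    simp only [mul_apply_eq_comp, hu, hv]
  have hexp : ∀ X, NormedSpace.exp (t • ad (u.1 X)) =
      u * NormedSpace.exp (t • B X) * ↑u⁻¹ := fun X => by
    rw [← NormedSpace.exp_units_conj, hconj, mul_smul_comm, smul_mul_assoc]
  have hprod : NormedSpace.exp (t • ad (u.1 X)) * NormedSpace.exp (t • ad (u.1 Y)) - 1 =
      u * (NormedSpace.exp (t • B X) * NormedSpace.exp (t • B Y) - 1) * ↑u⁻¹ := by
    rw [hexp, hexp, mul_sub, sub_mul, mul_one, Units.mul_inv]
    simp only [mul_assoc, Units.inv_mul_cancel_left]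
  rw [bchIntegrand, bchIntegrand, hprod, hexp, logTrunc_units_conj]
  simp only [mul_apply_eq_comp, hinv, map_add]

theorem units_apply_bchInt (u : (E →L[ℝ] E)ˣ) {B ad : E →L[ℝ] E →L[ℝ] E}
    (hu : ∀ X Y, u.1 (B X Y) = ad (u.1 X) (u.1 Y)) (K : ℕ) (X Y : E) :
    u.1 (bchInt B K X Y) = bchInt ad K (u.1 X) (u.1 Y) := by
  have hint : IntervalIntegrable (bchIntegrand B K X Y) MeasureTheory.volume 0 1 :=
    (continuous_bchIntegrand (T := ℝ) continuous_const continuous_const continuous_const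
      continuous_id).intervalIntegrable _ _
  simp only [bchInt, ← u.1.intervalIntegral_comp_comm hint, units_apply_bchIntegrand u hu]

theorem norm_sub_logTrunc_expInt_apply_le {a : E →L[ℝ] E} {c : ℝ}
    (ha : ∀ s ∈ Icc (0 : ℝ) 1, ‖NormedSpace.exp (s • a) - 1‖ ≤ c) (K : ℕ) (v : E) :
    ‖v - logTrunc K (NormedSpace.exp a - 1) (expInt a 1 v)‖ ≤ c ^ K * ‖v‖ := by
  have hremainder : v - logTrunc K (NormedSpace.exp a - 1) (expInt a 1 v) =
      (∫ s in (0 : ℝ)..1, (-(NormedSpace.exp (s • a) - 1)) ^ K) v := by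
    rw [← mul_apply_eq_comp, logTrunc_mul_expInt, sub_apply, one_apply_eq_self, sub_sub_cancel]
  have hint : ‖∫ s in (0 : ℝ)..1, (-(NormedSpace.exp (s • a) - 1)) ^ K‖ ≤ c ^ K := by
    simpa using intervalIntegral.norm_integral_le_of_norm_le_const (a := 0) (b := 1)
      (f := fun s : ℝ => (-(NormedSpace.exp (s • a) - 1)) ^ K) (C := c ^ K) fun s hs => by
        rw [uIoc_of_le zero_le_one] at hs
        exact norm_clm_pow_le ((norm_neg _).trans_le (ha s (Ioc_subset_Icc_self hs))) K
  exact hremainder ▸ ContinuousLinearMap.le_of_opNorm_le _ hint v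

end BchInt

namespace ExpChart

variable {E G : Type*} [NormedAddCommGroup E] [NormedSpace ℝ E] [TopologicalSpace G] [Group G]
  (M : ExpChart E G)

/-- The vectors `Z` so close to `0` that the formula for the derivative of the exponential map and
the estimates behind the Baker-Campbell-Hausdorff formula hold at `Z`. -/
structure IsSmall (Z : E) : Prop where
  hasFDerivAt_twistedConj : HasFDerivAt (M.twistedConj Z)
    ((NormedSpace.exp (M.ad Z)).coprod (expInt (M.ad Z) 1)) 0
  norm_one_sub_expInt : ‖1 - expInt (M.ad Z) 1‖ ≤ 1 / 2
  norm_exp : ‖NormedSpace.exp (M.ad Z)‖ ≤ 2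
  norm_exp_sub_one : ∀ s ∈ Icc (0 : ℝ) 1, ‖NormedSpace.exp (s • M.ad Z) - 1‖ ≤ 2 * ‖M.ad Z‖

variable {M} in
theorem IsSmall.norm_le {Z : E} (hZ : M.IsSmall Z) (v : E) :
    ‖v‖ ≤ 2 * ‖expInt (M.ad Z) 1 v‖ := by
  have hle := (1 - expInt (M.ad Z) 1).le_of_opNorm_le hZ.norm_one_sub_expInt v
  have htri := norm_sub_norm_le v (expInt (M.ad Z) 1 v)
  simp only [sub_apply, one_apply_eq_self] at hle
  linarith

variable {M} in
theorem IsSmall.isUnit_expInt [CompleteSpace E] {Z : E} (hZ : M.IsSmall Z) :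
    IsUnit (expInt (M.ad Z) 1) := by
  simpa using isUnit_one_sub_of_norm_lt_one (hZ.norm_one_sub_expInt.trans_lt (by norm_num))

/-- The pairs `(X, Y)` at which the derivative of the logarithm of `exp X · exp Y` is controlled,
where the logarithm is the inverse of the local homeomorphism `e`. -/
structure IsSmallPair (e : OpenPartialHomeomorph E G) (X Y : E) : Prop where
  left : M.IsSmall X
  right : M.IsSmall Y
  mem_target : M.exp X * M.exp Y ∈ e.target
  log : M.IsSmall (e.symm (M.exp X * M.exp Y))

variable {M} in
theorem IsSmallPair.exp_log {e : OpenPartialHomeomorph E G} (he : EqOn e M.exp e.source) {X Y : E}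
    (h : M.IsSmallPair e X Y) :
    M.exp (e.symm (M.exp X * M.exp Y)) = M.exp X * M.exp Y := by
  rw [← he (e.map_target h.mem_target), e.right_inv h.mem_target]

variable {M} in
theorem IsSmallPair.norm_le_of_expInt_eq {e : OpenPartialHomeomorph E G} {X Y : E} {t : ℝ}
    (h : M.IsSmallPair e (t • X) (t • Y)) {v : E}
    (hv : expInt (M.ad (e.symm (M.exp (t • X) * M.exp (t • Y)))) 1 v =
      X + NormedSpace.exp (t • M.ad X) Y) : ‖v‖ ≤ 6 * ‖(X, Y)‖ := by
  have hexp := h.left.norm_exp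
  rw [map_smul] at hexp
  calc ‖v‖ ≤ 2 * ‖X + NormedSpace.exp (t • M.ad X) Y‖ := hv ▸ h.log.norm_le v
    _ ≤ 2 * (‖X‖ + 2 * ‖Y‖) := by
      gcongr
      exact (norm_add_le _ _).trans
        (add_le_add le_rfl (ContinuousLinearMap.le_of_opNorm_le _ hexp Y))
    _ ≤ 2 * (‖(X, Y)‖ + 2 * ‖(X, Y)‖) := by
      gcongr
      exacts [norm_fst_le (X, Y), norm_snd_le (X, Y)]
    _ = 6 * ‖(X, Y)‖ := by ring

variable [IsTopologicalGroup G]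

theorem tendsto_exp_mul_exp :
    Tendsto (fun q : E × E => M.exp q.1 * M.exp q.2) (𝓝 0) (𝓝 1) := by
  have hfst : Tendsto (fun q : E × E => M.exp q.1) (𝓝 0) (𝓝 1) :=
    M.tendsto_exp.comp (Continuous.tendsto' (by fun_prop) _ _ (by simp))
  have hsnd : Tendsto (fun q : E × E => M.exp q.2) (𝓝 0) (𝓝 1) :=
    M.tendsto_exp.comp (Continuous.tendsto' (by fun_prop) _ _ (by simp))
  simpa using hfst.mul hsnd

theorem tendsto_symm_mul (g : G) : Tendsto (fun y => M.chart.symm y * g) (𝓝 0) (𝓝 g) := by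
  have hsymm := M.chart.symm.continuousAt M.zero_mem_target
  rw [ContinuousAt, M.symm_zero] at hsymm
  simpa using hsymm.mul (tendsto_const_nhds (x := g))

theorem tendsto_exp_mul_mul_exp_neg (Z : E) {ι : Type*} {l : Filter ι} {g : ι → G}
    (hg : Tendsto g l (𝓝 1)) : Tendsto (fun i => M.exp Z * g i * M.exp (-Z)) l (𝓝 1) := by
  simpa [M.exp_neg] using ((tendsto_const_nhds (x := M.exp Z)).mul hg).mul
    (tendsto_const_nhds (x := M.exp (-Z)))

variable {M} in
theorem IsSmall.exp_ad_eq_mul {A B Z : E} (hA : M.IsSmall A) (hB : M.IsSmall B)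
    (hZ : M.IsSmall Z) (h : M.exp Z = M.exp A * M.exp B) :
    NormedSpace.exp (M.ad Z) = NormedSpace.exp (M.ad A) * NormedSpace.exp (M.ad B) := by
  have hconjZ := M.hasFDerivAt_conj hZ.hasFDerivAt_twistedConj
  have hconjA := M.hasFDerivAt_conj hA.hasFDerivAt_twistedConj
  have hconjB := M.hasFDerivAt_conj hB.hasFDerivAt_twistedConj
  have hzero : M.chart (M.exp B * M.chart.symm 0 * M.exp (-B)) = 0 := by
    simp [M.symm_zero, M.exp_neg, M.map_one]
  rw [← hzero] at hconjA
  refine hconjZ.unique ((HasFDerivAt.comp (0 : E) hconjA hconjB).congr_of_eventuallyEq ?_)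
  have hsymm : Tendsto M.chart.symm (𝓝 0) (𝓝 1) := by simpa using M.tendsto_symm_mul 1
  filter_upwards [(M.tendsto_exp_mul_mul_exp_neg B hsymm).eventually
    (M.source_mem_nhds M.one_mem)] with y hy
  simp only [Function.comp]
  rw [M.chart.left_inv hy]
  simp only [M.exp_neg, h, mul_inv_rev, mul_assoc]

variable {M} in
theorem IsSmall.hasDerivAt_exp_smul_mul_conj {A : E} (hA : M.IsSmall A) (X Y : E) :
    HasDerivAt (fun τ : ℝ => M.chart (M.exp (τ • X) * (M.exp A * M.exp (τ • Y) * M.exp (-A))))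
      (X + NormedSpace.exp (M.ad A) Y) 0 := by
  let F : E → E := fun y => M.chart (M.exp A * M.chart.symm y * M.exp (-A))
  have hF0 : F 0 = 0 := by simp [F, M.symm_zero, M.exp_neg, M.map_one]
  have hF : HasDerivAt (fun τ : ℝ => F (M.chart (M.exp (τ • Y)))) (NormedSpace.exp (M.ad A) Y) 0 :=
    HasFDerivAt.comp_hasDerivAt (l := F) (0 : ℝ)
      (by simpa [M.exp_zero, M.map_one] using M.hasFDerivAt_conj hA.hasFDerivAt_twistedConj)
      (M.hasDerivAt_exp Y)
  have hd : DifferentiableAt ℝ M.mul (0, 0) := M.eventually_differentiableAt_mul.self_of_nhds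
  have hmul : HasFDerivAt M.mul (fderiv ℝ M.mul (0, 0))
      (M.chart (M.exp ((0 : ℝ) • X)), F (M.chart (M.exp ((0 : ℝ) • Y)))) := by
    simpa [M.exp_zero, M.map_one, hF0] using hd.hasFDerivAt
  have hadd : fderiv ℝ M.mul (0, 0) (X, NormedSpace.exp (M.ad A) Y) =
      X + NormedSpace.exp (M.ad A) Y := by
    rw [← zero_add (NormedSpace.exp (M.ad A) Y), ← add_zero X, ← Prod.mk_add_mk, map_add,
      M.fderiv_mul_zero_left M.zero_mem_target hd, M.fderiv_mul_zero_right M.zero_mem_target hd,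
      add_zero, zero_add]
  rw [← hadd]
  refine (HasFDerivAt.comp_hasDerivAt (0 : ℝ) hmul
    ((M.hasDerivAt_exp X).prodMk hF)).congr_of_eventuallyEq ?_
  have hone := M.source_mem_nhds M.one_mem
  filter_upwards [(M.tendsto_exp_smul X).eventually hone, (M.tendsto_exp_smul Y).eventually hone,
    (M.tendsto_exp_mul_mul_exp_neg A (M.tendsto_exp_smul Y)).eventually hone] with τ hX hY hconj
  simp only [F, GroupChart.mul, Function.comp]
  rw [M.chart.left_inv hX, M.chart.left_inv hY, M.chart.left_inv hconj]

variable {M} in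
theorem IsSmall.hasFDerivAt_log_mul_exp {e : OpenPartialHomeomorph E G}
    (he : EqOn e M.exp e.source) {Z : E} (hZ : M.IsSmall Z) (hZe : Z ∈ e.source)
    {u : (E →L[ℝ] E)ˣ} (hu : u = expInt (M.ad Z) 1) :
    HasFDerivAt (fun y => e.symm (M.chart.symm y * M.exp Z)) (↑u⁻¹ : E →L[ℝ] E) 0 := by
  have hexp : e.symm (M.exp Z) = Z := by rw [← he hZe, e.left_inv hZe]
  have hmem : M.exp Z ∈ e.target := he hZe ▸ e.map_source hZe
  have hprod := M.tendsto_symm_mul (M.exp Z)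
  refine HasFDerivAt.of_local_left_inverse (f := fun W : E => M.chart (M.exp W * M.exp (-Z)))
    (f' := ContinuousLinearEquiv.ofUnit u) ?_ ?_ ?_
  · simpa [ContinuousAt, M.symm_zero, Function.comp_def] using
      (e.symm.continuousAt hmem).tendsto.comp hprod
  · rw [M.symm_zero, one_mul, hexp]
    rw [show (ContinuousLinearEquiv.ofUnit u : E →L[ℝ] E) = expInt (M.ad Z) 1 from hu]
    exact M.hasFDerivAt_exp_mul_exp_neg hZ.hasFDerivAt_twistedConj
  · filter_upwards [hprod.eventually (e.open_target.mem_nhds hmem),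
      M.target_mem_nhds M.zero_mem_target] with y hy hyt
    rw [← he (e.map_target hy), e.right_inv hy, M.exp_neg, mul_inv_cancel_right,
      M.chart.right_inv hyt]

variable [CompleteSpace E]

theorem eventually_isSmall : ∀ᶠ Z in 𝓝 (0 : E), M.IsSmall Z := by
  have hexpInt : ∀ᶠ Z in 𝓝 (0 : E), ‖1 - expInt (M.ad Z) 1‖ ≤ 1 / 2 := by
    filter_upwards [M.tendsto_expInt_ad.eventually
      (Metric.closedBall_mem_nhds 1 (show (0 : ℝ) < 1 / 2 by norm_num))] with Z hZ
    rwa [← dist_eq_norm, dist_comm]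
  have had : Tendsto M.ad (𝓝 0) (𝓝 0) := M.ad.continuous.tendsto' 0 0 (map_zero _)
  have hle : ∀ᶠ Z in 𝓝 (0 : E), ‖M.ad Z‖ ≤ 1 / 2 := by
    simpa using had.eventually (Metric.closedBall_mem_nhds 0 (show (0 : ℝ) < 1 / 2 by norm_num))
  filter_upwards [M.eventually_hasFDerivAt_twistedConj, hexpInt, hle, had.eventually
    (eventually_forall_smul_of_eventually eventually_norm_exp_sub_one_le)]
    with Z hderiv hinv hZ hexp
  have hexp' : ∀ s ∈ Icc (0 : ℝ) 1, ‖NormedSpace.exp (s • M.ad Z) - 1‖ ≤ 2 * ‖M.ad Z‖ :=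
    fun s hs => (hexp s hs).trans (by gcongr; exact norm_smul_le_of_mem_Icc hs _)
  have hone : ‖(1 : E →L[ℝ] E)‖ ≤ 1 := ContinuousLinearMap.norm_id_le
  refine ⟨hderiv, hinv, ?_, hexp'⟩
  calc ‖NormedSpace.exp (M.ad Z)‖ = ‖(NormedSpace.exp ((1 : ℝ) • M.ad Z) - 1) + 1‖ := by
        rw [one_smul, sub_add_cancel]
    _ ≤ 2 * ‖M.ad Z‖ + 1 := (norm_add_le _ _).trans (add_le_add (hexp' 1 (by simp)) hone)
    _ ≤ 2 := by linarith

variable {M} {e : OpenPartialHomeomorph E G}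

theorem eventually_isSmallPair (h0 : 0 ∈ e.source) (he : EqOn e M.exp e.source) :
    ∀ᶠ q in 𝓝 (0 : E × E), M.IsSmallPair e q.1 q.2 := by
  have he0 : e 0 = 1 := by rw [he h0, M.exp_zero]
  have hone : (1 : G) ∈ e.target := he0 ▸ e.map_source h0
  have hlog : Tendsto (fun q : E × E => e.symm (M.exp q.1 * M.exp q.2)) (𝓝 0) (𝓝 0) := by
    have hcont := (e.symm.continuousAt (x := 1) hone).tendsto
    rw [← he0, e.left_inv h0, he0] at hcont
    exact hcont.comp M.tendsto_exp_mul_exp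
  filter_upwards [(continuous_fst.tendsto (0 : E × E)).eventually M.eventually_isSmall,
    (continuous_snd.tendsto (0 : E × E)).eventually M.eventually_isSmall,
    M.tendsto_exp_mul_exp.eventually (e.open_target.mem_nhds hone),
    hlog.eventually M.eventually_isSmall] with q hX hY hmem hZ
  exact ⟨hX, hY, hmem, hZ⟩

/-- With `Z = log (exp (t X) exp (t Y))`, the product at time `t + τ` is
`exp (τ X) · (exp (t X) exp (τ Y) exp (- t X)) · exp Z`. -/
theorem IsSmallPair.exists_hasDerivAt_log (he : EqOn e M.exp e.source) {X Y : E} {t : ℝ}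
    (h : M.IsSmallPair e (t • X) (t • Y)) :
    ∃ v : E, HasDerivAt (fun t : ℝ => e.symm (M.exp (t • X) * M.exp (t • Y))) v t ∧
      expInt (M.ad (e.symm (M.exp (t • X) * M.exp (t • Y)))) 1 v =
        X + NormedSpace.exp (t • M.ad X) Y := by
  have hexpZ := h.exp_log he
  set Z := e.symm (M.exp (t • X) * M.exp (t • Y))
  obtain ⟨u, hu⟩ := h.log.isUnit_expInt
  have hlog := h.log.hasFDerivAt_log_mul_exp he (e.map_target h.mem_target) hu
  have hκ := h.left.hasDerivAt_exp_smul_mul_conj X Y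
  rw [map_smul] at hκ
  have hκ0 : M.chart (M.exp ((0 : ℝ) • X) *
      (M.exp (t • X) * M.exp ((0 : ℝ) • Y) * M.exp (-(t • X)))) = 0 := by
    simp [M.exp_zero, M.exp_neg, M.map_one]
  rw [← hκ0] at hlog
  have hcomp := hlog.comp_hasDerivAt (0 : ℝ) hκ
  rw [← sub_self t] at hcomp
  refine ⟨(↑u⁻¹ : E →L[ℝ] E) (X + NormedSpace.exp (t • M.ad X) Y),
    (hcomp.comp_sub_const t t).congr_of_eventuallyEq ?_,
    hu ▸ DFunLike.congr_fun u.mul_inv (X + NormedSpace.exp (t • M.ad X) Y)⟩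
  have hsub : Tendsto (fun τ : ℝ => τ - t) (𝓝 t) (𝓝 0) :=
    Continuous.tendsto' (by fun_prop) _ _ (sub_self t)
  have hprod : Tendsto (fun τ : ℝ => M.exp (τ • X) *
      (M.exp (t • X) * M.exp (τ • Y) * M.exp (-(t • X)))) (𝓝 0) (𝓝 1) := by
    simpa using (M.tendsto_exp_smul X).mul
      (M.tendsto_exp_mul_mul_exp_neg (t • X) (M.tendsto_exp_smul Y))
  filter_upwards [(hprod.comp hsub).eventually (M.source_mem_nhds M.one_mem)] with τ hτ
  have hX : M.exp (τ • X) = M.exp ((τ - t) • X) * M.exp (t • X) := by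
    rw [← M.exp_add_smul, sub_add_cancel]
  have hY : M.exp (τ • Y) = M.exp ((τ - t) • Y) * M.exp (t • Y) := by
    rw [← M.exp_add_smul, sub_add_cancel]
  simp only [Function.comp] at hτ ⊢
  rw [M.chart.left_inv hτ, hexpZ, M.exp_neg, hX, hY]
  congr 1
  group

theorem IsSmallPair.norm_sub_bchIntegrand_le (he : EqOn e M.exp e.source) {X Y : E} {t : ℝ}
    (h : M.IsSmallPair e (t • X) (t • Y)) {v : E}
    (hv : expInt (M.ad (e.symm (M.exp (t • X) * M.exp (t • Y)))) 1 v =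
      X + NormedSpace.exp (t • M.ad X) Y) (K : ℕ) :
    ‖v - bchIntegrand M.ad K X Y t‖ ≤
      (2 * ‖M.ad (e.symm (M.exp (t • X) * M.exp (t • Y)))‖) ^ K * ‖v‖ := by
  have hexp := h.left.exp_ad_eq_mul h.right h.log (h.exp_log he)
  rw [map_smul, map_smul] at hexp
  rw [bchIntegrand, ← hexp, ← hv]
  exact norm_sub_logTrunc_expInt_apply_le h.log.norm_exp_sub_one K v

theorem norm_log_sub_bchInt_le (h0 : 0 ∈ e.source) (he : EqOn e M.exp e.source) (K : ℕ) {X Y : E}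
    (h : ∀ t ∈ Icc (0 : ℝ) 1, M.IsSmallPair e (t • X) (t • Y)) :
    ‖e.symm (M.exp X * M.exp Y) - bchInt M.ad K X Y‖ ≤
      (2 * (‖M.ad‖ * 6)) ^ K * 6 * ‖(X, Y)‖ ^ (K + 1) := by
  let Z : ℝ → E := fun t => e.symm (M.exp (t • X) * M.exp (t • Y))
  have hZ0 : Z 0 = 0 := by
    simp only [Z, zero_smul, mul_one, M.exp_zero]
    rw [← M.exp_zero, ← he h0, e.left_inv h0]
  choose! v hv hexpInt using fun t ht => (h t ht).exists_hasDerivAt_log he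
  have hv_le : ∀ t ∈ Icc (0 : ℝ) 1, ‖v t‖ ≤ 6 * ‖(X, Y)‖ := fun t ht =>
    (h t ht).norm_le_of_expInt_eq (hexpInt t ht)
  have hZ_le : ∀ t ∈ Icc (0 : ℝ) 1, ‖Z t‖ ≤ 6 * ‖(X, Y)‖ := fun t ht => by
    have hmvt := norm_image_sub_le_of_norm_deriv_le_segment' (f := Z)
      (fun s hs => (hv s hs).hasDerivWithinAt) (fun s hs => hv_le s (Ico_subset_Icc_self hs)) t ht
    rw [hZ0, sub_zero, sub_zero] at hmvt
    exact hmvt.trans (mul_le_of_le_one_right (by positivity) ht.2)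
  have hcont : Continuous (bchIntegrand M.ad K X Y) :=
    continuous_bchIntegrand (T := ℝ) continuous_const continuous_const continuous_const
      continuous_id
  have hmvt := norm_image_sub_le_of_norm_deriv_le_segment_01'
    (f := fun t => Z t - ∫ u in (0 : ℝ)..t, bchIntegrand M.ad K X Y u)
    (C := (2 * (‖M.ad‖ * 6)) ^ K * 6 * ‖(X, Y)‖ ^ (K + 1))
    (fun t ht => ((hv t ht).sub (hcont.integral_hasStrictDerivAt 0 t).hasDerivAt).hasDerivWithinAt)
    (fun t ht => ?_)
  · simpa [hZ0, Z, bchInt] using hmvt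
  · have ht' := Ico_subset_Icc_self ht
    calc ‖v t - bchIntegrand M.ad K X Y t‖ ≤ (2 * ‖M.ad (Z t)‖) ^ K * ‖v t‖ :=
          (h t ht').norm_sub_bchIntegrand_le he (hexpInt t ht') K
      _ ≤ (2 * (‖M.ad‖ * (6 * ‖(X, Y)‖))) ^ K * (6 * ‖(X, Y)‖) := by
        gcongr
        exacts [(M.ad.le_opNorm _).trans (by gcongr; exact hZ_le t ht'), hv_le t ht']
      _ = (2 * (‖M.ad‖ * 6)) ^ K * 6 * ‖(X, Y)‖ ^ (K + 1) := by ring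

theorem log_sub_bchInt_isBigO (h0 : 0 ∈ e.source) (he : EqOn e M.exp e.source) (K : ℕ) :
    (fun q : E × E => e.symm (M.exp q.1 * M.exp q.2) - bchInt M.ad K q.1 q.2)
      =O[𝓝 0] fun q => ‖q‖ ^ (K + 1) := by
  refine Asymptotics.IsBigO.of_bound ((2 * (‖M.ad‖ * 6)) ^ K * 6) ?_
  filter_upwards [eventually_forall_smul_of_eventually (eventually_isSmallPair h0 he)] with q hq
  rw [norm_pow, norm_norm]
  exact norm_log_sub_bchInt_le h0 he K hq

end ExpChart

/-! ### The chart of a Lie group at the identity -/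

section LieChart

variable {E : Type*} [NormedAddCommGroup E]
  {G : Type*} [TopologicalSpace G] [ChartedSpace E G] [Group G]

variable (E G) in
/-- The preferred chart at the identity, translated so that the identity is sent to `0`. -/
noncomputable def chartOne : OpenPartialHomeomorph G E :=
  (chartAt E (1 : G)).transHomeomorph (Homeomorph.subRight (chartAt E (1 : G) 1))

theorem chartOne_apply (g : G) : chartOne E G g = chartAt E (1 : G) g - chartAt E (1 : G) 1 := rfl

theorem chartOne_symm_apply (x : E) :
    (chartOne E G).symm x = (chartAt E (1 : G)).symm (x + chartAt E (1 : G) 1) := rfl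

theorem one_mem_chartOne_source : (1 : G) ∈ (chartOne E G).source := mem_chart_source E (1 : G)

theorem chartOne_one : chartOne E G 1 = 0 := sub_self _

theorem mem_chartOne_target {x : E} (hx : x ∈ (chartOne E G).target) :
    x + chartAt E (1 : G) 1 ∈ (chartAt E (1 : G)).target := hx

theorem zero_mem_chartOne_target : (0 : E) ∈ (chartOne E G).target := by
  rw [← chartOne_one (E := E) (G := G)]
  exact (chartOne E G).map_source one_mem_chartOne_source

theorem chartOne_symm_zero : (chartOne E G).symm 0 = 1 := by
  rw [← chartOne_one (E := E) (G := G), (chartOne E G).left_inv one_mem_chartOne_source]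

variable [NormedSpace ℝ E] [LieGroup 𝓘(ℝ, E) ∞ G]

theorem contMDiffAt_chartOne {g : G} (hg : g ∈ (chartOne E G).source) :
    ContMDiffAt 𝓘(ℝ, E) 𝓘(ℝ, E) ∞ (chartOne E G) g := by
  have hchart : ContMDiffAt 𝓘(ℝ, E) 𝓘(ℝ, E) ∞ (chartAt E (1 : G)) g :=
    contMDiffAt_of_mem_maximalAtlas (IsManifold.chart_mem_maximalAtlas 1) hg
  exact hchart.sub contMDiffAt_const

theorem contMDiffAt_chartOne_symm {x : E} (hx : x ∈ (chartOne E G).target) :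
    ContMDiffAt 𝓘(ℝ, E) 𝓘(ℝ, E) ∞ (chartOne E G).symm x := by
  have hsymm : ContMDiffAt 𝓘(ℝ, E) 𝓘(ℝ, E) ∞ (chartAt E (1 : G)).symm
      (x + chartAt E (1 : G) 1) :=
    contMDiffAt_symm_of_mem_maximalAtlas (IsManifold.chart_mem_maximalAtlas 1)
      (mem_chartOne_target hx)
  have hadd : ContMDiffAt 𝓘(ℝ, E) 𝓘(ℝ, E) ∞ (fun x : E => x + chartAt E (1 : G) 1) x :=
    (contDiff_id.add contDiff_const).contMDiff.contMDiffAt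
  exact ContMDiffAt.comp (g := (chartAt E (1 : G)).symm)
    (f := fun x : E => x + chartAt E (1 : G) 1) x hsymm hadd

theorem hasMFDerivAt_chartOne_symm {x : E} (hx : x ∈ (chartOne E G).target) :
    HasMFDerivAt 𝓘(ℝ, E) 𝓘(ℝ, E) (chartOne E G).symm x
      (mfderiv 𝓘(ℝ, E) 𝓘(ℝ, E) (chartOne E G).symm x : E →L[ℝ] E) :=
  ((contMDiffAt_chartOne_symm (G := G) hx).mdifferentiableAt (by simp)).hasMFDerivAt

theorem hasMFDerivAt_chartOne_one :
    HasMFDerivAt 𝓘(ℝ, E) 𝓘(ℝ, E) (chartOne E G) (1 : G) (ContinuousLinearMap.id ℝ E) := by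
  have : IsManifold 𝓘(ℝ, E) 1 G := IsManifold.of_le (n := ∞) (by exact_mod_cast le_top)
  have hchart := (mdifferentiableAt_extChartAt (I := 𝓘(ℝ, E))
    (mem_chart_source E (1 : G))).hasMFDerivAt
  rw [mfderiv_extChartAt_self] at hchart
  refine ((hchart.sub (hasMFDerivAt_const (chartAt E (1 : G) 1) (1 : G))).congr_of_eventuallyEq
    ?_).congr_mfderiv (sub_zero (ContinuousLinearMap.id ℝ E))
  filter_upwards with g
  simp [chartOne_apply]

theorem hasMFDerivAt_chartOne_symm_zero :
    HasMFDerivAt 𝓘(ℝ, E) 𝓘(ℝ, E) (chartOne E G).symm (0 : E) (ContinuousLinearMap.id ℝ E) := by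
  have hsymm := hasMFDerivAt_chartOne_symm (G := G) (zero_mem_chartOne_target (E := E))
  have hchart : HasMFDerivAt 𝓘(ℝ, E) 𝓘(ℝ, E) (chartOne E G) ((chartOne E G).symm 0)
      (ContinuousLinearMap.id ℝ E) := chartOne_symm_zero (E := E) (G := G) ▸
    hasMFDerivAt_chartOne_one
  have hid : HasMFDerivAt 𝓘(ℝ, E) 𝓘(ℝ, E) (chartOne E G ∘ (chartOne E G).symm) (0 : E)
      (ContinuousLinearMap.id ℝ E) := by
    refine (hasMFDerivAt_id (0 : E)).congr_of_eventuallyEq ?_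
    filter_upwards [(chartOne E G).open_target.mem_nhds zero_mem_chartOne_target] with x hx
    exact (chartOne E G).right_inv hx
  have hunique := hasMFDerivAt_unique (hchart.comp (0 : E) hsymm) hid
  exact hsymm.congr_mfderiv hunique

theorem hasMFDerivAt_mul_left (g h : G) : HasMFDerivAt 𝓘(ℝ, E) 𝓘(ℝ, E) (fun x => g * x) h
    (mfderiv 𝓘(ℝ, E) 𝓘(ℝ, E) (fun x => g * x) h) :=
  ((contMDiff_mul_left (I := 𝓘(ℝ, E)) (n := ∞) (a := g)).contMDiffAt.mdifferentiableAt
    (by simp)).hasMFDerivAt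

theorem contDiffAt_chartOne_mul :
    ContDiffAt ℝ ∞ (fun p : E × E =>
      chartOne E G ((chartOne E G).symm p.1 * (chartOne E G).symm p.2)) 0 := by
  rw [← contMDiffAt_iff_contDiffAt]
  have hfst : ContMDiffAt 𝓘(ℝ, E × E) 𝓘(ℝ, E) ∞ (fun p : E × E => (chartOne E G).symm p.1) 0 :=
    ContMDiffAt.comp (g := (chartOne E G).symm) (f := fun p : E × E => p.1) (0 : E × E)
      (contMDiffAt_chartOne_symm zero_mem_chartOne_target) contDiff_fst.contMDiff.contMDiffAt
  have hsnd : ContMDiffAt 𝓘(ℝ, E × E) 𝓘(ℝ, E) ∞ (fun p : E × E => (chartOne E G).symm p.2) 0 :=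
    ContMDiffAt.comp (g := (chartOne E G).symm) (f := fun p : E × E => p.2) (0 : E × E)
      (contMDiffAt_chartOne_symm zero_mem_chartOne_target) contDiff_snd.contMDiff.contMDiffAt
  refine ContMDiffAt.comp (g := chartOne E G)
    (f := fun p : E × E => (chartOne E G).symm p.1 * (chartOne E G).symm p.2) (0 : E × E)
    (contMDiffAt_chartOne ?_) (hfst.mul hsnd)
  simp only [Prod.fst_zero, Prod.snd_zero, chartOne_symm_zero, mul_one]
  exact one_mem_chartOne_source

variable (E G) in
/-- The chart at the identity of a Lie group, as a group chart. -/
noncomputable def lieGroupChart : GroupChart E G where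
  chart := chartOne E G
  one_mem := one_mem_chartOne_source
  map_one := chartOne_one
  contDiffAt_mul := contDiffAt_chartOne_mul.of_le (by norm_cast)

theorem mfderiv_chartOne_symm_comp_left {x : E} (hx : x ∈ (chartOne E G).target)
    (hd : DifferentiableAt ℝ (lieGroupChart E G).mul (x, 0)) :
    (mfderiv 𝓘(ℝ, E) 𝓘(ℝ, E) (chartOne E G).symm x : E →L[ℝ] E).comp
        ((lieGroupChart E G).left x) =
      (mfderiv 𝓘(ℝ, E) 𝓘(ℝ, E) (fun h : G => (chartOne E G).symm x * h) 1 : E →L[ℝ] E) := by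
  have : IsTopologicalGroup G := topologicalGroup_of_lieGroup 𝓘(ℝ, E) ∞
  let M := lieGroupChart E G
  let L : E →L[ℝ] E := mfderiv 𝓘(ℝ, E) 𝓘(ℝ, E) (fun h : G => (chartOne E G).symm x * h) 1
  have hmul : HasFDerivAt (fun y : E => M.mul (x, y)) (M.left x) 0 :=
    hd.hasFDerivAt.comp (0 : E) (hasFDerivAt_prodMk_right x (0 : E))
  have hsymm : HasMFDerivAt 𝓘(ℝ, E) 𝓘(ℝ, E) (chartOne E G).symm (M.mul (x, 0))
      (mfderiv 𝓘(ℝ, E) 𝓘(ℝ, E) (chartOne E G).symm x : E →L[ℝ] E) := by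
    rw [M.mul_zero_right hx]
    exact hasMFDerivAt_chartOne_symm hx
  have htranslate : HasMFDerivAt 𝓘(ℝ, E) 𝓘(ℝ, E) (fun h : G => (chartOne E G).symm x * h)
      ((chartOne E G).symm 0) L := by
    rw [chartOne_symm_zero]
    exact hasMFDerivAt_mul_left _ _
  have hcomp := HasMFDerivAt.comp (f := fun y : E => M.mul (x, y)) (0 : E) hsymm hmul.hasMFDerivAt
  have hcomp' := (htranslate.comp (0 : E) hasMFDerivAt_chartOne_symm_zero).congr_of_eventuallyEq
    (M.symm_comp_mul_eventuallyEq hx)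
  exact (hasMFDerivAt_unique hcomp hcomp').trans (ContinuousLinearMap.comp_id L)

end LieChart

/-! ### Integral curves of a vector field depending on a parameter -/

section IntegralCurves

variable {E F : Type*} [NormedAddCommGroup E] [NormedSpace ℝ E] [CompleteSpace E]
  [NormedAddCommGroup F] [NormedSpace ℝ F] [CompleteSpace F]

theorem exists_forall_exists_integralCurve_mem {f : E → E} {x₀ : E} (hf : ContDiffAt ℝ 1 f x₀)
    {P : Set E} (hP : P ∈ 𝓝 x₀) :
    ∃ ε > 0, ∀ᶠ x in 𝓝 x₀, ∃ γ : ℝ → E, γ 0 = x ∧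
      ∀ t ∈ Ioo (-ε) ε, γ t ∈ P ∧ HasDerivAt γ (f (γ t)) t := by
  obtain ⟨ε, hε, a, r, L, K, hr, hpl⟩ := IsPicardLindelof.of_contDiffAt_one hf
  obtain ⟨α, hα, hcont⟩ := (hpl 0).exists_forall_mem_closedBall_eq_hasDerivWithinAt_continuousOn
  simp only [zero_sub, zero_add] at hα hcont
  have hball := Metric.closedBall_mem_nhds x₀ (NNReal.coe_pos.2 hr)
  have hα_tendsto : Tendsto α (𝓝 (x₀, 0)) (𝓝 x₀) := by
    have hαx₀ := hcont.continuousAt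
      (prod_mem_nhds hball (Icc_mem_nhds (neg_lt_zero.2 hε) hε))
    rwa [ContinuousAt, (hα x₀ (mem_of_mem_nhds hball)).1] at hαx₀
  obtain ⟨ρ, hρ, hαP⟩ := Metric.eventually_nhds_iff.1 (hα_tendsto.eventually hP)
  refine ⟨min ρ ε, lt_min hρ hε, ?_⟩
  filter_upwards [hball, Metric.ball_mem_nhds x₀ hρ] with x hx hxρ
  refine ⟨fun t => α (x, t), (hα x hx).1, fun t ht => ⟨@hαP (x, t) ?_, ?_⟩⟩
  · rw [Prod.dist_eq, Real.dist_eq, sub_zero]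
    exact max_lt hxρ ((abs_lt.2 ht).trans_le (min_le_left _ _))
  · obtain ⟨hlt, hgt⟩ := abs_lt.1 ((abs_lt.2 ht).trans_le (min_le_right ρ ε))
    exact ((hα x hx).2 t ⟨hlt.le, hgt.le⟩).hasDerivAt (Icc_mem_nhds hlt hgt)

/-- Adding the parameter, with velocity `0`, to the unknowns makes the vector field autonomous. -/
theorem exists_forall_exists_integralCurve_mem_of_parameter {v : E × F → E} {x₀ : E} {y₀ : F}
    (hv : ContDiffAt ℝ 1 v (x₀, y₀)) {P : Set E} (hP : P ∈ 𝓝 x₀) :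
    ∃ ε > 0, ∀ᶠ y in 𝓝 y₀, ∃ γ : ℝ → E, γ 0 = x₀ ∧
      ∀ t ∈ Ioo (-ε) ε, γ t ∈ P ∧ HasDerivAt γ (v (γ t, y)) t := by
  obtain ⟨ε, hε, hflow⟩ := exists_forall_exists_integralCurve_mem
    (f := fun p : E × F => (v p, 0)) (hv.prodMk contDiffAt_const)
    (prod_mem_nhds hP univ_mem)
  refine ⟨ε, hε, ?_⟩
  have hpair : Tendsto (fun y : F => (x₀, y)) (𝓝 y₀) (𝓝 (x₀, y₀)) :=
    Continuous.tendsto' (by fun_prop) _ _ rfl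
  filter_upwards [hpair.eventually hflow] with y ⟨γ, hγ0, hγ⟩
  have hsnd : ∀ t ∈ Ioo (-ε) ε, (γ t).2 = y := fun t ht => by
    have hderiv : ∀ s ∈ Ioo (-ε) ε, HasDerivWithinAt (fun s => (γ s).2) 0 (Ioo (-ε) ε) s :=
      fun s hs => (hasFDerivAt_snd (𝕜 := ℝ) (E := E) (F := F)).comp_hasDerivWithinAt s
        (hγ s hs).2.hasDerivWithinAt
    have hle := (convex_Ioo (-ε) ε).norm_image_sub_le_of_norm_hasDerivWithin_le (C := 0) hderiv
      (by simp) ⟨neg_lt_zero.2 hε, hε⟩ ht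
    rw [zero_mul, norm_le_zero_iff, sub_eq_zero] at hle
    rw [hle, hγ0]
  refine ⟨fun t => (γ t).1, congrArg Prod.fst hγ0, fun t ht => ⟨(hγ t ht).1.1, ?_⟩⟩
  have hfst := (hasFDerivAt_fst (𝕜 := ℝ) (E := E) (F := F)).comp_hasDerivAt t (hγ t ht).2
  rw [← Prod.mk.eta (p := γ t), hsnd t ht] at hfst
  exact hfst

theorem GroupChart.exists_forall_exists_integralCurve_left_mem {G : Type*} [TopologicalSpace G]
    [Group G] (M : GroupChart E G) {P : Set E} (hP : P ∈ 𝓝 0) :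
    ∃ ε > 0, ∀ᶠ X in 𝓝 (0 : E), ∃ γ : ℝ → E, γ 0 = 0 ∧
      ∀ t ∈ Ioo (-ε) ε, γ t ∈ P ∧ HasDerivAt γ (M.left (γ t) X) t :=
  exists_forall_exists_integralCurve_mem_of_parameter (v := fun p : E × E => M.left p.1 p.2)
    (ContDiffAt.clm_apply (ContDiffAt.comp (g := M.left) (f := Prod.fst) ((0, 0) : E × E)
      M.contDiffAt_left contDiffAt_fst) contDiffAt_snd) hP

end IntegralCurves

/-! ### The exponential map of a Lie group -/

theorem t2Space_of_lieGroup (E G : Type*) [NormedAddCommGroup E] [NormedSpace ℝ E]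
    [TopologicalSpace G] [ChartedSpace E G] [Group G] [LieGroup 𝓘(ℝ, E) ∞ G] : T2Space G := by
  have : IsTopologicalGroup G := topologicalGroup_of_lieGroup 𝓘(ℝ, E) ∞
  have : T1Space G := ChartedSpace.t1Space E G
  infer_instance

theorem GroupChart.eventually_mem_target_differentiableAt_mul {E G : Type*} [NormedAddCommGroup E]
    [NormedSpace ℝ E] [TopologicalSpace G] [Group G] (M : GroupChart E G) :
    ∀ᶠ x in 𝓝 (0 : E), x ∈ M.chart.target ∧ DifferentiableAt ℝ M.mul (x, 0) := by
  have hpair : Tendsto (fun x : E => (x, (0 : E))) (𝓝 0) (𝓝 0) :=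
    Continuous.tendsto' (by fun_prop) _ _ (by simp)
  exact Filter.inter_mem (M.target_mem_nhds M.zero_mem_target)
    (hpair.eventually M.eventually_differentiableAt_mul)

section InvariantVectorField

variable {E : Type*} [NormedAddCommGroup E] [NormedSpace ℝ E]
  {G : Type*} [TopologicalSpace G] [ChartedSpace E G] [Group G]

theorem mulInvariantVectorField_one (X : LieAlg E G) :
    (mulInvariantVectorField X (1 : G) : E) = X := by
  have hone : HasMFDerivAt 𝓘(ℝ, E) 𝓘(ℝ, E) (fun x : G => 1 * x) (1 : G)
      (ContinuousLinearMap.id ℝ E) := by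
    refine (hasMFDerivAt_id (1 : G)).congr_of_eventuallyEq ?_
    filter_upwards with g
    exact one_mul g
  exact congrArg (fun A : E →L[ℝ] E => A X) hone.mfderiv

variable [LieGroup 𝓘(ℝ, E) ∞ G]

theorem mulInvariantVectorField_mul (X : LieAlg E G) (g h : G) :
    (mulInvariantVectorField X (g * h) : E) =
      (mfderiv 𝓘(ℝ, E) 𝓘(ℝ, E) (fun x : G => g * x) h : E →L[ℝ] E)
        (mulInvariantVectorField X h) := by
  have hcomp : HasMFDerivAt 𝓘(ℝ, E) 𝓘(ℝ, E) ((fun x => g * x) ∘ (fun x => h * x)) (1 : G)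
      ((mfderiv 𝓘(ℝ, E) 𝓘(ℝ, E) (fun x => g * x) (h * 1)).comp
        (mfderiv 𝓘(ℝ, E) 𝓘(ℝ, E) (fun x => h * x) 1)) :=
    (hasMFDerivAt_mul_left g (h * 1)).comp (1 : G) (hasMFDerivAt_mul_left h 1)
  rw [show (fun x => g * x) ∘ (fun x => h * x) = fun x => g * h * x from
    funext fun x => (mul_assoc g h x).symm] at hcomp
  have happly : mulInvariantVectorField X (g * h) =
      mfderiv 𝓘(ℝ, E) 𝓘(ℝ, E) (fun x => g * x) (h * 1) (mulInvariantVectorField X h) :=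
    congrArg (fun A : E →L[ℝ] E => A X) hcomp.mfderiv
  have hbase : ∀ k : G, k = h → (mfderiv 𝓘(ℝ, E) 𝓘(ℝ, E) (fun x => g * x) k : E →L[ℝ] E) =
      (mfderiv 𝓘(ℝ, E) 𝓘(ℝ, E) (fun x => g * x) h : E →L[ℝ] E) := by
    rintro _ rfl; rfl
  exact happly.trans (congrArg (fun A : E →L[ℝ] E => A (mulInvariantVectorField X h))
    (hbase _ (mul_one _)))

theorem isMIntegralCurve_mul_left {X : LieAlg E G} {γ : ℝ → G}
    (hγ : IsMIntegralCurve (I := 𝓘(ℝ, E)) γ (mulInvariantVectorField X)) (g : G) :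
    IsMIntegralCurve (I := 𝓘(ℝ, E)) (fun t => g * γ t) (mulInvariantVectorField X) := by
  intro t
  refine (congrArg (fun A : ℝ →L[ℝ] E => HasMFDerivAt 𝓘(ℝ, ℝ) 𝓘(ℝ, E)
    (fun t => g * γ t) t A) ?_).mpr ((hasMFDerivAt_mul_left g (γ t)).comp t (hγ t))
  refine ContinuousLinearMap.ext fun r => ?_
  exact (congrArg (fun w : E => r • w) (mulInvariantVectorField_mul X g (γ t))).trans
    ((mfderiv 𝓘(ℝ, E) 𝓘(ℝ, E) (fun x => g * x) (γ t)).map_smul r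
      (mulInvariantVectorField X (γ t))).symm

theorem mfderiv_chartOne_symm_left {x : E} (hx : x ∈ (chartOne E G).target)
    (hd : DifferentiableAt ℝ (lieGroupChart E G).mul (x, 0)) (X : LieAlg E G) :
    (mfderiv 𝓘(ℝ, E) 𝓘(ℝ, E) (chartOne E G).symm x : E →L[ℝ] E) ((lieGroupChart E G).left x X) =
      mulInvariantVectorField X ((chartOne E G).symm x) :=
  congrArg (fun A : E →L[ℝ] E => A X) (mfderiv_chartOne_symm_comp_left hx hd)

theorem isMIntegralCurveOn_chartOne_symm {X : LieAlg E G} {x : ℝ → E} {s : Set ℝ}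
    (hmem : ∀ t ∈ s, x t ∈ (chartOne E G).target)
    (hd : ∀ t ∈ s, DifferentiableAt ℝ (lieGroupChart E G).mul (x t, 0))
    (hx : ∀ t ∈ s, HasDerivAt x ((lieGroupChart E G).left (x t) X) t) :
    IsMIntegralCurveOn (I := 𝓘(ℝ, E)) (fun t => (chartOne E G).symm (x t))
      (mulInvariantVectorField X) s := by
  intro t ht
  refine HasMFDerivAt.hasMFDerivWithinAt ?_
  refine (congrArg (fun A : ℝ →L[ℝ] E => HasMFDerivAt 𝓘(ℝ, ℝ) 𝓘(ℝ, E)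
    (fun t => (chartOne E G).symm (x t)) t A) ?_).mpr
    ((hasMFDerivAt_chartOne_symm (G := G) (hmem t ht)).comp t (hx t ht).hasFDerivAt.hasMFDerivAt)
  refine ContinuousLinearMap.ext fun r => ?_
  exact (congrArg (fun w : E => r • w)
    (mfderiv_chartOne_symm_left (hmem t ht) (hd t ht) X).symm).trans
    ((mfderiv 𝓘(ℝ, E) 𝓘(ℝ, E) (chartOne E G).symm (x t) : E →L[ℝ] E).map_smul r
      ((lieGroupChart E G).left (x t) X)).symm

theorem contMDiff_one_mulInvariantVectorField (X : LieAlg E G) :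
    ContMDiff 𝓘(ℝ, E) (𝓘(ℝ, E).prod 𝓘(ℝ, E)) 1
      (fun g : G => (mulInvariantVectorField X g : TangentBundle 𝓘(ℝ, E) G)) :=
  (contMDiff_mulInvariantVectorField X).of_le (le_trans (by norm_num) le_minSmoothness)

end InvariantVectorField

section LieExp

variable {E : Type*} [NormedAddCommGroup E] [NormedSpace ℝ E]
  {G : Type*} [TopologicalSpace G] [ChartedSpace E G] [Group G] [LieGroup 𝓘(ℝ, E) ∞ G]

theorem isMIntegralCurve_eq_of_apply_zero_eq {X : LieAlg E G} {γ γ' : ℝ → G}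
    (hγ : IsMIntegralCurve (I := 𝓘(ℝ, E)) γ (mulInvariantVectorField X))
    (hγ' : IsMIntegralCurve (I := 𝓘(ℝ, E)) γ' (mulInvariantVectorField X)) (h : γ 0 = γ' 0) :
    γ = γ' := by
  have : IsManifold 𝓘(ℝ, E) 1 G := IsManifold.of_le (n := ∞) (by exact_mod_cast le_top)
  have : T2Space G := t2Space_of_lieGroup E G
  exact isMIntegralCurve_Ioo_eq_of_contMDiff_boundaryless
    (contMDiff_one_mulInvariantVectorField X) hγ hγ' h

variable [FiniteDimensional ℝ E]

/-- The integral curve from the identity of the left-invariant vector field `X`; it is the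
one-parameter subgroup `t ↦ lieExp (t • X)`. -/
noncomputable def oneParam (X : LieAlg E G) : ℝ → G :=
  (exists_isMIntegralCurve_mulInvariantVectorField X).choose

theorem oneParam_zero (X : LieAlg E G) : oneParam X 0 = 1 :=
  (exists_isMIntegralCurve_mulInvariantVectorField X).choose_spec.1

theorem isMIntegralCurve_oneParam (X : LieAlg E G) :
    IsMIntegralCurve (I := 𝓘(ℝ, E)) (oneParam X) (mulInvariantVectorField X) :=
  (exists_isMIntegralCurve_mulInvariantVectorField X).choose_spec.2

theorem lieExp_smul (X : LieAlg E G) (t : ℝ) : lieExp (t • X) = oneParam X t := by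
  have hscaled := (isMIntegralCurve_oneParam X).comp_mul t
  rw [← mulInvariantVectorField_smul] at hscaled
  have heq := isMIntegralCurve_eq_of_apply_zero_eq (isMIntegralCurve_oneParam (t • X)) hscaled
    (by simp [oneParam_zero])
  exact (congrFun heq 1).trans (congrArg (oneParam X) (one_mul t))

theorem lieExp_zero : (lieExp (0 : LieAlg E G) : G) = 1 := by
  rw [← zero_smul ℝ (0 : LieAlg E G), lieExp_smul, oneParam_zero]

theorem lieExp_add_smul (X : LieAlg E G) (s t : ℝ) :
    (lieExp ((s + t) • X) : G) = lieExp (s • X) * lieExp (t • X) := by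
  rw [lieExp_smul, lieExp_smul, lieExp_smul]
  have heq := isMIntegralCurve_eq_of_apply_zero_eq ((isMIntegralCurve_oneParam X).comp_add s)
    (isMIntegralCurve_mul_left (isMIntegralCurve_oneParam X) (oneParam X s))
    (by simp [oneParam_zero])
  simpa [add_comm] using congrFun heq t

theorem hasDerivAt_chartOne_lieExp (X : LieAlg E G) :
    HasDerivAt (fun t : ℝ => chartOne E G (lieExp (t • X))) (X : E) 0 := by
  simp only [lieExp_smul]
  have hchart : HasMFDerivAt 𝓘(ℝ, E) 𝓘(ℝ, E) (chartOne E G) (oneParam X 0)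
      (ContinuousLinearMap.id ℝ E) := by
    rw [oneParam_zero]
    exact hasMFDerivAt_chartOne_one
  have hcomp : HasFDerivAt (fun t : ℝ => chartOne E G (oneParam X t)) ((1 : ℝ →L[ℝ] ℝ).smulRight
      (mulInvariantVectorField X (oneParam X 0) : E)) 0 :=
    (hchart.comp (0 : ℝ) (isMIntegralCurve_oneParam X 0)).hasFDerivAt
  refine hcomp.hasDerivAt.congr_deriv ?_
  have hone : ∀ g : G, g = 1 → (mulInvariantVectorField X g : E) = X := by
    rintro _ rfl; exact mulInvariantVectorField_one X
  exact (one_smul ℝ (mulInvariantVectorField X (oneParam X 0) : E)).trans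
    (hone _ (oneParam_zero X))

theorem lieExp_smul_eq_chartOne_symm {X : LieAlg E G} {x : ℝ → E} {ε : ℝ} (hx0 : x 0 = 0)
    (hmem : ∀ t ∈ Ioo (-ε) ε, x t ∈ (chartOne E G).target)
    (hd : ∀ t ∈ Ioo (-ε) ε, DifferentiableAt ℝ (lieGroupChart E G).mul (x t, 0))
    (hx : ∀ t ∈ Ioo (-ε) ε, HasDerivAt x ((lieGroupChart E G).left (x t) X) t)
    {t : ℝ} (ht : t ∈ Ioo (-ε) ε) : lieExp (t • X) = (chartOne E G).symm (x t) := by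
  have : IsManifold 𝓘(ℝ, E) 1 G := IsManifold.of_le (n := ∞) (by exact_mod_cast le_top)
  have : T2Space G := t2Space_of_lieGroup E G
  have hε : 0 < ε := by linarith [ht.1, ht.2]
  rw [lieExp_smul]
  exact isMIntegralCurveOn_Ioo_eqOn_of_contMDiff_boundaryless (t₀ := 0)
    ⟨neg_lt_zero.2 hε, hε⟩ (contMDiff_one_mulInvariantVectorField X)
    ((isMIntegralCurve_oneParam (G := G) X).isMIntegralCurveOn _)
    (isMIntegralCurveOn_chartOne_symm hmem hd hx)
    (by rw [oneParam_zero, hx0, chartOne_symm_zero]) ht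

theorem tendsto_lieExp : Tendsto (fun X : E => (lieExp (X : LieAlg E G) : G)) (𝓝 0) (𝓝 1) := by
  intro U hU
  have hsymm : Tendsto (chartOne E G).symm (𝓝 0) (𝓝 1) := by
    have hcont := (chartOne E G).symm.continuousAt (x := 0) zero_mem_chartOne_target
    rwa [ContinuousAt, chartOne_symm_zero] at hcont
  obtain ⟨ε, hε, hcurve⟩ := (lieGroupChart E G).exists_forall_exists_integralCurve_left_mem
    (Filter.inter_mem (lieGroupChart E G).eventually_mem_target_differentiableAt_mul (hsymm hU))
  have hscale : Tendsto (fun X : E => (ε / 2)⁻¹ • X) (𝓝 0) (𝓝 0) :=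
    Continuous.tendsto' (by fun_prop) _ _ (by simp)
  refine mem_map.2 ?_
  filter_upwards [hscale.eventually hcurve] with X ⟨x, hx0, hx⟩
  have ht : ε / 2 ∈ Ioo (-ε) ε := ⟨by linarith, by linarith⟩
  have hexp : (lieExp ((ε / 2) • (ε / 2)⁻¹ • X : LieAlg E G) : G) =
      (chartOne E G).symm (x (ε / 2)) :=
    lieExp_smul_eq_chartOne_symm hx0 (fun t ht => (hx t ht).1.1.1) (fun t ht => (hx t ht).1.1.2)
      (fun t ht => (hx t ht).2) ht
  have hX : ((ε / 2) • (ε / 2)⁻¹ • X : LieAlg E G) = X := smul_inv_smul₀ (by positivity) X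
  rw [hX] at hexp
  exact (congrArg (· ∈ U) hexp).mpr (hx _ ht).1.2

variable (E G) in
/-- A Lie group with its exponential map, in the chart at the identity. -/
noncomputable def lieExpChart : ExpChart E G where
  toGroupChart := lieGroupChart E G
  exp := fun X : E => lieExp (X : LieAlg E G)
  exp_add_smul := fun X s t => lieExp_add_smul X s t
  continuousAt_exp := by
    have hzero : (lieExp ((0 : E) : LieAlg E G) : G) = 1 := lieExp_zero
    rw [ContinuousAt, hzero]
    exact tendsto_lieExp
  hasDerivAt_exp := hasDerivAt_chartOne_lieExp

end LieExp

/-! ### The Lie bracket in the chart at the identity -/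

theorem GroupChart.lieBracketWithin_eq_ad {E G : Type*} [NormedAddCommGroup E] [NormedSpace ℝ E]
    [TopologicalSpace G] [Group G] (M : GroupChart E G) {V W : E → E} {c X Y : E}
    (hV : V =ᶠ[𝓝 c] fun z => M.left (z - c) X) (hW : W =ᶠ[𝓝 c] fun z => M.left (z - c) Y) :
    VectorField.lieBracketWithin ℝ V W univ c = M.ad X Y := by
  have hderiv : ∀ W : E,
      HasFDerivAt (fun z => M.left (z - c) W) ((fderiv ℝ M.left 0).flip W) c := by
    intro W
    have hleft : HasFDerivAt M.left (fderiv ℝ M.left 0) (c - c) := by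
      rw [sub_self]
      exact (M.contDiffAt_left.differentiableAt (by simp)).hasFDerivAt
    have hclm := (HasFDerivAt.comp (f := fun z : E => z - c) c hleft
      ((hasFDerivAt_id c).sub_const c)).clm_apply (hasFDerivAt_const W c)
    convert! hclm using 1
    ext v; simp
  rw [VectorField.lieBracketWithin_univ, hV.lieBracket_vectorField_eq hW,
    VectorField.lieBracket_eq]
  simp only
  rw [(hderiv X).fderiv, (hderiv Y).fderiv, M.ad_apply, sub_self, M.left_zero]
  simp only [ContinuousLinearMap.flip_apply, one_apply_eq_self]

section LieBracket

variable {E : Type*} [NormedAddCommGroup E] [NormedSpace ℝ E]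
  {G : Type*} [TopologicalSpace G] [ChartedSpace E G] [Group G] [LieGroup 𝓘(ℝ, E) ∞ G]

theorem mfderivWithin_extChartAt_one_symm {z : E}
    (hz : z - chartAt E (1 : G) 1 ∈ (chartOne E G).target) :
    (mfderivWithin 𝓘(ℝ, E) 𝓘(ℝ, E) (extChartAt 𝓘(ℝ, E) (1 : G)).symm
      (range 𝓘(ℝ, E)) z : E →L[ℝ] E) =
      (mfderiv 𝓘(ℝ, E) 𝓘(ℝ, E) (chartOne E G).symm (z - chartAt E (1 : G) 1) : E →L[ℝ] E) := by
  have hsub : HasFDerivAt (fun w : E => w - chartAt E (1 : G) 1) (ContinuousLinearMap.id ℝ E) z :=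
    (hasFDerivAt_id z).sub_const _
  have hcomp := HasMFDerivAt.comp (f := fun w : E => w - chartAt E (1 : G) 1) z
    (hasMFDerivAt_chartOne_symm (G := G) hz) hsub.hasMFDerivAt
  have hsymm : HasMFDerivAt 𝓘(ℝ, E) 𝓘(ℝ, E) (extChartAt 𝓘(ℝ, E) (1 : G)).symm z
      ((mfderiv 𝓘(ℝ, E) 𝓘(ℝ, E) (chartOne E G).symm (z - chartAt E (1 : G) 1) : E →L[ℝ] E).comp
        (ContinuousLinearMap.id ℝ E)) := by
    refine hcomp.congr_of_eventuallyEq (Filter.Eventually.of_forall fun w => ?_)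
    simp [chartOne_symm_apply]
  rw [ModelWithCorners.range_eq_univ, mfderivWithin_univ]
  exact hsymm.mfderiv.trans (ContinuousLinearMap.comp_id
    (mfderiv 𝓘(ℝ, E) 𝓘(ℝ, E) (chartOne E G).symm (z - chartAt E (1 : G) 1) : E →L[ℝ] E))

theorem mpullbackWithin_mulInvariantVectorField_eventuallyEq (X : LieAlg E G) :
    (VectorField.mpullbackWithin 𝓘(ℝ, E) 𝓘(ℝ, E) (extChartAt 𝓘(ℝ, E) (1 : G)).symm
      (mulInvariantVectorField X) (range 𝓘(ℝ, E)) : E → E) =ᶠ[𝓝 (chartAt E (1 : G) 1)]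
      fun z => (lieGroupChart E G).left (z - chartAt E (1 : G) 1) X := by
  have : IsManifold 𝓘(ℝ, E) 1 G := IsManifold.of_le (n := ∞) (by exact_mod_cast le_top)
  set c := chartAt E (1 : G) 1 with hc
  let D : E → E →L[ℝ] E := mfderivWithin 𝓘(ℝ, E) 𝓘(ℝ, E) (extChartAt 𝓘(ℝ, E) (1 : G)).symm
    (range 𝓘(ℝ, E))
  have hsub : Tendsto (fun z : E => z - c) (𝓝 c) (𝓝 0) :=
    Continuous.tendsto' (by fun_prop) _ _ (by simp)
  filter_upwards [hsub.eventually
    (lieGroupChart E G).eventually_mem_target_differentiableAt_mul] with z ⟨hmem, hd⟩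
  have hz : z ∈ (extChartAt 𝓘(ℝ, E) (1 : G)).target := by
    have hmem' := mem_chartOne_target hmem
    rw [sub_add_cancel] at hmem'
    simpa using hmem'
  have hinv := isInvertible_mfderivWithin_extChartAt_symm (I := 𝓘(ℝ, E)) hz
  have hbase : ∀ g : G, g = (chartOne E G).symm (z - c) → (mulInvariantVectorField X g : E) =
      (mulInvariantVectorField X ((chartOne E G).symm (z - c)) : E) := by rintro _ rfl; rfl
  have hval : (mulInvariantVectorField X ((extChartAt 𝓘(ℝ, E) (1 : G)).symm z) : E) =
      D z ((lieGroupChart E G).left (z - c) X) := by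
    have hsymm : (extChartAt 𝓘(ℝ, E) (1 : G)).symm z = (chartOne E G).symm (z - c) := by
      simp [chartOne_symm_apply, hc]
    exact (hbase _ hsymm).trans <| (mfderiv_chartOne_symm_left hmem hd X).symm.trans
      (DFunLike.congr_fun (mfderivWithin_extChartAt_one_symm hmem).symm _)
  rw [VectorField.mpullbackWithin_apply]
  exact (congrArg (fun v : E => (D z).inverse v) hval).trans
    (congrArg (fun A : E →L[ℝ] E => A ((lieGroupChart E G).left (z - c) X)) hinv.inverse_comp_self)

theorem lieGroupChart_ad (X Y : LieAlg E G) :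
    ((lieGroupChart E G).ad X Y : E) = (⁅X, Y⁆ : LieAlg E G) := by
  have : IsManifold 𝓘(ℝ, E) 1 G := IsManifold.of_le (n := ∞) (by exact_mod_cast le_top)
  have hbracket := (lieGroupChart E G).lieBracketWithin_eq_ad
    (mpullbackWithin_mulInvariantVectorField_eventuallyEq X)
    (mpullbackWithin_mulInvariantVectorField_eventuallyEq Y)
  have hset : ((extChartAt 𝓘(ℝ, E) (1 : G)).symm ⁻¹' univ ∩ range 𝓘(ℝ, E)) = univ := by simp
  have hpoint : extChartAt 𝓘(ℝ, E) (1 : G) 1 = chartAt E (1 : G) 1 := by simp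
  rw [← hset, ← hpoint] at hbracket
  have hid : (mfderiv 𝓘(ℝ, E) 𝓘(ℝ, E) (extChartAt 𝓘(ℝ, E) (1 : G)) 1 : E →L[ℝ] E).inverse =
      ContinuousLinearMap.id ℝ E :=
    (congrArg (fun A : E →L[ℝ] E => A.inverse) mfderiv_extChartAt_self).trans
      ContinuousLinearMap.inverse_id
  exact ((congrArg (fun A : E →L[ℝ] E => A _) hid).trans hbracket).symm

end LieBracket

/-! ### Layers and dilatations -/

/-- A splitting of a normed space into finitely many layers of positive degree, with a bracket
that respects the associated filtration. The layers are encoded by their projections `proj i`,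
where `i = 0` is allowed only to make the indices match the degrees. -/
structure LayerSplitting {E : Type*} [NormedAddCommGroup E] [NormedSpace ℝ E] (m : ℕ)
    (ad : E →L[ℝ] E →L[ℝ] E) where
  proj : ℕ → E →L[ℝ] E
  sum_proj : ∀ x, ∑ i ∈ Finset.range (m + 1), proj i x = x
  proj_proj : ∀ i j x, proj i (proj j x) = if i = j then proj j x else 0
  proj_zero : proj 0 = 0
  proj_ad : ∀ i j k x y, i + j < k → proj k (ad (proj i x) (proj j y)) = 0

namespace LayerSplitting

variable {E : Type*} [NormedAddCommGroup E] [NormedSpace ℝ E] {m : ℕ}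
  {ad : E →L[ℝ] E →L[ℝ] E} (S : LayerSplitting m ad)

theorem proj_of_lt {k : ℕ} (hk : m < k) (x : E) : S.proj k x = 0 := by
  rw [← S.sum_proj x, map_sum]
  refine Finset.sum_eq_zero fun i hi => ?_
  rw [S.proj_proj, if_neg]
  have := Finset.mem_range.1 hi
  omega

theorem eq_zero_of_proj {x : E} (h : ∀ k, S.proj k x = 0) : x = 0 := by
  rw [← S.sum_proj x]
  exact Finset.sum_eq_zero fun i _ => h i

/-- The dilatation of factor `ε`, multiplying the layer of degree `i` by `ε ^ i`. -/
noncomputable def dil (ε : ℝ) : E →L[ℝ] E := ∑ i ∈ Finset.range (m + 1), ε ^ i • S.proj i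

theorem dil_apply (ε : ℝ) (x : E) :
    S.dil ε x = ∑ i ∈ Finset.range (m + 1), ε ^ i • S.proj i x := by
  simp [dil]

theorem continuous_dil : Continuous S.dil := by
  unfold dil
  fun_prop

theorem dil_proj (ε : ℝ) (k : ℕ) (x : E) : S.dil ε (S.proj k x) = ε ^ k • S.proj k x := by
  rcases Nat.lt_or_ge m k with hk | hk
  · rw [S.proj_of_lt hk, map_zero, smul_zero]
  · rw [dil_apply, Finset.sum_eq_single k]
    · rw [S.proj_proj, if_pos rfl]
    · intro i _ hi
      rw [S.proj_proj, if_neg hi, smul_zero]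
    · intro h
      exact absurd (Finset.mem_range.2 (by omega)) h

theorem dil_dil (ε η : ℝ) (x : E) : S.dil ε (S.dil η x) = S.dil (ε * η) x := by
  rw [S.dil_apply η, map_sum, S.dil_apply]
  refine Finset.sum_congr rfl fun i _ => ?_
  rw [map_smul, dil_proj, smul_smul, mul_pow, mul_comm]

theorem dil_one (x : E) : S.dil 1 x = x := by
  rw [dil_apply]
  simp only [one_pow, one_smul]
  exact S.sum_proj x

theorem dil_zero (x : E) : S.dil 0 x = 0 := by
  rw [dil_apply]
  refine Finset.sum_eq_zero fun i _ => ?_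
  rcases Nat.eq_zero_or_pos i with rfl | hi
  · rw [S.proj_zero, zero_apply, smul_zero]
  · rw [zero_pow hi.ne', zero_smul]

theorem dil_inv_dil {ε : ℝ} (hε : ε ≠ 0) (x : E) : S.dil ε⁻¹ (S.dil ε x) = x := by
  rw [S.dil_dil, inv_mul_cancel₀ hε, S.dil_one]

theorem dil_dil_inv {ε : ℝ} (hε : ε ≠ 0) (x : E) : S.dil ε (S.dil ε⁻¹ x) = x := by
  rw [S.dil_dil, mul_inv_cancel₀ hε, S.dil_one]

theorem continuous_dil_apply : Continuous fun p : ℝ × E => S.dil p.1 p.2 :=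
  (S.continuous_dil.comp continuous_fst).clm_apply continuous_snd

theorem tendsto_dil_nhds (x : E) :
    Tendsto (fun p : ℝ × E => S.dil p.1 p.2) (𝓝[>] 0 ×ˢ 𝓝 x) (𝓝 0) :=
  (S.continuous_dil_apply.tendsto' (0, x) 0 (S.dil_zero x)).mono_left
    (nhds_prod_eq (x := (0 : ℝ)) (y := x) ▸ prod_mono nhdsWithin_le_nhds le_rfl)

theorem tendsto_dil (x : E) : Tendsto (fun ε : ℝ => S.dil ε x) (𝓝[>] 0) (𝓝 0) :=
  Tendsto.comp (f := fun ε : ℝ => (ε, x)) (S.tendsto_dil_nhds x)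
    (tendsto_id.prodMk tendsto_const_nhds)

/-- The dilatation of a non-zero factor as an invertible map. -/
noncomputable def dilUnit (ε : ℝ) (hε : ε ≠ 0) : (E →L[ℝ] E)ˣ where
  val := S.dil ε
  inv := S.dil ε⁻¹
  val_inv := ContinuousLinearMap.ext (S.dil_dil_inv hε)
  inv_val := ContinuousLinearMap.ext (S.dil_inv_dil hε)

/-- The bracket transported by the dilatation of factor `ε`. The exponent `i + j - k` is truncated
only where `proj_ad` makes the coefficient vanish, so that the formula also makes sense at `ε = 0`,
where it gives the nilpotent bracket. -/
noncomputable def bracket (ε : ℝ) : E →L[ℝ] E →L[ℝ] E :=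
  ∑ i ∈ Finset.range (m + 1), ∑ j ∈ Finset.range (m + 1), ∑ k ∈ Finset.range (m + 1),
    ε ^ (i + j - k) • (ContinuousLinearMap.compL ℝ E E E (S.proj k)).comp
      (ad.bilinearComp (S.proj i) (S.proj j))

theorem bracket_apply (ε : ℝ) (X Y : E) :
    S.bracket ε X Y = ∑ i ∈ Finset.range (m + 1), ∑ j ∈ Finset.range (m + 1),
      ∑ k ∈ Finset.range (m + 1),
        ε ^ (i + j - k) • S.proj k (ad (S.proj i X) (S.proj j Y)) := by
  simp [bracket]

theorem continuous_bracket : Continuous S.bracket := by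
  unfold bracket
  fun_prop

theorem dil_bracket (ε : ℝ) (X Y : E) :
    S.dil ε (S.bracket ε X Y) = ad (S.dil ε X) (S.dil ε Y) := by
  rw [bracket_apply, S.dil_apply ε X, S.dil_apply ε Y]
  simp only [map_sum, sum_apply, map_smul, smul_apply]
  rw [Finset.sum_comm]
  refine Finset.sum_congr rfl fun j _ => ?_
  rw [Finset.smul_sum]
  refine Finset.sum_congr rfl fun i _ => ?_
  conv_rhs => rw [← S.sum_proj (ad (S.proj i X) (S.proj j Y))]
  rw [Finset.smul_sum, Finset.smul_sum]
  refine Finset.sum_congr rfl fun k _ => ?_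
  rw [S.dil_proj]
  rcases Nat.lt_or_ge (i + j) k with hk | hk
  · simp only [S.proj_ad i j k X Y hk, smul_zero]
  · rw [smul_smul, smul_smul, ← pow_add, ← pow_add, Nat.sub_add_cancel hk, add_comm j i]

theorem bracket_zero_apply (X Y : E) :
    S.bracket 0 X Y = ∑ i ∈ Finset.range (m + 1), ∑ j ∈ Finset.range (m + 1),
      S.proj (i + j) (ad (S.proj i X) (S.proj j Y)) := by
  rw [bracket_apply]
  refine Finset.sum_congr rfl fun i _ => Finset.sum_congr rfl fun j _ => ?_
  rw [Finset.sum_eq_single (i + j)]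
  · rw [Nat.sub_self, pow_zero, one_smul]
  · intro k _ hk
    rcases Nat.lt_or_ge (i + j) k with h | h
    · rw [S.proj_ad i j k X Y h, smul_zero]
    · rw [zero_pow (by omega), zero_smul]
  · intro h
    rw [S.proj_of_lt (by simpa using h), smul_zero]

theorem proj_bracket_zero (n : ℕ) (X Y : E) :
    S.proj n (S.bracket 0 X Y) = ∑ p ∈ Finset.HasAntidiagonal.antidiagonal n,
      S.proj n (ad (S.proj p.1 X) (S.proj p.2 Y)) := by
  rcases Nat.lt_or_ge m n with hn | hn
  · rw [S.proj_of_lt hn, Finset.sum_eq_zero]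
    exact fun p _ => S.proj_of_lt hn _
  have hsum : S.proj n (S.bracket 0 X Y) =
      ∑ i ∈ Finset.range (m + 1), ∑ j ∈ Finset.range (m + 1),
        if i + j = n then S.proj n (ad (S.proj i X) (S.proj j Y)) else 0 := by
    rw [bracket_zero_apply]
    simp only [map_sum, S.proj_proj]
    refine Finset.sum_congr rfl fun i _ => Finset.sum_congr rfl fun j _ => ?_
    by_cases h : i + j = n
    · rw [if_pos h.symm, if_pos h, h]
    · rw [if_neg (Ne.symm h), if_neg h]
  rw [hsum, ← Finset.sum_product', ← Finset.sum_filter]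
  refine Finset.sum_congr ?_ fun _ _ => rfl
  ext p
  simp only [Finset.mem_filter, Finset.mem_product, Finset.mem_range,
    Finset.HasAntidiagonal.mem_antidiagonal]
  omega

theorem bracket_skew (hskew : ∀ X Y, ad X Y = -ad Y X) (ε : ℝ) (X Y : E) :
    S.bracket ε X Y = -S.bracket ε Y X := by
  rw [bracket_apply, Finset.sum_comm, bracket_apply]
  simp only [← Finset.sum_neg_distrib]
  refine Finset.sum_congr rfl fun i _ => Finset.sum_congr rfl fun j _ =>
    Finset.sum_congr rfl fun k _ => ?_
  rw [hskew, map_neg, smul_neg, add_comm]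

theorem bracket_self (hself : ∀ X, ad X X = 0) (ε : ℝ) (X : E) : S.bracket ε X X = 0 := by
  have hskew : ∀ X Y, ad X Y = -ad Y X := fun X Y => by
    have hadd := hself (X + Y)
    simp only [map_add, add_apply, hself, zero_add, add_zero] at hadd
    exact eq_neg_of_add_eq_zero_right hadd
  have : IsAddTorsionFree E := .of_isTorsionFree ℝ E
  exact self_eq_neg.1 (S.bracket_skew hskew ε X X)

theorem norm_dil_le {ε : ℝ} (hε : 0 ≤ ε) (hε1 : ε ≤ 1) (x : E) :
    ‖S.dil ε x‖ ≤ ε * ((∑ i ∈ Finset.range (m + 1), ‖S.proj i‖) * ‖x‖) := by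
  rw [dil_apply, Finset.sum_mul, Finset.mul_sum]
  refine (norm_sum_le _ _).trans (Finset.sum_le_sum fun i _ => ?_)
  rw [norm_smul, norm_pow, Real.norm_of_nonneg hε]
  rcases Nat.eq_zero_or_pos i with rfl | hi
  · simp [S.proj_zero]
  · refine mul_le_mul ?_ ((S.proj i).le_opNorm x) (norm_nonneg _) hε
    exact pow_le_of_le_one hε hε1 (by omega)

theorem norm_dil_inv_le {ε : ℝ} (hε : 0 < ε) (hε1 : ε ≤ 1) (x : E) :
    ‖S.dil ε⁻¹ x‖ ≤ (ε ^ m)⁻¹ * ((∑ i ∈ Finset.range (m + 1), ‖S.proj i‖) * ‖x‖) := by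
  rw [dil_apply, Finset.sum_mul, Finset.mul_sum]
  refine (norm_sum_le _ _).trans (Finset.sum_le_sum fun i hi => ?_)
  rw [norm_smul, norm_pow, Real.norm_of_nonneg (by positivity)]
  refine mul_le_mul ?_ ((S.proj i).le_opNorm x) (norm_nonneg _) (by positivity)
  rw [inv_pow]
  refine inv_anti₀ (by positivity) (pow_le_pow_of_le_one hε.le hε1 ?_)
  have := Finset.mem_range.1 hi
  omega

theorem dil_inv_bchInt_dil [CompleteSpace E] {ε : ℝ} (hε : ε ≠ 0) (K : ℕ) (X Y : E) :
    S.dil ε⁻¹ (bchInt ad K (S.dil ε X) (S.dil ε Y)) = bchInt (S.bracket ε) K X Y := by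
  have hnat : S.dil ε (bchInt (S.bracket ε) K X Y) = bchInt ad K (S.dil ε X) (S.dil ε Y) :=
    units_apply_bchInt (S.dilUnit ε hε) (S.dil_bracket ε) K X Y
  rw [← hnat, S.dil_inv_dil hε]

theorem continuous_bchInt_bracket_zero [CompleteSpace E] (K : ℕ) :
    Continuous fun p : E × E => bchInt (S.bracket 0) K p.1 p.2 :=
  continuous_bchInt continuous_const continuous_fst continuous_snd

theorem tendstoUniformlyOn_bchInt_bracket [CompleteSpace E] (K : ℕ) {Q : Set (E × E)}
    (hQ : IsCompact Q) :
    TendstoUniformlyOn (fun (ε : ℝ) (p : E × E) => bchInt (S.bracket ε) K p.1 p.2)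
      (fun p => bchInt (S.bracket 0) K p.1 p.2) (𝓝 0) Q := by
  have hcont : Continuous fun q : ℝ × (E × E) => bchInt (S.bracket q.1) K q.2.1 q.2.2 :=
    continuous_bchInt (S.continuous_bracket.comp continuous_fst) (by fun_prop) (by fun_prop)
  rw [Metric.tendstoUniformlyOn_iff]
  intro η hη
  obtain ⟨v, hv, hclose⟩ := hQ.mem_uniformity_of_prod (s := univ)
    (f := fun (ε : ℝ) (p : E × E) => bchInt (S.bracket ε) K p.1 p.2) hcont.continuousOn
    (mem_univ (0 : ℝ)) (Metric.dist_mem_uniformity hη)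
  rw [nhdsWithin_univ] at hv
  filter_upwards [hv] with ε hε p hp
  rw [dist_comm]
  exact hclose ε hε p hp

/- A point of size `ε` has a remainder of size `ε ^ (m + 1)`, and `S.dil ε⁻¹` stretches by at most
`ε ^ (-m)`. -/
theorem tendstoUniformlyOn_dil_inv_of_isBigO {ρ : E × E → E}
    (hρ : ρ =O[𝓝 0] fun q => ‖q‖ ^ (m + 1)) {Q : Set (E × E)} (hQ : Bornology.IsBounded Q) :
    TendstoUniformlyOn (fun (ε : ℝ) (p : E × E) => S.dil ε⁻¹ (ρ (S.dil ε p.1, S.dil ε p.2)))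
      0 (𝓝[>] 0) Q := by
  obtain ⟨C, hC, hbound⟩ := hρ.exists_pos
  obtain ⟨r, hr, hball⟩ := Metric.eventually_nhds_iff_ball.1 hbound.bound
  obtain ⟨R, -, hR⟩ := hQ.exists_pos_norm_le
  set c := ∑ i ∈ Finset.range (m + 1), ‖S.proj i‖
  have hsmall : ∀ a b : ℝ, 0 < b → ∀ᶠ ε in 𝓝[>] (0 : ℝ), ε * a < b := fun a b hb =>
    nhdsWithin_le_nhds ((Continuous.tendsto' (f := fun ε : ℝ => ε * a) (by fun_prop) 0 0
      (zero_mul a)).eventually (gt_mem_nhds hb))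
  rw [Metric.tendstoUniformlyOn_iff]
  intro η hη
  filter_upwards [hsmall 1 1 one_pos, hsmall (c * R) r hr,
    hsmall (c * (C * (c * R) ^ (m + 1))) η hη, self_mem_nhdsWithin]
    with ε hε1 hεr hεη (hε : 0 < ε) p hp
  rw [mul_one] at hε1
  have hdil : ‖(S.dil ε p.1, S.dil ε p.2)‖ ≤ ε * (c * R) :=
    norm_prod_le_iff.2
      ⟨(S.norm_dil_le hε.le hε1.le p.1).trans (by gcongr; exact (norm_fst_le p).trans (hR p hp)),
        (S.norm_dil_le hε.le hε1.le p.2).trans (by gcongr; exact (norm_snd_le p).trans (hR p hp))⟩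
  have hrem : ‖ρ (S.dil ε p.1, S.dil ε p.2)‖ ≤ C * (ε * (c * R)) ^ (m + 1) := by
    refine (hball _ (mem_ball_zero_iff.2 (hdil.trans_lt hεr))).trans ?_
    rw [norm_pow, norm_norm]
    gcongr
  rw [Pi.zero_apply, dist_zero_left]
  calc ‖S.dil ε⁻¹ (ρ (S.dil ε p.1, S.dil ε p.2))‖
      ≤ (ε ^ m)⁻¹ * (c * ‖ρ (S.dil ε p.1, S.dil ε p.2)‖) := S.norm_dil_inv_le hε hε1.le _
    _ ≤ (ε ^ m)⁻¹ * (c * (C * (ε * (c * R)) ^ (m + 1))) := by gcongr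
    _ = ε * (c * (C * (c * R) ^ (m + 1))) := by
        rw [mul_pow ε]
        field_simp
        ring
    _ < η := hεη

theorem tendstoUniformlyOn_dil_inv [CompleteSpace E] {μ : E → E → E}
    (hμ : (fun q : E × E => μ q.1 q.2 - bchInt ad m q.1 q.2) =O[𝓝 0] fun q => ‖q‖ ^ (m + 1))
    {Q : Set (E × E)} (hQ : IsCompact Q) :
    TendstoUniformlyOn (fun (ε : ℝ) (p : E × E) => S.dil ε⁻¹ (μ (S.dil ε p.1) (S.dil ε p.2)))
      (fun p => bchInt (S.bracket 0) m p.1 p.2) (𝓝[>] 0) Q := by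
  have hbch : TendstoUniformlyOn (fun (ε : ℝ) (p : E × E) => bchInt (S.bracket ε) m p.1 p.2)
      (fun p => bchInt (S.bracket 0) m p.1 p.2) (𝓝[>] 0) Q := fun u hu =>
    nhdsWithin_le_nhds (S.tendstoUniformlyOn_bchInt_bracket m hQ u hu)
  have hsum := hbch.add (S.tendstoUniformlyOn_dil_inv_of_isBigO hμ hQ.isBounded)
  rw [add_zero] at hsum
  refine hsum.congr ?_
  filter_upwards [self_mem_nhdsWithin] with ε (hε : 0 < ε) p _
  simp only [Pi.add_apply, map_sub, S.dil_inv_bchInt_dil hε.ne', add_sub_cancel]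

end LayerSplitting

/-! ### Dynkin's form of the truncated product for a nilpotent bracket -/

/-- The lists of length `k` with entries in `P`, as a finite index set. -/
def listsOfLength {α : Type*} [DecidableEq α] (P : Finset α) : ℕ → Finset (List α)
  | 0 => {[]}
  | k + 1 => (P ×ˢ listsOfLength P k).image fun q => q.1 :: q.2

theorem mem_listsOfLength {α : Type*} [DecidableEq α] {P : Finset α} {k : ℕ} {l : List α} :
    l ∈ listsOfLength P k ↔ l.length = k ∧ ∀ q ∈ l, q ∈ P := by
  induction k generalizing l with
  | zero =>
    simp only [listsOfLength, Finset.mem_singleton, List.length_eq_zero_iff]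
    exact ⟨by rintro rfl; simp, And.left⟩
  | succ k ih =>
    simp only [listsOfLength, Finset.mem_image, Finset.mem_product, Prod.exists]
    constructor
    · rintro ⟨a, l', ⟨ha, hl'⟩, rfl⟩
      obtain ⟨hlen, hmem⟩ := ih.1 hl'
      exact ⟨by rw [List.length_cons, hlen], List.forall_mem_cons.2 ⟨ha, hmem⟩⟩
    · rintro ⟨hlen, hmem⟩
      match l with
      | [] => simp at hlen
      | a :: l' =>
        obtain ⟨ha, hmem'⟩ := List.forall_mem_cons.1 hmem
        exact ⟨a, l', ⟨ha, ih.2 ⟨by simpa using hlen, hmem'⟩⟩, rfl⟩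

theorem pairwiseDisjoint_listsOfLength {α : Type*} [DecidableEq α] (P : Finset α) {s : Set ℕ} :
    s.PairwiseDisjoint fun k => listsOfLength P (k + 1) := by
  intro i _ j _ hij
  refine Finset.disjoint_left.2 fun l hi hj => hij ?_
  have hlen := (mem_listsOfLength.1 hi).1.symm.trans (mem_listsOfLength.1 hj).1
  omega

theorem sum_listsOfLength_succ {α M : Type*} [DecidableEq α] [AddCommMonoid M] (P : Finset α)
    (k : ℕ) (f : List α → M) :
    ∑ l ∈ listsOfLength P (k + 1), f l = ∑ q ∈ P, ∑ l ∈ listsOfLength P k, f (q :: l) := by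
  rw [listsOfLength, Finset.sum_image, Finset.sum_product]
  rintro ⟨a, l⟩ _ ⟨b, l'⟩ _ h
  simpa using h

/-- The degree `∑ (rᵢ + sᵢ)` of a list of exponents `(rᵢ, sᵢ)`, as in `bchTerm`. -/
def blockDeg (l : List (ℕ × ℕ)) : ℕ := (l.map fun p => p.1 + p.2).sum

/-- The product `∏ rᵢ! sᵢ!` over a list of exponents `(rᵢ, sᵢ)`, as in `bchTerm`. -/
def blockFact (l : List (ℕ × ℕ)) : ℕ := (l.map fun p => p.1.factorial * p.2.factorial).prod

/-- The word `X ^ r₁ Y ^ s₁ X ^ r₂ Y ^ s₂ …` for a list of exponents `(rᵢ, sᵢ)`, as in `bchTerm`. -/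
def blockWord {E : Type*} (X Y : E) (l : List (ℕ × ℕ)) : List E :=
  l.flatMap fun p => List.replicate p.1 X ++ List.replicate p.2 Y

theorem length_blockWord {E : Type*} (X Y : E) (l : List (ℕ × ℕ)) :
    (blockWord X Y l).length = blockDeg l := by
  simp [blockWord, blockDeg, List.length_flatMap]

theorem length_le_blockDeg {l : List (ℕ × ℕ)} (h : (0, 0) ∉ l) : l.length ≤ blockDeg l := by
  induction l with
  | nil => simp
  | cons q l ih =>
    simp only [List.mem_cons, not_or] at h
    have hlen := ih h.2
    have hq : q.1 + q.2 ≠ 0 := fun hq => h.1 <| by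
      obtain ⟨hr, hs⟩ := Nat.add_eq_zero_iff.1 hq
      exact (Prod.ext hr hs).symm
    simp only [blockDeg, List.length_cons, List.map_cons, List.sum_cons] at hlen ⊢
    omega

theorem add_le_blockDeg {l : List (ℕ × ℕ)} {q : ℕ × ℕ} (h : q ∈ l) : q.1 + q.2 ≤ blockDeg l :=
  List.single_le_sum (by simp) _ (List.mem_map.2 ⟨q, h, rfl⟩)

/-- The pairs of exponents smaller than `N` and not both zero: they occur in Dynkin's formula for
a bracket all of whose words of length `N` vanish. -/
def blockIndex (N : ℕ) : Finset (ℕ × ℕ) := (Finset.range N ×ˢ Finset.range N).erase (0, 0)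

theorem zero_notMem_of_mem_listsOfLength {N k : ℕ} {l : List (ℕ × ℕ)}
    (h : l ∈ listsOfLength (blockIndex N) k) : (0, 0) ∉ l := fun hmem =>
  (Finset.mem_erase.1 ((mem_listsOfLength.1 h).2 _ hmem)).1 rfl

theorem le_blockDeg_of_mem_listsOfLength {N k : ℕ} {l : List (ℕ × ℕ)}
    (h : l ∈ listsOfLength (blockIndex N) k) : k ≤ blockDeg l :=
  (mem_listsOfLength.1 h).1 ▸ length_le_blockDeg (zero_notMem_of_mem_listsOfLength h)

theorem mem_listsOfLength_blockIndex {N : ℕ} {l : List (ℕ × ℕ)} (h : (0, 0) ∉ l)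
    (hdeg : blockDeg l < N) : l ∈ listsOfLength (blockIndex N) l.length := by
  refine mem_listsOfLength.2 ⟨rfl, fun q hq => ?_⟩
  have hle := add_le_blockDeg hq
  rw [blockIndex, Finset.mem_erase, Finset.mem_product, Finset.mem_range, Finset.mem_range]
  exact ⟨fun hq0 => h (hq0 ▸ hq), by omega, by omega⟩

section Nested

variable {E : Type*} [NormedAddCommGroup E] [NormedSpace ℝ E] (B : E →L[ℝ] E →L[ℝ] E)

/-- The right-nested bracket `B a₁ (B a₂ (… aₙ))` of a word `a₁ a₂ … aₙ`, the analogue of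
`nestedBracket` for a continuous bilinear map. -/
noncomputable def nestedApply : List E → E
  | [] => 0
  | [a] => a
  | a :: b :: l => B a (nestedApply (b :: l))

theorem nestedApply_cons (a : E) {l : List E} (hl : l ≠ []) :
    nestedApply B (a :: l) = B a (nestedApply B l) := by
  cases l with
  | nil => exact absurd rfl hl
  | cons b l => rfl

theorem nestedApply_replicate_append (r : ℕ) (a : E) {l : List E} (hl : l ≠ []) :
    nestedApply B (List.replicate r a ++ l) = (B a ^ r) (nestedApply B l) := by
  induction r with
  | zero => simp
  | succ r ih =>
    rw [List.replicate_succ, List.cons_append, nestedApply_cons B a (by simp [hl]), ih, pow_succ',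
      mul_apply_eq_comp]

theorem nestedApply_blockWord_cons (X Y : E) (q : ℕ × ℕ) {l : List (ℕ × ℕ)}
    (hl : blockWord X Y l ≠ []) :
    nestedApply B (blockWord X Y (q :: l)) =
      (B X ^ q.1 * B Y ^ q.2) (nestedApply B (blockWord X Y l)) := by
  rw [mul_apply_eq_comp, ← nestedApply_replicate_append B q.2 Y hl,
    ← nestedApply_replicate_append B q.1 X (by simp [hl])]
  simp [blockWord]

variable {B}

theorem nestedApply_replicate (hself : ∀ X, B X X = 0) (r : ℕ) (a : E) :
    nestedApply B (List.replicate (r + 2) a) = 0 := by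
  have hsplit : List.replicate (r + 2) a = List.replicate r a ++ [a, a] := by
    rw [List.replicate_add]
    rfl
  rw [hsplit, nestedApply_replicate_append B r a (by simp)]
  simp [nestedApply, hself]

theorem nestedApply_replicate_append_replicate (hself : ∀ X, B X X = 0) (r s : ℕ) (X Y : E) :
    nestedApply B (List.replicate r X ++ List.replicate (s + 2) Y) = 0 := by
  rw [nestedApply_replicate_append B r X (by simp), nestedApply_replicate hself, map_zero]

theorem pow_eq_zero_of_nestedApply_eq_zero {M : ℕ}
    (hnil : ∀ l : List E, M < l.length → nestedApply B l = 0) {r : ℕ} (hr : M ≤ r) (X : E) :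
    B X ^ r = 0 := by
  ext v
  have hword := nestedApply_replicate_append B r X (l := [v]) (by simp)
  rw [hnil _ (by rw [List.length_append, List.length_replicate, List.length_singleton]; omega)]
    at hword
  exact hword.symm

theorem exp_smul_eq_sum [CompleteSpace E] {M N : ℕ}
    (hnil : ∀ l : List E, M < l.length → nestedApply B l = 0) (hN : M ≤ N) (t : ℝ) (X : E) :
    NormedSpace.exp (t • B X) =
      ∑ r ∈ Finset.range N, (t ^ r / (r.factorial : ℝ)) • B X ^ r := by
  rw [NormedSpace.exp_eq_tsum ℝ]
  dsimp only
  rw [tsum_eq_sum (s := Finset.range N)]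
  · refine Finset.sum_congr rfl fun r _ => ?_
    rw [smul_pow, smul_smul, div_eq_inv_mul]
  · intro r hr
    rw [Finset.mem_range, not_lt] at hr
    rw [smul_pow, pow_eq_zero_of_nestedApply_eq_zero hnil (hN.trans hr), smul_zero, smul_zero]

theorem exp_mul_exp_sub_one [CompleteSpace E] {M N : ℕ}
    (hnil : ∀ l : List E, M < l.length → nestedApply B l = 0) (hN : M < N) (t : ℝ) (X Y : E) :
    NormedSpace.exp (t • B X) * NormedSpace.exp (t • B Y) - 1 =
      ∑ q ∈ blockIndex N, (t ^ (q.1 + q.2) / (q.1.factorial * q.2.factorial : ℝ)) •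
        (B X ^ q.1 * B Y ^ q.2) := by
  rw [blockIndex, ← add_left_inj
    ((t ^ (0 + 0) / (Nat.factorial 0 * Nat.factorial 0 : ℝ)) • (B X ^ 0 * B Y ^ 0)),
    Finset.sum_erase_add _ (a := ((0 : ℕ), (0 : ℕ))) _ (by simpa using by omega)]
  rw [exp_smul_eq_sum hnil hN.le, exp_smul_eq_sum hnil hN.le, Finset.sum_mul_sum,
    Finset.sum_product]
  simp only [add_zero, pow_zero, Nat.factorial_zero, Nat.cast_one, mul_one, div_one, one_smul,
    sub_add_cancel]
  refine Finset.sum_congr rfl fun r _ => Finset.sum_congr rfl fun s _ => ?_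
  rw [smul_mul_smul_comm, pow_add, mul_div_mul_comm]

theorem add_exp_apply_eq_sum [CompleteSpace E] {M N : ℕ} (hself : ∀ X, B X X = 0)
    (hnil : ∀ l : List E, M < l.length → nestedApply B l = 0) (hN : M + 2 ≤ N) (t : ℝ) (X Y : E) :
    X + NormedSpace.exp (t • B X) Y =
      ∑ q ∈ blockIndex N, (t ^ (q.1 + q.2 - 1) / (q.1.factorial * q.2.factorial : ℝ)) •
        nestedApply B (List.replicate q.1 X ++ List.replicate q.2 Y) := by
  rw [blockIndex, Finset.sum_erase _ (by simp [nestedApply]), Finset.sum_product_right]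
  obtain ⟨n, rfl⟩ : ∃ n, N = n + 1 + 1 := ⟨N - 2, by omega⟩
  rw [Finset.sum_range_succ', Finset.sum_range_succ']
  rw [Finset.sum_eq_zero (s := Finset.range n), zero_add, add_comm X]
  · congr 1
    · rw [exp_smul_eq_sum hnil (N := n + 1 + 1) (by omega), sum_apply]
      refine Finset.sum_congr rfl fun r _ => ?_
      rw [nestedApply_replicate_append B r X (by simp)]
      simp [nestedApply]
    · rw [Finset.sum_range_succ', Finset.sum_range_succ', Finset.sum_eq_zero]
      · simp [nestedApply]
      · intro r _
        simp only [List.replicate_zero, List.append_nil]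
        rw [nestedApply_replicate hself, smul_zero]
  · intro s _
    refine Finset.sum_eq_zero fun r _ => ?_
    rw [nestedApply_replicate_append_replicate hself, smul_zero]

theorem exp_mul_exp_sub_one_pow_apply_eq_sum [CompleteSpace E] {M N : ℕ}
    (hself : ∀ X, B X X = 0) (hnil : ∀ l : List E, M < l.length → nestedApply B l = 0)
    (hN : M + 2 ≤ N) (t : ℝ) (X Y : E) (k : ℕ) :
    ((NormedSpace.exp (t • B X) * NormedSpace.exp (t • B Y) - 1) ^ k)
        (X + NormedSpace.exp (t • B X) Y) =
      ∑ l ∈ listsOfLength (blockIndex N) (k + 1),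
        (t ^ (blockDeg l - 1) / (blockFact l : ℝ)) • nestedApply B (blockWord X Y l) := by
  induction k with
  | zero =>
    rw [sum_listsOfLength_succ, pow_zero, one_apply_eq_self,
      add_exp_apply_eq_sum hself hnil hN]
    simp [listsOfLength, blockDeg, blockFact, blockWord]
  | succ k ih =>
    rw [pow_succ', mul_apply_eq_comp, ih, sum_listsOfLength_succ _ (k + 1),
      exp_mul_exp_sub_one hnil (N := N) (by omega), sum_apply]
    refine Finset.sum_congr rfl fun q _ => ?_
    rw [smul_apply, map_sum (B X ^ q.1 * B Y ^ q.2), Finset.smul_sum]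
    refine Finset.sum_congr rfl fun l hl => ?_
    have hdeg := le_blockDeg_of_mem_listsOfLength hl
    have hword : blockWord X Y l ≠ [] := by
      rw [← List.length_pos_iff, length_blockWord]
      omega
    have hsub : blockDeg (q :: l) - 1 = (blockDeg l - 1) + (q.1 + q.2) := by
      simp only [blockDeg, List.map_cons, List.sum_cons] at hdeg ⊢
      omega
    have hfact : blockFact (q :: l) = q.1.factorial * q.2.factorial * blockFact l := by
      simp only [blockFact, List.map_cons, List.prod_cons]
    rw [nestedApply_blockWord_cons B X Y q hword, map_smul, smul_smul, hsub, hfact, pow_add]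
    congr 1
    push_cast
    ring

theorem bchIntegrand_eq_sum [CompleteSpace E] {M N : ℕ} (hself : ∀ X, B X X = 0)
    (hnil : ∀ l : List E, M < l.length → nestedApply B l = 0) (hN : M + 2 ≤ N) (K : ℕ) (X Y : E)
    (t : ℝ) :
    bchIntegrand B K X Y t = ∑ k ∈ Finset.range K, ∑ l ∈ listsOfLength (blockIndex N) (k + 1),
      t ^ (blockDeg l - 1) • ((-1 : ℝ) ^ (l.length - 1) / (l.length * blockFact l)) •
        nestedApply B (blockWord X Y l) := by
  rw [bchIntegrand, logTrunc, sum_apply]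
  refine Finset.sum_congr rfl fun k _ => ?_
  rw [smul_apply, exp_mul_exp_sub_one_pow_apply_eq_sum hself hnil hN, Finset.smul_sum]
  refine Finset.sum_congr rfl fun l hl => ?_
  rw [(mem_listsOfLength.1 hl).1, smul_smul, smul_smul, Nat.add_sub_cancel]
  congr 1
  push_cast
  field_simp

theorem integral_pow_pred_smul [CompleteSpace E] {d : ℕ} (hd : 1 ≤ d) (v : E) :
    ∫ t in (0 : ℝ)..1, t ^ (d - 1) • v = (d : ℝ)⁻¹ • v := by
  rw [intervalIntegral.integral_smul_const, integral_pow, Nat.sub_add_cancel hd, one_pow,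
    zero_pow (by omega), sub_zero, Nat.cast_sub hd, Nat.cast_one, sub_add_cancel, one_div]

theorem bchInt_eq_sum [CompleteSpace E] {M N : ℕ} (hself : ∀ X, B X X = 0)
    (hnil : ∀ l : List E, M < l.length → nestedApply B l = 0) (hN : M + 2 ≤ N) (K : ℕ) (X Y : E) :
    bchInt B K X Y = ∑ k ∈ Finset.range K, ∑ l ∈ listsOfLength (blockIndex N) (k + 1),
      ((-1 : ℝ) ^ (l.length - 1) / (l.length * blockDeg l * blockFact l : ℕ)) •
        nestedApply B (blockWord X Y l) := by
  simp only [bchInt, bchIntegrand_eq_sum hself hnil hN]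
  rw [intervalIntegral.integral_finsetSum
    fun k _ => Continuous.intervalIntegrable (by fun_prop) _ _]
  refine Finset.sum_congr rfl fun k _ => ?_
  rw [intervalIntegral.integral_finsetSum
    fun k _ => Continuous.intervalIntegrable (by fun_prop) _ _]
  refine Finset.sum_congr rfl fun l hl => ?_
  have hdeg : 1 ≤ blockDeg l := Nat.le_of_add_left_le (le_blockDeg_of_mem_listsOfLength hl)
  rw [integral_pow_pred_smul hdeg, smul_smul]
  congr 1
  push_cast
  ring

end Nested

section Dynkin

variable {E L : Type*} [NormedAddCommGroup E] [NormedSpace ℝ E] [LieRing L] [LieAlgebra ℝ L]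
  {B : E →L[ℝ] E →L[ℝ] E} (θ : E →ₗ[ℝ] L)

theorem map_nestedApply (hθ : ∀ X Y, θ (B X Y) = ⁅θ X, θ Y⁆) (l : List E) :
    θ (nestedApply B l) = nestedBracket (l.map θ) := by
  induction l with
  | nil => exact map_zero θ
  | cons a l ih =>
    cases l with
    | nil => rfl
    | cons b l =>
      rw [nestedApply, hθ, ih]
      rfl

theorem bchTerm_map (hθ : ∀ X Y, θ (B X Y) = ⁅θ X, θ Y⁆) (X Y : E) (l : List (ℕ × ℕ)) :
    bchTerm (θ X) (θ Y) l =
      θ (((-1 : ℝ) ^ (l.length - 1) / (l.length * blockDeg l * blockFact l : ℕ)) •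
        nestedApply B (blockWord X Y l)) := by
  rw [map_smul, map_nestedApply θ hθ, bchTerm]
  congr 2
  simp [blockWord, List.map_flatMap]

theorem blockDeg_le_of_bchTerm_ne_zero {M : ℕ}
    (hnil : ∀ l : List E, M < l.length → nestedApply B l = 0)
    (hθ : ∀ X Y, θ (B X Y) = ⁅θ X, θ Y⁆) {X Y : E} {l : List (ℕ × ℕ)}
    (hl : bchTerm (θ X) (θ Y) l ≠ 0) : blockDeg l ≤ M := by
  by_contra! hdeg
  rw [bchTerm_map θ hθ, hnil _ (by rwa [length_blockWord]), smul_zero, map_zero] at hl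
  exact hl rfl

theorem map_bchInt_eq_bchMul [CompleteSpace E] {M : ℕ} (hself : ∀ X, B X X = 0)
    (hnil : ∀ l : List E, M < l.length → nestedApply B l = 0)
    (hθ : ∀ X Y, θ (B X Y) = ⁅θ X, θ Y⁆) (X Y : E) :
    θ (bchInt B M X Y) = bchMul (θ X) (θ Y) := by
  rw [bchInt_eq_sum hself hnil le_rfl, bchMul,
    ← Finset.sum_biUnion (pairwiseDisjoint_listsOfLength _), map_sum,
    finsum_mem_eq_sum_of_inter_support_eq]
  · exact (Finset.sum_congr rfl fun l _ => bchTerm_map θ hθ X Y l).symm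
  ext l
  simp only [Finset.coe_biUnion, mem_inter_iff, mem_ofPred_eq, Function.mem_support, mem_iUnion,
    Finset.mem_coe, Finset.mem_range, exists_prop]
  refine and_congr_left fun hl => ⟨fun ⟨hne, hzero⟩ => ?_, ?_⟩
  · have hdeg := blockDeg_le_of_bchTerm_ne_zero θ hnil hθ hl
    have hlen := length_le_blockDeg hzero
    have hpos := List.length_pos_iff.2 hne
    refine ⟨l.length - 1, by omega, ?_⟩
    rw [Nat.sub_add_cancel hpos]
    exact mem_listsOfLength_blockIndex hzero (by omega)
  · rintro ⟨k, -, hmem⟩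
    refine ⟨?_, zero_notMem_of_mem_listsOfLength hmem⟩
    rintro rfl
    exact absurd (mem_listsOfLength.1 hmem).1 (by simp)

end Dynkin

/-! ### The bracket of the nilpotentisation as a limit of rescaled brackets -/

namespace LayerSplitting

variable {E : Type*} [NormedAddCommGroup E] [NormedSpace ℝ E] {m : ℕ}
  {ad : E →L[ℝ] E →L[ℝ] E} (S : LayerSplitting m ad)

theorem proj_nestedApply_bracket_zero (l : List E) :
    ∀ n < l.length, S.proj n (nestedApply (S.bracket 0) l) = 0 := by
  induction l with
  | nil => exact fun n hn => absurd hn n.not_lt_zero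
  | cons a l ih =>
    intro n hn
    rcases eq_or_ne l [] with rfl | hl
    · obtain rfl : n = 0 := by simpa using hn
      rw [S.proj_zero]; rfl
    · rw [nestedApply_cons _ a hl, S.proj_bracket_zero]
      refine Finset.sum_eq_zero fun p hp => ?_
      rw [Finset.HasAntidiagonal.mem_antidiagonal] at hp
      rw [List.length_cons] at hn
      rcases Nat.eq_zero_or_pos p.1 with h | h
      · simp only [h, S.proj_zero, zero_apply, map_zero]
      · rw [ih p.2 (by omega), map_zero, map_zero]

theorem nestedApply_bracket_zero {l : List E} (hl : m < l.length) :
    nestedApply (S.bracket 0) l = 0 := by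
  refine S.eq_zero_of_proj fun k => ?_
  rcases Nat.lt_or_ge m k with hk | hk
  · exact S.proj_of_lt hk _
  · exact S.proj_nestedApply_bracket_zero l k (by omega)

end LayerSplitting

namespace Strata

variable {L : Type*} [LieRing L] [LieAlgebra ℝ L] {D : Submodule ℝ L} (S : Strata D)

/-- The projection to `W i` of the decomposition `𝔤 = ⨁ Wᵢ`, as an endomorphism of `𝔤`. -/
noncomputable def component (i : ℕ) : L →ₗ[ℝ] L :=
  (S.W i).subtype ∘ₗ DirectSum.component ℝ ℕ (fun i => S.W i) i ∘ₗ S.decomp.toLinearMap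

theorem decomp_of_mem {i : ℕ} {x : L} (hx : x ∈ S.W i) :
    S.decomp x = DirectSum.lof ℝ ℕ (fun i => S.W i) i ⟨x, hx⟩ := by
  rw [decomp, LinearEquiv.symm_apply_eq]
  exact (DirectSum.coeLinearMap_lof S.W i ⟨x, hx⟩).symm

theorem component_mem (i : ℕ) (x : L) : S.component i x ∈ S.W i := Subtype.property _

theorem component_of_mem {i : ℕ} (j : ℕ) {x : L} (hx : x ∈ S.W i) :
    S.component j x = if j = i then x else 0 := by
  rw [component, LinearMap.comp_apply, LinearMap.comp_apply, LinearEquiv.coe_coe,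
    S.decomp_of_mem hx]
  split_ifs with h
  · subst h
    rw [DirectSum.component.lof_self]
    rfl
  · rw [DirectSum.component.of, dif_neg (Ne.symm h), map_zero]

theorem component_eq_zero {i k : ℕ} (h : i < k) {x : L} (hx : x ∈ lieFiltration D i) :
    S.component k x = 0 := by
  have hker : lieFiltration D i ≤ LinearMap.ker (S.component k) := by
    rw [S.filtration_eq]
    refine iSup₂_le fun j hj y hy => ?_
    rw [LinearMap.mem_ker, S.component_of_mem k hy, if_neg (by omega)]
  exact hker hx

theorem component_zero : S.component 0 = 0 := by
  ext x
  exact S.le_filtration 0 (S.component_mem 0 x)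

theorem sub_component_mem {n : ℕ} {x : L} (hx : x ∈ lieFiltration D n) :
    x - S.component n x ∈ lieFiltration D (n - 1) := by
  have hcomap : lieFiltration D n ≤
      (lieFiltration D (n - 1)).comap (LinearMap.id - S.component n) := by
    conv_lhs => rw [S.filtration_eq]
    refine iSup₂_le fun j hj y hy => ?_
    rw [Submodule.mem_comap, LinearMap.sub_apply, LinearMap.id_apply, S.component_of_mem n hy]
    split_ifs with h
    · rw [sub_self]
      exact zero_mem _
    · rw [sub_zero]
      exact lieFiltration_mono D (by omega) (S.le_filtration j hy)
  exact hcomap hx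

theorem sum_component {m : ℕ} (hm : lieFiltration D m = ⊤) (x : L) :
    ∑ i ∈ Finset.range (m + 1), S.component i x = x := by
  have heq : lieFiltration D m ≤ LinearMap.eqLocus (∑ i ∈ Finset.range (m + 1), S.component i)
      LinearMap.id := by
    rw [S.filtration_eq]
    refine iSup₂_le fun j hj y hy => ?_
    rw [LinearMap.mem_eqLocus, LinearMap.sum_apply, LinearMap.id_apply, Finset.sum_eq_single j]
    · rw [S.component_of_mem j hy, if_pos rfl]
    · intro i _ hi
      rw [S.component_of_mem i hy, if_neg hi]
    · intro h
      exact absurd (Finset.mem_range.2 (by omega)) h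
  have hx := heq (hm ▸ Submodule.mem_top : x ∈ lieFiltration D m)
  rwa [LinearMap.mem_eqLocus, LinearMap.sum_apply] at hx

theorem dil_of_mem (ε : ℝ) {i : ℕ} {x : L} (hx : x ∈ S.W i) : S.dil ε x = ε ^ i • x := by
  rw [dil, LinearMap.comp_apply, LinearEquiv.coe_coe, S.decomp_of_mem hx, DirectSum.toModule_lof]
  rfl

theorem dil_eq_sum {m : ℕ} (hm : lieFiltration D m = ⊤) (ε : ℝ) (x : L) :
    S.dil ε x = ∑ i ∈ Finset.range (m + 1), ε ^ i • S.component i x := by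
  conv_lhs => rw [← S.sum_component hm x, map_sum]
  exact Finset.sum_congr rfl fun i _ => S.dil_of_mem ε (S.component_mem i x)

theorem ident_of_mem {i : ℕ} {x : L} (hx : x ∈ S.W i) :
    S.ident x = NilAlgebra.cls D i ⟨x, S.le_filtration i hx⟩ := by
  rw [ident, LinearEquiv.trans_apply, S.decomp_of_mem hx]
  exact DFinsupp.mapRange_single (hf := fun i => map_zero _)

theorem ident_component {n : ℕ} {z : L} (hz : z ∈ lieFiltration D n) :
    S.ident (S.component n z) = NilAlgebra.cls D n ⟨z, hz⟩ := by
  rw [S.ident_of_mem (S.component_mem n z), eq_comm, ← sub_eq_zero, ← map_sub]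
  exact NilAlgebra.cls_eq_zero (sub_mem hz (S.le_filtration n (S.component_mem n z)))
    (S.sub_component_mem hz)

variable {E : Type*} [NormedAddCommGroup E] [NormedSpace ℝ E] [FiniteDimensional ℝ E]
  (φ : E ≃ₗ[ℝ] L) {ad : E →L[ℝ] E →L[ℝ] E} (had : ∀ X Y, φ (ad X Y) = ⁅φ X, φ Y⁆) {m : ℕ}
  (hm : lieFiltration D m = ⊤)

/-- The splitting into layers which the decomposition `𝔤 = ⨁ Wᵢ` induces on a normed space `E`
identified with `𝔤` by `φ`. -/
noncomputable def layerSplitting : LayerSplitting m ad where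
  proj i := LinearMap.toContinuousLinearMap (φ.symm.toLinearMap ∘ₗ S.component i ∘ₗ φ.toLinearMap)
  sum_proj x := by
    simp only [LinearMap.coe_toContinuousLinearMap', LinearMap.comp_apply, LinearEquiv.coe_coe]
    rw [← map_sum, S.sum_component hm, φ.symm_apply_apply]
  proj_proj i j x := by
    simp only [LinearMap.coe_toContinuousLinearMap', LinearMap.comp_apply, LinearEquiv.coe_coe,
      φ.apply_symm_apply]
    rw [S.component_of_mem i (S.component_mem j _)]
    split_ifs
    · rfl
    · exact map_zero _
  proj_zero := by
    ext x
    simp [S.component_zero]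
  proj_ad i j k x y h := by
    simp only [LinearMap.coe_toContinuousLinearMap', LinearMap.comp_apply, LinearEquiv.coe_coe,
      had, φ.apply_symm_apply]
    rw [S.component_eq_zero h, map_zero]
    exact lie_mem_lieFiltration D i j (S.le_filtration i (S.component_mem i _))
      (S.le_filtration j (S.component_mem j _))

theorem layerSplitting_proj (i : ℕ) (x : E) :
    (S.layerSplitting φ had hm).proj i x = φ.symm (S.component i (φ x)) := rfl

theorem layerSplitting_dil (ε : ℝ) (x : E) :
    φ ((S.layerSplitting φ had hm).dil ε x) = S.dil ε (φ x) := by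
  rw [LayerSplitting.dil_apply, S.dil_eq_sum hm, map_sum]
  simp only [map_smul, layerSplitting_proj, φ.apply_symm_apply]

theorem ident_layerSplitting_bracket (X Y : E) :
    S.ident (φ ((S.layerSplitting φ had hm).bracket 0 X Y)) =
      ⁅S.ident (φ X), S.ident (φ Y)⁆ := by
  rw [LayerSplitting.bracket_zero_apply]
  conv_rhs => rw [← S.sum_component hm (φ X), ← S.sum_component hm (φ Y)]
  simp only [map_sum]
  rw [sum_lie_sum]
  refine Finset.sum_congr rfl fun i _ => Finset.sum_congr rfl fun j _ => ?_
  simp only [layerSplitting_proj, φ.apply_symm_apply, had]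
  rw [S.ident_of_mem (S.component_mem i _), S.ident_of_mem (S.component_mem j _),
    NilAlgebra.cls_lie_cls, S.ident_component]

theorem ident_bchInt (hself : ∀ X, ad X X = 0) (X Y : E) :
    S.ident (φ (bchInt ((S.layerSplitting φ had hm).bracket 0) m X Y)) =
      bchMul (S.ident (φ X)) (S.ident (φ Y)) :=
  have : CompleteSpace E := FiniteDimensional.complete ℝ E
  map_bchInt_eq_bchMul (S.ident.toLinearMap ∘ₗ φ.toLinearMap)
    (LayerSplitting.bracket_self _ hself 0)
    (fun _ hl => LayerSplitting.nestedApply_bracket_zero _ hl)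
    (S.ident_layerSplitting_bracket φ had hm) X Y

end Strata

/-! ### Germs of topological groups with dilatations -/

/-- The germ at the neutral element `one` of a local topological group. In contrast to
`LocalGroupData.IsLocalGroup` no uniformity is involved: all laws hold eventually near `one`. -/
structure LocalGroupGerm {X : Type*} [TopologicalSpace X] (one : X) (mul : X → X → X)
    (inv : X → X) : Prop where
  assoc : ∀ᶠ p : X × X × X in 𝓝 (one, one, one),
    mul (mul p.1 p.2.1) p.2.2 = mul p.1 (mul p.2.1 p.2.2)
  one_mul : ∀ᶠ x in 𝓝 one, mul one x = x
  mul_one : ∀ᶠ x in 𝓝 one, mul x one = x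
  inv_one : inv one = one
  inv_mul : ∀ᶠ x in 𝓝 one, mul (inv x) x = one
  mul_inv : ∀ᶠ x in 𝓝 one, mul x (inv x) = one
  continuousAt_mul : ∀ᶠ p : X × X in 𝓝 (one, one), ContinuousAt (fun p : X × X => mul p.1 p.2) p
  continuousAt_inv : ∀ᶠ x in 𝓝 one, ContinuousAt inv x

namespace LocalGroupGerm

variable {X Y : Type*} [TopologicalSpace X] [TopologicalSpace Y] {one : X} {mul mul' : X → X → X}
  {inv inv' : X → X}

theorem tendsto_mul (h : LocalGroupGerm one mul inv) {α : Type*} {l : Filter α} {f g : α → X}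
    (hf : Tendsto f l (𝓝 one)) (hg : Tendsto g l (𝓝 one)) :
    Tendsto (fun a => mul (f a) (g a)) l (𝓝 one) := by
  have hmul := h.continuousAt_mul.self_of_nhds.tendsto
  simp only [h.one_mul.self_of_nhds] at hmul
  exact hmul.comp (hf.prodMk_nhds hg)

theorem tendsto_inv (h : LocalGroupGerm one mul inv) : Tendsto inv (𝓝 one) (𝓝 one) := by
  have hinv := h.continuousAt_inv.self_of_nhds.tendsto
  rwa [h.inv_one] at hinv

theorem eventually_assoc_comp (h : LocalGroupGerm one mul inv) {α : Type*} {l : Filter α}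
    {f g k : α → X} (hf : Tendsto f l (𝓝 one)) (hg : Tendsto g l (𝓝 one))
    (hk : Tendsto k l (𝓝 one)) :
    ∀ᶠ a in l, mul (mul (f a) (g a)) (k a) = mul (f a) (mul (g a) (k a)) :=
  (hf.prodMk_nhds (hg.prodMk_nhds hk)).eventually h.assoc

theorem eventually_assoc_congr (h : LocalGroupGerm one mul inv)
    (hmul : ∀ᶠ p : X × X in 𝓝 (one, one), mul' p.1 p.2 = mul p.1 p.2) :
    ∀ᶠ p : X × X × X in 𝓝 (one, one, one),
      mul' (mul' p.1 p.2.1) p.2.2 = mul' p.1 (mul' p.2.1 p.2.2) := by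
  have hx : Tendsto (fun p : X × X × X => p.1) (𝓝 (one, one, one)) (𝓝 one) :=
    continuous_fst.tendsto _
  have hy : Tendsto (fun p : X × X × X => p.2.1) (𝓝 (one, one, one)) (𝓝 one) :=
    (continuous_fst.comp continuous_snd).tendsto _
  have hz : Tendsto (fun p : X × X × X => p.2.2) (𝓝 (one, one, one)) (𝓝 one) :=
    (continuous_snd.comp continuous_snd).tendsto _
  filter_upwards [h.assoc, (hx.prodMk_nhds hy).eventually hmul, (hy.prodMk_nhds hz).eventually hmul,
    ((h.tendsto_mul hx hy).prodMk_nhds hz).eventually hmul,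
    (hx.prodMk_nhds (h.tendsto_mul hy hz)).eventually hmul] with p hassoc hxy hyz hxy_z hx_yz
  rw [hxy, hyz, hxy_z, hx_yz, hassoc]

theorem congr (h : LocalGroupGerm one mul inv)
    (hmul : ∀ᶠ p : X × X in 𝓝 (one, one), mul' p.1 p.2 = mul p.1 p.2)
    (hinv : ∀ᶠ x in 𝓝 one, inv' x = inv x) : LocalGroupGerm one mul' inv' where
  assoc := h.eventually_assoc_congr hmul
  one_mul := by
    filter_upwards [h.one_mul, (tendsto_const_nhds.prodMk_nhds tendsto_id).eventually hmul]
      with x hone hx using hx.trans hone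
  mul_one := by
    filter_upwards [h.mul_one, (tendsto_id.prodMk_nhds tendsto_const_nhds).eventually hmul]
      with x hone hx using hx.trans hone
  inv_one := hinv.self_of_nhds.trans h.inv_one
  inv_mul := by
    filter_upwards [h.inv_mul, hinv, (h.tendsto_inv.prodMk_nhds tendsto_id).eventually hmul]
      with x hone hinvx hx
    rw [hinvx]
    exact hx.trans hone
  mul_inv := by
    filter_upwards [h.mul_inv, hinv, (tendsto_id.prodMk_nhds h.tendsto_inv).eventually hmul]
      with x hone hinvx hx
    rw [hinvx]
    exact hx.trans hone
  continuousAt_mul := by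
    filter_upwards [h.continuousAt_mul, eventually_eventually_nhds.2 hmul] with p hcont heq
    exact hcont.congr (heq.mono fun _ => Eq.symm)
  continuousAt_inv := by
    filter_upwards [h.continuousAt_inv, eventually_eventually_nhds.2 hinv] with p hcont heq
    exact hcont.congr (heq.mono fun _ => Eq.symm)

theorem eventually_assoc_map (h : LocalGroupGerm one mul inv) (e : OpenPartialHomeomorph X Y)
    (h0 : one ∈ e.source) :
    ∀ᶠ p : Y × Y × Y in 𝓝 (e one, e one, e one),
      e (mul (e.symm (e (mul (e.symm p.1) (e.symm p.2.1)))) (e.symm p.2.2)) =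
        e (mul (e.symm p.1) (e.symm (e (mul (e.symm p.2.1) (e.symm p.2.2))))) := by
  have hsymm := e.tendsto_symm h0
  have hx : Tendsto (fun p : Y × Y × Y => e.symm p.1) (𝓝 (e one, e one, e one)) (𝓝 one) :=
    hsymm.comp (continuous_fst.tendsto _)
  have hy : Tendsto (fun p : Y × Y × Y => e.symm p.2.1) (𝓝 (e one, e one, e one)) (𝓝 one) :=
    hsymm.comp ((continuous_fst.comp continuous_snd).tendsto _)
  have hz : Tendsto (fun p : Y × Y × Y => e.symm p.2.2) (𝓝 (e one, e one, e one)) (𝓝 one) :=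
    hsymm.comp ((continuous_snd.comp continuous_snd).tendsto _)
  filter_upwards [h.eventually_assoc_comp hx hy hz,
    (h.tendsto_mul hx hy).eventually (e.eventually_left_inverse h0),
    (h.tendsto_mul hy hz).eventually (e.eventually_left_inverse h0)] with p hassoc hxy hyz
  rw [hxy, hyz, hassoc]

theorem eventually_continuousAt_mul_map (h : LocalGroupGerm one mul inv)
    (e : OpenPartialHomeomorph X Y) (h0 : one ∈ e.source) :
    ∀ᶠ p : Y × Y in 𝓝 (e one, e one),
      ContinuousAt (fun p : Y × Y => e (mul (e.symm p.1) (e.symm p.2))) p := by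
  have hfst : Tendsto (fun p : Y × Y => p.1) (𝓝 (e one, e one)) (𝓝 (e one)) :=
    continuous_fst.tendsto _
  have hsnd : Tendsto (fun p : Y × Y => p.2) (𝓝 (e one, e one)) (𝓝 (e one)) :=
    continuous_snd.tendsto _
  have hx := (e.tendsto_symm h0).comp hfst
  have hy := (e.tendsto_symm h0).comp hsnd
  have htarget := e.open_target.mem_nhds (e.map_source h0)
  filter_upwards [(hx.prodMk_nhds hy).eventually h.continuousAt_mul,
    (h.tendsto_mul hx hy).eventually (e.open_source.mem_nhds h0), hfst.eventually htarget,
    hsnd.eventually htarget] with p hcont hmem hp₁ hp₂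
  have hsymm : ContinuousAt (fun p : Y × Y => (e.symm p.1, e.symm p.2)) p :=
    ((e.continuousAt_symm hp₁).comp continuousAt_fst).prodMk
      ((e.continuousAt_symm hp₂).comp continuousAt_snd)
  exact (e.continuousAt hmem).comp (f := fun p : Y × Y => mul (e.symm p.1) (e.symm p.2))
    (ContinuousAt.comp (f := fun p : Y × Y => (e.symm p.1, e.symm p.2)) hcont hsymm)

theorem map (h : LocalGroupGerm one mul inv) (e : OpenPartialHomeomorph X Y) (h0 : one ∈ e.source) :
    LocalGroupGerm (e one) (fun x y => e (mul (e.symm x) (e.symm y)))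
      (fun x => e (inv (e.symm x))) := by
  have hsymm := e.tendsto_symm h0
  have hright := e.eventually_right_inverse (e.map_source h0)
  have hinv : ∀ᶠ y in 𝓝 (e one), e.symm (e (inv (e.symm y))) = inv (e.symm y) :=
    (h.tendsto_inv.comp hsymm).eventually (e.eventually_left_inverse h0)
  refine ⟨h.eventually_assoc_map e h0, ?_, ?_, ?_, ?_, ?_, h.eventually_continuousAt_mul_map e h0,
    ?_⟩
  · filter_upwards [hsymm.eventually h.one_mul, hright] with y hone hy
    rw [e.left_inv h0, hone, hy]
  · filter_upwards [hsymm.eventually h.mul_one, hright] with y hone hy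
    rw [e.left_inv h0, hone, hy]
  · rw [e.left_inv h0, h.inv_one]
  · filter_upwards [hsymm.eventually h.inv_mul, hinv] with y hone hy
    rw [hy, hone]
  · filter_upwards [hsymm.eventually h.mul_inv, hinv] with y hone hy
    rw [hy, hone]
  · filter_upwards [hsymm.eventually h.continuousAt_inv,
      (h.tendsto_inv.comp hsymm).eventually (e.open_source.mem_nhds h0),
      e.open_target.mem_nhds (e.map_source h0)] with y hcont hmem hy
    exact (e.continuousAt hmem).comp (f := fun y => inv (e.symm y))
      (ContinuousAt.comp hcont (e.continuousAt_symm hy))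

theorem exists_assoc (h : LocalGroupGerm one mul inv) :
    ∃ U ∈ 𝓝 one, ∀ x ∈ U, ∀ y ∈ U, ∀ z ∈ U, mul (mul x y) z = mul x (mul y z) := by
  have hassoc := h.assoc
  rw [nhds_prod_eq, nhds_prod_eq] at hassoc
  obtain ⟨U, hU, V, hV, hUV⟩ := mem_prod_iff.1 hassoc
  obtain ⟨V', hV', hVV⟩ := mem_prod_same_iff.1 hV
  exact ⟨U ∩ V', inter_mem hU hV', fun x hx y hy z hz =>
    hUV (mk_mem_prod hx.1 (hVV (mk_mem_prod hy.2 hz.2)))⟩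

/- Near the neutral element the space has a compact neighbourhood, on which continuity is uniform
for every uniformity of the topology. -/
theorem isLocalGroup [LocallyCompactSpace X] (h : LocalGroupGerm one mul inv) (u : UniformSpace X)
    (hu : u.toTopologicalSpace = ‹TopologicalSpace X›) :
    (LocalGroupData.mk u one mul inv).IsLocalGroup := by
  subst hu
  obtain ⟨U, hU, hassoc⟩ := h.exists_assoc
  obtain ⟨V, hV, hcont⟩ : ∃ V ∈ 𝓝 one, ∀ x ∈ V, ∀ y ∈ V,
      ContinuousAt (fun p : X × X => mul p.1 p.2) (x, y) := by
    have hmul := h.continuousAt_mul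
    rw [nhds_prod_eq] at hmul
    obtain ⟨V, hV, hVV⟩ := mem_prod_same_iff.1 hmul
    exact ⟨V, hV, fun x hx y hy => hVV (mk_mem_prod hx hy)⟩
  have hall : ∀ᶠ x in 𝓝 one, x ∈ U ∧ x ∈ V ∧ (mul one x = x ∧ mul x one = x) ∧
      (mul (inv x) x = one ∧ mul x (inv x) = one) ∧ ContinuousAt inv x :=
    Filter.Eventually.and hU (Filter.Eventually.and hV ((h.one_mul.and h.mul_one).and
      ((h.inv_mul.and h.mul_inv).and h.continuousAt_inv)))
  obtain ⟨K, hK, hKs, hKc⟩ := local_compact_nhds hall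
  refine ⟨K, hK, fun x hx y hy z hz => hassoc x (hKs hx).1 y (hKs hy).1 z (hKs hz).1,
    fun x hx => (hKs hx).2.2.1, fun x hx => (hKs hx).2.2.2.1, ?_, ?_⟩
  · refine (hKc.prod hKc).uniformContinuousOn_of_continuous fun p hp => ?_
    exact (hcont p.1 (hKs hp.1).2.1 p.2 (hKs hp.2).2.1).continuousWithinAt
  · exact hKc.uniformContinuousOn_of_continuous fun x hx => (hKs hx).2.2.2.2.continuousWithinAt

end LocalGroupGerm

theorem tendstoUniformlyOn_of_isCompact {ι X Y : Type*} [TopologicalSpace X] [UniformSpace Y]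
    {l : Filter ι} {F : ι → X → Y} {f : X → Y} {K : Set X} (hK : IsCompact K)
    (hf : ∀ x ∈ K, ContinuousAt f x)
    (hF : ∀ x ∈ K, Tendsto (fun p : ι × X => F p.1 p.2) (l ×ˢ 𝓝 x) (𝓝 (f x))) :
    TendstoUniformlyOn F f l K := by
  rw [← tendstoLocallyUniformlyOn_iff_tendstoUniformlyOn_of_compact hK,
    tendstoLocallyUniformlyOn_iff_forall_tendsto]
  intro x hx
  have hlim : Tendsto (fun p : ι × X => f p.2) (l ×ˢ 𝓝 x) (𝓝 (f x)) :=
    (hf x hx).tendsto.comp tendsto_snd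
  exact ((hlim.prodMk_nhds (hF x hx)).mono_right (nhds_le_uniformity (f x))).mono_left
    (prod_mono le_rfl nhdsWithin_le_nhds)

/-- A germ of topological group with dilatations `δ` and with limit `β` of its rescaled products.
Limits are joint in the factor and the point, which amounts to locally uniform convergence to a
continuous limit. -/
structure DilatationGerm {X : Type*} [TopologicalSpace X] (one : X) (mul : X → X → X)
    (inv : X → X) (δ : ℝ → X → X) (β : X → X → X) : Prop where
  group : LocalGroupGerm one mul inv
  tangent : LocalGroupGerm one β inv
  continuousAt_dil : ∀ᶠ p : ℝ × X in 𝓝 (1, one), ContinuousAt (fun p : ℝ × X => δ p.1 p.2) p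
  tendsto_dil : ∀ ε > 0, Tendsto (δ ε) (𝓝 one) (𝓝 one)
  dil_mul : ∀ ε > 0, ∀ η > 0, ∀ᶠ x in 𝓝 one, δ (ε * η⁻¹) x = δ ε (δ η⁻¹ x)
  tendsto_one : ∀ᶠ x in 𝓝 one,
    Tendsto (fun p : ℝ × X => δ p.1 p.2) (𝓝[>] 0 ×ˢ 𝓝 x) (𝓝 one)
  tendsto_mul : ∀ᶠ p in 𝓝 (one, one),
    Tendsto (fun q : ℝ × X × X => δ q.1⁻¹ (mul (δ q.1 q.2.1) (δ q.1 q.2.2))) (𝓝[>] 0 ×ˢ 𝓝 p)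
      (𝓝 (β p.1 p.2))
  tendsto_inv : ∀ᶠ x in 𝓝 one,
    Tendsto (fun q : ℝ × X => δ q.1⁻¹ (inv (δ q.1 q.2))) (𝓝[>] 0 ×ˢ 𝓝 x) (𝓝 (inv x))

namespace DilatationGerm

variable {X : Type*} [TopologicalSpace X] [T2Space X] {one : X} {mul : X → X → X} {inv : X → X}
  {δ : ℝ → X → X} {β : X → X → X}

theorem virtualMul_eq (u : UniformSpace X) (hu : u.toTopologicalSpace = ‹TopologicalSpace X›)
    {x y b : X} (h : Tendsto (fun ε => δ ε⁻¹ (mul (δ ε x) (δ ε y))) (𝓝[>] 0) (𝓝 b)) :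
    (LocalGroupData.mk u one mul inv).virtualMul δ x y = b := by
  subst hu
  exact h.limUnder_eq

theorem eventually_virtualMul_eq (h : DilatationGerm one mul inv δ β) (u : UniformSpace X)
    (hu : u.toTopologicalSpace = ‹TopologicalSpace X›) :
    ∀ᶠ p : X × X in 𝓝 (one, one),
      (LocalGroupData.mk u one mul inv).virtualMul δ p.1 p.2 = β p.1 p.2 := by
  filter_upwards [h.tendsto_mul] with p hp
  exact virtualMul_eq u hu (hp.comp (tendsto_id.prodMk (tendsto_const_nhds (x := p))))

theorem isLocalGroup_virtualTangent [LocallyCompactSpace X] (h : DilatationGerm one mul inv δ β)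
    (u : UniformSpace X) (hu : u.toTopologicalSpace = ‹TopologicalSpace X›) :
    ((LocalGroupData.mk u one mul inv).virtualTangent δ).IsLocalGroup :=
  (h.tangent.congr (h.eventually_virtualMul_eq u hu)
    (Eventually.of_forall fun _ => rfl)).isLocalGroup u hu

theorem hasVirtualTangent [LocallyCompactSpace X] (h : DilatationGerm one mul inv δ β)
    (u : UniformSpace X) (hu : u.toTopologicalSpace = ‹TopologicalSpace X›) :
    (LocalGroupData.mk u one mul inv).HasVirtualTangent δ := by
  have hg := h.group.isLocalGroup u hu
  have hv := h.eventually_virtualMul_eq u hu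
  have htan := h.tangent.congr hv (Eventually.of_forall fun _ => rfl)
  subst hu
  refine ⟨hg, ⟨?_, h.tendsto_dil, h.dil_mul⟩, ?_, ?_, ?_⟩
  · obtain ⟨K, hK, hKs, hKc⟩ := local_compact_nhds h.continuousAt_dil
    rw [nhds_prod_eq] at hK
    obtain ⟨T, hT, U, hU, hTU⟩ := mem_prod_iff.1 hK
    exact ⟨T, hT, U, hU, (hKc.uniformContinuousOn_of_continuous fun p hp =>
      ContinuousAt.continuousWithinAt (mem_ofPred_eq ▸ hKs hp :)).mono hTU⟩
  · obtain ⟨K, hK, hKs, hKc⟩ := local_compact_nhds h.tendsto_one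
    exact ⟨K, hK, tendstoUniformlyOn_of_isCompact hKc (fun _ _ => continuousAt_const)
      fun x hx => hKs hx⟩
  · obtain ⟨K, hK, hKs, hKc⟩ :=
      local_compact_nhds ((h.tendsto_mul.and htan.continuousAt_mul).and hv)
    have hunif : TendstoUniformlyOn (fun (ε : ℝ) (p : X × X) => δ ε⁻¹ (mul (δ ε p.1) (δ ε p.2)))
        (fun p => (LocalGroupData.mk u one mul inv).virtualMul δ p.1 p.2) (𝓝[>] 0) K :=
      tendstoUniformlyOn_of_isCompact hKc (fun p hp => (hKs hp).1.2)
        (fun p hp => (hKs hp).2.symm ▸ (hKs hp).1.1)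
    rw [nhds_prod_eq] at hK
    obtain ⟨U, hU, V, hV, hUV⟩ := mem_prod_iff.1 hK
    exact ⟨U ∩ V, inter_mem hU hV, hunif.mono fun p hp => hUV ⟨hp.1.1, hp.2.2⟩⟩
  · obtain ⟨K, hK, hKs, hKc⟩ := local_compact_nhds (h.tendsto_inv.and h.group.continuousAt_inv)
    exact ⟨K, hK, tendstoUniformlyOn_of_isCompact hKc (fun x hx => (hKs hx).2)
      fun x hx => (hKs hx).1⟩

end DilatationGerm

theorem LocalGroupData.isLocalIso_of_openPartialHomeomorph {X Y : Type*} [TopologicalSpace X]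
    [TopologicalSpace Y] [LocallyCompactSpace X] (P : LocalGroupData X) (Q : LocalGroupData Y)
    (hP : P.unif.toTopologicalSpace = ‹TopologicalSpace X›)
    (hQ : Q.unif.toTopologicalSpace = ‹TopologicalSpace Y›) (e : OpenPartialHomeomorph X Y)
    (h0 : P.one ∈ e.source) (hone : e P.one = Q.one)
    (hmul : ∀ᶠ p in 𝓝 (P.one, P.one), e (P.mul p.1 p.2) = Q.mul (e p.1) (e p.2)) :
    P.IsLocalIso Q e := by
  subst hP
  subst hQ
  let _ := P.unif
  let _ := Q.unif
  obtain ⟨K, hK, hKs, hKc⟩ := local_compact_nhds (e.open_source.mem_nhds h0)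
  have hcont : ContinuousOn e K := e.continuousOn.mono hKs
  refine ⟨hone, hmul, K, hK, e '' K, ?_, e.symm, mapsTo_image _ _, ?_, ⟨?_, ?_⟩, ?_, ?_⟩
  · rw [← hone, ← e.map_nhds_eq h0]
    exact image_mem_map hK
  · rintro _ ⟨x, hx, rfl⟩
    rwa [e.left_inv (hKs hx)]
  · exact fun x hx => e.left_inv (hKs hx)
  · rintro _ ⟨x, hx, rfl⟩
    rw [e.left_inv (hKs hx)]
  · exact hKc.uniformContinuousOn_of_continuous hcont
  · refine (hKc.image_of_continuousOn hcont).uniformContinuousOn_of_continuous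
      (e.symm.continuousOn.mono ?_)
    rintro _ ⟨x, hx, rfl⟩
    exact e.map_source (hKs hx)

/-! ### The tangent germs of a group with an exponential chart -/

theorem localGroupGerm_of_isTopologicalGroup (G : Type*) [TopologicalSpace G] [Group G]
    [IsTopologicalGroup G] :
    LocalGroupGerm (1 : G) (fun x y => x * y) (fun x => x⁻¹) where
  assoc := Eventually.of_forall fun _ => mul_assoc _ _ _
  one_mul := Eventually.of_forall one_mul
  mul_one := Eventually.of_forall mul_one
  inv_one := inv_one
  inv_mul := Eventually.of_forall inv_mul_cancel
  mul_inv := Eventually.of_forall mul_inv_cancel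
  continuousAt_mul := Eventually.of_forall fun _ => continuous_mul.continuousAt
  continuousAt_inv := Eventually.of_forall fun _ => continuous_inv.continuousAt

theorem tendsto_prodMap_symm {T X Y : Type*} [TopologicalSpace X] [TopologicalSpace Y]
    {l : Filter T} {e : OpenPartialHomeomorph X Y} {y : Y} (hy : y ∈ e.target) :
    Tendsto (fun p : T × Y => (p.1, e.symm p.2)) (l ×ˢ 𝓝 y) (l ×ˢ 𝓝 (e.symm y)) :=
  tendsto_id.prodMap (e.continuousAt_symm hy).tendsto

namespace ExpChart

variable {E G : Type*} [NormedAddCommGroup E] [NormedSpace ℝ E] [TopologicalSpace G]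
  [Group G] (M : ExpChart E G) {e : OpenPartialHomeomorph E G}

theorem openPartialHomeomorph_zero (h0 : 0 ∈ e.source) (he : EqOn e M.exp e.source) : e 0 = 1 := by
  rw [he h0, M.exp_zero]

theorem one_mem_target (h0 : 0 ∈ e.source) (he : EqOn e M.exp e.source) : 1 ∈ e.target :=
  M.openPartialHomeomorph_zero h0 he ▸ e.map_source h0

theorem symm_one (h0 : 0 ∈ e.source) (he : EqOn e M.exp e.source) : e.symm 1 = 0 := by
  rw [← M.openPartialHomeomorph_zero h0 he, e.left_inv h0]

theorem tendsto_symm_one (h0 : 0 ∈ e.source) (he : EqOn e M.exp e.source) :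
    Tendsto e.symm (𝓝 1) (𝓝 0) := by
  have hcont := (e.continuousAt_symm (M.one_mem_target h0 he)).tendsto
  rwa [M.symm_one h0 he] at hcont

theorem continuousAt_exp_of_mem (he : EqOn e M.exp e.source) {x : E} (hx : x ∈ e.source) :
    ContinuousAt M.exp x :=
  (e.continuousAt hx).congr (he.eventuallyEq_of_mem (e.open_source.mem_nhds hx))

theorem exp_symm (he : EqOn e M.exp e.source) {g : G} (hg : g ∈ e.target) :
    M.exp (e.symm g) = g := by
  rw [← he (e.map_target hg), e.right_inv hg]

theorem symm_exp (he : EqOn e M.exp e.source) {x : E} (hx : x ∈ e.source) :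
    e.symm (M.exp x) = x := by
  rw [← he hx, e.left_inv hx]

theorem eventually_symm_exp_inv (h0 : 0 ∈ e.source) (he : EqOn e M.exp e.source) :
    ∀ᶠ x in 𝓝 (0 : E), e.symm (M.exp x)⁻¹ = -x := by
  have hneg : ∀ᶠ x in 𝓝 (0 : E), -x ∈ e.source :=
    (continuous_neg.tendsto' (0 : E) 0 neg_zero).eventually (e.open_source.mem_nhds h0)
  filter_upwards [hneg] with x hx
  rw [← M.exp_neg, M.symm_exp he hx]

variable {m : ℕ} (S : LayerSplitting m M.ad)

theorem eventually_continuousAt_exp_dil (h0 : 0 ∈ e.source) (he : EqOn e M.exp e.source) :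
    ∀ᶠ p : ℝ × G in 𝓝 (1, 1),
      ContinuousAt (fun p : ℝ × G => M.exp (S.dil p.1 (e.symm p.2))) p := by
  have h1 := M.one_mem_target h0 he
  have hdil : ∀ p : ℝ × G, p.2 ∈ e.target →
      ContinuousAt (fun p : ℝ × G => S.dil p.1 (e.symm p.2)) p := fun p hp =>
    ContinuousAt.comp (f := fun p : ℝ × G => (p.1, e.symm p.2))
      S.continuous_dil_apply.continuousAt
      (continuousAt_fst.prodMk ((e.continuousAt_symm hp).comp continuousAt_snd))
  have hdil_one : Tendsto (fun p : ℝ × G => S.dil p.1 (e.symm p.2)) (𝓝 (1, 1)) (𝓝 0) := by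
    simpa only [M.symm_one h0 he, map_zero] using (hdil (1, 1) h1).tendsto
  filter_upwards [(continuous_snd.tendsto ((1 : ℝ), (1 : G))).eventually
    (e.open_target.mem_nhds h1), hdil_one.eventually (e.open_source.mem_nhds h0)] with p hp hmem
  exact ContinuousAt.comp (M.continuousAt_exp_of_mem he hmem) (hdil p hp)

theorem eventually_tendsto_exp_dil (h0 : 0 ∈ e.source) (he : EqOn e M.exp e.source) :
    ∀ᶠ g in 𝓝 (1 : G),
      Tendsto (fun p : ℝ × G => M.exp (S.dil p.1 (e.symm p.2))) (𝓝[>] 0 ×ˢ 𝓝 g) (𝓝 1) := by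
  filter_upwards [e.open_target.mem_nhds (M.one_mem_target h0 he)] with g hg
  have hdil : Tendsto (fun p : ℝ × G => S.dil p.1 (e.symm p.2)) (𝓝[>] 0 ×ˢ 𝓝 g) (𝓝 0) :=
    Tendsto.comp (g := fun p : ℝ × E => S.dil p.1 p.2) (f := fun p : ℝ × G => (p.1, e.symm p.2))
      (S.tendsto_dil_nhds (e.symm g)) (tendsto_prodMap_symm hg)
  exact Tendsto.comp (g := M.exp) M.tendsto_exp hdil

variable [IsTopologicalGroup G]

theorem eventually_inv_mem_target (h0 : 0 ∈ e.source) (he : EqOn e M.exp e.source) :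
    ∀ᶠ g in 𝓝 (1 : G), g⁻¹ ∈ e.target :=
  (continuous_inv.tendsto' (1 : G) 1 inv_one).eventually
    (e.open_target.mem_nhds (M.one_mem_target h0 he))

theorem localGroupGerm_log (h0 : 0 ∈ e.source) (he : EqOn e M.exp e.source) :
    LocalGroupGerm (0 : E) (fun X Y => e.symm (M.exp X * M.exp Y))
      (fun X => e.symm (M.exp X)⁻¹) := by
  have hgerm := (localGroupGerm_of_isTopologicalGroup G).map e.symm (M.one_mem_target h0 he)
  rw [M.symm_one h0 he] at hgerm
  have hsource : ∀ᶠ x in 𝓝 (0 : E), x ∈ e.source := e.open_source.mem_nhds h0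
  refine hgerm.congr ?_ ?_
  · filter_upwards [(continuous_fst.tendsto ((0 : E), (0 : E))).eventually hsource,
      (continuous_snd.tendsto ((0 : E), (0 : E))).eventually hsource] with p hp₁ hp₂
    rw [e.symm_symm, he hp₁, he hp₂]
  · filter_upwards [hsource] with x hx
    rw [e.symm_symm, he hx]

variable [ProperSpace E]

theorem tendsto_dil_mul_nhds (h0 : 0 ∈ e.source) (he : EqOn e M.exp e.source) (p : E × E) :
    Tendsto (fun q : ℝ × E × E =>
      S.dil q.1⁻¹ (e.symm (M.exp (S.dil q.1 q.2.1) * M.exp (S.dil q.1 q.2.2))))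
      (𝓝[>] 0 ×ˢ 𝓝 p) (𝓝 (bchInt (S.bracket 0) m p.1 p.2)) := by
  obtain ⟨K, hK, hpK⟩ := exists_compact_mem_nhds p
  have hunif := tendstoUniformlyOn_iff_tendsto.1
    (S.tendstoUniformlyOn_dil_inv (μ := fun X Y => e.symm (M.exp X * M.exp Y))
      (log_sub_bchInt_isBigO h0 he m) hK)
  have hlim : Tendsto (fun q : ℝ × E × E => bchInt (S.bracket 0) m q.2.1 q.2.2)
      (𝓝[>] 0 ×ˢ 𝓝 p) (𝓝 (bchInt (S.bracket 0) m p.1 p.2)) :=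
    ((S.continuous_bchInt_bracket_zero m).tendsto p).comp tendsto_snd
  exact hlim.congr_uniformity
    (hunif.mono_left (prod_mono (le_refl (𝓝[>] (0 : ℝ))) (le_principal_iff.2 hpK)))

theorem tendsto_dil_mul (h0 : 0 ∈ e.source) (he : EqOn e M.exp e.source) {x y : ℝ → E}
    {X Y : E} (hx : Tendsto x (𝓝[>] 0) (𝓝 X)) (hy : Tendsto y (𝓝[>] 0) (𝓝 Y)) :
    Tendsto (fun ε : ℝ => S.dil ε⁻¹ (e.symm (M.exp (S.dil ε (x ε)) * M.exp (S.dil ε (y ε)))))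
      (𝓝[>] 0) (𝓝 (bchInt (S.bracket 0) m X Y)) := by
  have hxy : Tendsto (fun ε : ℝ => (ε, (x ε, y ε))) (𝓝[>] 0) (𝓝[>] 0 ×ˢ 𝓝 (X, Y)) :=
    tendsto_id.prodMk (hx.prodMk_nhds hy)
  exact Tendsto.comp (f := fun ε : ℝ => (ε, (x ε, y ε))) (M.tendsto_dil_mul_nhds S h0 he (X, Y)) hxy

theorem bchInt_bracket_assoc (h0 : 0 ∈ e.source) (he : EqOn e M.exp e.source) (X Y Z : E) :
    bchInt (S.bracket 0) m (bchInt (S.bracket 0) m X Y) Z =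
      bchInt (S.bracket 0) m X (bchInt (S.bracket 0) m Y Z) := by
  have hconst := fun x : E => tendsto_const_nhds (x := x) (f := 𝓝[>] (0 : ℝ))
  have hleft := M.tendsto_dil_mul S h0 he
    (M.tendsto_dil_mul S h0 he (hconst X) (hconst Y)) (hconst Z)
  have hright := M.tendsto_dil_mul S h0 he (hconst X)
    (M.tendsto_dil_mul S h0 he (hconst Y) (hconst Z))
  refine tendsto_nhds_unique hleft (hright.congr' ?_)
  filter_upwards [(M.localGroupGerm_log h0 he).eventually_assoc_comp (S.tendsto_dil X)
    (S.tendsto_dil Y) (S.tendsto_dil Z), self_mem_nhdsWithin] with ε hassoc (hε : 0 < ε)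
  rw [S.dil_dil_inv hε.ne', S.dil_dil_inv hε.ne', hassoc]

theorem bchInt_bracket_zero_left (h0 : 0 ∈ e.source) (he : EqOn e M.exp e.source) (X : E) :
    bchInt (S.bracket 0) m 0 X = X := by
  refine tendsto_nhds_unique (M.tendsto_dil_mul S h0 he tendsto_const_nhds tendsto_const_nhds)
    (tendsto_const_nhds.congr' ?_)
  filter_upwards [(S.tendsto_dil X).eventually (M.localGroupGerm_log h0 he).one_mul,
    self_mem_nhdsWithin] with ε hone (hε : 0 < ε)
  rw [map_zero, hone, S.dil_inv_dil hε.ne']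

theorem bchInt_bracket_zero_right (h0 : 0 ∈ e.source) (he : EqOn e M.exp e.source) (X : E) :
    bchInt (S.bracket 0) m X 0 = X := by
  refine tendsto_nhds_unique (M.tendsto_dil_mul S h0 he tendsto_const_nhds tendsto_const_nhds)
    (tendsto_const_nhds.congr' ?_)
  filter_upwards [(S.tendsto_dil X).eventually (M.localGroupGerm_log h0 he).mul_one,
    self_mem_nhdsWithin] with ε hone (hε : 0 < ε)
  rw [map_zero, hone, S.dil_inv_dil hε.ne']

theorem bchInt_bracket_neg_left (h0 : 0 ∈ e.source) (he : EqOn e M.exp e.source) (X : E) :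
    bchInt (S.bracket 0) m (-X) X = 0 := by
  refine tendsto_nhds_unique (M.tendsto_dil_mul S h0 he tendsto_const_nhds tendsto_const_nhds)
    (tendsto_const_nhds.congr fun ε => ?_)
  rw [map_neg, M.exp_neg, inv_mul_cancel, M.symm_one h0 he, map_zero]

theorem bchInt_bracket_neg_right (h0 : 0 ∈ e.source) (he : EqOn e M.exp e.source) (X : E) :
    bchInt (S.bracket 0) m X (-X) = 0 := by
  simpa using M.bchInt_bracket_neg_left S h0 he (-X)

theorem localGroupGerm_bchInt_bracket (h0 : 0 ∈ e.source) (he : EqOn e M.exp e.source) :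
    LocalGroupGerm (0 : E) (bchInt (S.bracket 0) m) (fun X => e.symm (M.exp X)⁻¹) := by
  refine LocalGroupGerm.congr (mul := bchInt (S.bracket 0) m) (inv := fun x => -x) ?_
    (Eventually.of_forall fun _ => rfl) (M.eventually_symm_exp_inv h0 he)
  exact {
    assoc := Eventually.of_forall fun p => M.bchInt_bracket_assoc S h0 he _ _ _
    one_mul := Eventually.of_forall (M.bchInt_bracket_zero_left S h0 he)
    mul_one := Eventually.of_forall (M.bchInt_bracket_zero_right S h0 he)
    inv_one := neg_zero
    inv_mul := Eventually.of_forall (M.bchInt_bracket_neg_left S h0 he)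
    mul_inv := Eventually.of_forall (M.bchInt_bracket_neg_right S h0 he)
    continuousAt_mul := Eventually.of_forall fun p =>
      (S.continuous_bchInt_bracket_zero m).continuousAt
    continuousAt_inv := Eventually.of_forall fun _ => continuous_neg.continuousAt }

theorem dilatationGerm_log (h0 : 0 ∈ e.source) (he : EqOn e M.exp e.source) :
    DilatationGerm (0 : E) (fun X Y => e.symm (M.exp X * M.exp Y))
      (fun X => e.symm (M.exp X)⁻¹) (fun ε X => S.dil ε X) (bchInt (S.bracket 0) m) where
  group := M.localGroupGerm_log h0 he
  tangent := M.localGroupGerm_bchInt_bracket S h0 he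
  continuousAt_dil := Eventually.of_forall fun p => S.continuous_dil_apply.continuousAt
  tendsto_dil ε _ := (S.dil ε).continuous.tendsto' 0 0 (map_zero _)
  dil_mul ε _ η _ := Eventually.of_forall fun x => (S.dil_dil ε η⁻¹ x).symm
  tendsto_one := Eventually.of_forall S.tendsto_dil_nhds
  tendsto_mul := Eventually.of_forall fun p => M.tendsto_dil_mul_nhds S h0 he p
  tendsto_inv := by
    have hinv := M.eventually_symm_exp_inv h0 he
    filter_upwards [hinv] with x hx
    rw [hx]
    have hneg : Tendsto (fun p : ℝ × E => -p.2) (𝓝[>] 0 ×ˢ 𝓝 x) (𝓝 (-x)) := tendsto_snd.neg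
    have hpos : ∀ᶠ p : ℝ × E in 𝓝[>] 0 ×ˢ 𝓝 x, 0 < p.1 :=
      tendsto_fst.eventually self_mem_nhdsWithin
    refine hneg.congr' ?_
    filter_upwards [(S.tendsto_dil_nhds x).eventually hinv, hpos] with p hp hp0
    rw [hp, map_neg, S.dil_inv_dil hp0.ne']

theorem localGroupGerm_map_bchInt_bracket (h0 : 0 ∈ e.source) (he : EqOn e M.exp e.source) :
    LocalGroupGerm (1 : G) (fun g h => e (bchInt (S.bracket 0) m (e.symm g) (e.symm h)))
      (fun g => g⁻¹) := by
  have hgerm := (M.localGroupGerm_bchInt_bracket S h0 he).map e h0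
  rw [M.openPartialHomeomorph_zero h0 he] at hgerm
  refine hgerm.congr (Eventually.of_forall fun _ => rfl) ?_
  filter_upwards [e.open_target.mem_nhds (M.one_mem_target h0 he),
    M.eventually_inv_mem_target h0 he] with g hg hginv
  rw [M.exp_symm he hg, e.right_inv hginv]

theorem eventually_tendsto_exp_dil_mul (h0 : 0 ∈ e.source) (he : EqOn e M.exp e.source) :
    ∀ᶠ p : G × G in 𝓝 (1, 1),
      Tendsto (fun q : ℝ × G × G => M.exp (S.dil q.1⁻¹ (e.symm
        (M.exp (S.dil q.1 (e.symm q.2.1)) * M.exp (S.dil q.1 (e.symm q.2.2))))))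
        (𝓝[>] 0 ×ˢ 𝓝 p) (𝓝 (e (bchInt (S.bracket 0) m (e.symm p.1) (e.symm p.2)))) := by
  have htarget : ∀ᶠ g in 𝓝 (1 : G), g ∈ e.target :=
    e.open_target.mem_nhds (M.one_mem_target h0 he)
  have hsymm := M.tendsto_symm_one h0 he
  have hbch : Tendsto (fun p : G × G => bchInt (S.bracket 0) m (e.symm p.1) (e.symm p.2))
      (𝓝 (1, 1)) (𝓝 0) :=
    (M.localGroupGerm_bchInt_bracket S h0 he).tendsto_mul (hsymm.comp (continuous_fst.tendsto _))
      (hsymm.comp (continuous_snd.tendsto _))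
  filter_upwards [(continuous_fst.tendsto ((1 : G), (1 : G))).eventually htarget,
    (continuous_snd.tendsto ((1 : G), (1 : G))).eventually htarget,
    hbch.eventually (e.open_source.mem_nhds h0)] with p hp₁ hp₂ hmem
  rw [he hmem]
  have hpair : Tendsto (fun q : G × G => (e.symm q.1, e.symm q.2)) (𝓝 p)
      (𝓝 (e.symm p.1, e.symm p.2)) :=
    ((e.continuousAt_symm hp₁).tendsto.comp (continuous_fst.tendsto p)).prodMk_nhds
      ((e.continuousAt_symm hp₂).tendsto.comp (continuous_snd.tendsto p))
  have hmap : Tendsto (fun q : ℝ × G × G => (q.1, (e.symm q.2.1, e.symm q.2.2)))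
      (𝓝[>] 0 ×ˢ 𝓝 p) (𝓝[>] 0 ×ˢ 𝓝 (e.symm p.1, e.symm p.2)) :=
    (tendsto_id (x := 𝓝[>] (0 : ℝ))).prodMap hpair
  have hlim := Tendsto.comp (f := fun q : ℝ × G × G => (q.1, (e.symm q.2.1, e.symm q.2.2)))
    (M.tendsto_dil_mul_nhds S h0 he (e.symm p.1, e.symm p.2)) hmap
  have hexp := Tendsto.comp (M.continuousAt_exp_of_mem he hmem).tendsto hlim
  exact hexp

theorem eventually_tendsto_exp_dil_inv (h0 : 0 ∈ e.source) (he : EqOn e M.exp e.source) :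
    ∀ᶠ g in 𝓝 (1 : G),
      Tendsto (fun q : ℝ × G => M.exp (S.dil q.1⁻¹ (e.symm (M.exp (S.dil q.1 (e.symm q.2)))⁻¹)))
        (𝓝[>] 0 ×ˢ 𝓝 g) (𝓝 g⁻¹) := by
  filter_upwards [e.open_target.mem_nhds (M.one_mem_target h0 he),
    M.eventually_inv_mem_target h0 he,
    (M.tendsto_symm_one h0 he).eventually (M.dilatationGerm_log S h0 he).tendsto_inv]
    with g hg hginv hlim
  have hlim' := Tendsto.comp (f := fun p : ℝ × G => (p.1, e.symm p.2)) hlim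
    (tendsto_prodMap_symm hg)
  rw [M.exp_symm he hg] at hlim'
  have hexp := (M.continuousAt_exp_of_mem he (e.map_target hginv)).tendsto
  rw [M.exp_symm he hginv] at hexp
  have hcomp := Tendsto.comp hexp hlim'
  exact hcomp

theorem dilatationGerm_exp (h0 : 0 ∈ e.source) (he : EqOn e M.exp e.source) :
    DilatationGerm (1 : G) (fun x y => x * y) (fun x => x⁻¹)
      (fun ε g => M.exp (S.dil ε (e.symm g)))
      (fun g h => e (bchInt (S.bracket 0) m (e.symm g) (e.symm h))) where
  group := localGroupGerm_of_isTopologicalGroup G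
  tangent := M.localGroupGerm_map_bchInt_bracket S h0 he
  continuousAt_dil := M.eventually_continuousAt_exp_dil S h0 he
  tendsto_dil ε _ :=
    M.tendsto_exp.comp (((S.dil ε).continuous.tendsto' 0 0 (map_zero _)).comp
      (M.tendsto_symm_one h0 he))
  dil_mul ε _ η _ := by
    filter_upwards [(((S.dil η⁻¹).continuous.tendsto' 0 0 (map_zero _)).comp
      (M.tendsto_symm_one h0 he)).eventually (e.open_source.mem_nhds h0)]
      with g (hg : S.dil η⁻¹ (e.symm g) ∈ e.source)
    rw [M.symm_exp he hg, S.dil_dil]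
  tendsto_one := M.eventually_tendsto_exp_dil S h0 he
  tendsto_mul := M.eventually_tendsto_exp_dil_mul S h0 he
  tendsto_inv := M.eventually_tendsto_exp_dil_inv S h0 he

end ExpChart

/-! ### The virtual tangent spaces of a Lie group -/

section VirtualTangent

variable {E : Type*} [NormedAddCommGroup E] [NormedSpace ℝ E] [FiniteDimensional ℝ E]
  {G : Type*} [TopologicalSpace G] [ChartedSpace E G] [Group G] [LieGroup 𝓘(ℝ, E) ∞ G]

variable (E G) in
theorem exists_lieLog_eq_symm : ∃ e : OpenPartialHomeomorph E G, 0 ∈ e.source ∧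
    EqOn e (lieExpChart E G).exp e.source ∧ (lieLog E G : G → E) = e.symm := by
  have : IsTopologicalGroup G := topologicalGroup_of_lieGroup 𝓘(ℝ, E) ∞
  have hex : ∃ e : OpenPartialHomeomorph (LieAlg E G) G, 0 ∈ e.source ∧ EqOn e lieExp e.source :=
    (lieExpChart E G).exists_openPartialHomeomorph_exp
  refine ⟨hex.choose, hex.choose_spec.1, hex.choose_spec.2, ?_⟩
  rw [lieLog, dif_pos hex]
  rfl

variable (E G) in
/-- The identity, from the model space `E` with the bracket `ad` of the exponential chart of `G` to
the Lie algebra of `G`: Mathlib's `GroupLieAlgebra` is a type synonym of the model space. -/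
noncomputable def modelEquivLieAlg : E ≃ₗ[ℝ] LieAlg E G := LinearEquiv.refl ℝ E

theorem modelEquivLieAlg_ad (X Y : E) :
    modelEquivLieAlg E G ((lieExpChart E G).ad X Y) =
      ⁅modelEquivLieAlg E G X, modelEquivLieAlg E G Y⁆ :=
  lieGroupChart_ad (E := E) (G := G) X Y

theorem lieExpChart_ad_self (X : E) : (lieExpChart E G).ad X X = 0 := by
  rw [GroupChart.ad_apply, sub_self]

namespace Strata

variable {D : Submodule ℝ (LieAlg E G)} (S : Strata D) {m : ℕ} (hm : lieFiltration D m = ⊤)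

/-- The splitting `W_1 ⊕ ⋯ ⊕ W_m` of the Lie algebra, moved to the model space. -/
noncomputable def modelSplitting : LayerSplitting m (lieExpChart E G).ad :=
  S.layerSplitting (modelEquivLieAlg E G) modelEquivLieAlg_ad hm

theorem dil_eq_modelSplitting_dil :
    (fun ε X => S.dil ε X : ℝ → LieAlg E G → LieAlg E G) =
      fun ε X => (S.modelSplitting hm).dil ε X :=
  funext₂ fun ε X => (S.layerSplitting_dil (modelEquivLieAlg E G) modelEquivLieAlg_ad hm ε X).symm

/-- The limit `β(X, Y)` of the rescaled products of `log G`, as an integral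
Baker-Campbell-Hausdorff product. -/
noncomputable def limitMul (X Y : LieAlg E G) : LieAlg E G :=
  modelEquivLieAlg E G (bchInt ((S.modelSplitting hm).bracket 0) m X Y)

theorem ident_limitMul (X Y : LieAlg E G) :
    S.ident (S.limitMul hm X Y) = (nilpotentisation D).mul (S.ident X) (S.ident Y) :=
  S.ident_bchInt (modelEquivLieAlg E G) modelEquivLieAlg_ad hm lieExpChart_ad_self X Y

theorem ident_symm_mul (X Y : LieAlg E G) :
    S.ident.symm ((nilpotentisation D).mul (S.ident X) (S.ident Y)) = S.limitMul hm X Y := by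
  rw [← S.ident_limitMul hm, LinearEquiv.symm_apply_apply]

theorem limitMul_zero (X : LieAlg E G) : S.limitMul hm X 0 = X := by
  have : IsTopologicalGroup G := topologicalGroup_of_lieGroup 𝓘(ℝ, E) ∞
  obtain ⟨e, h0, he, -⟩ := exists_lieLog_eq_symm E G
  exact (lieExpChart E G).bchInt_bracket_zero_right (S.modelSplitting hm) h0 he X

theorem limitMul_assoc (X Y Z : LieAlg E G) :
    S.limitMul hm (S.limitMul hm X Y) Z = S.limitMul hm X (S.limitMul hm Y Z) := by
  have : IsTopologicalGroup G := topologicalGroup_of_lieGroup 𝓘(ℝ, E) ∞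
  obtain ⟨e, h0, he, -⟩ := exists_lieLog_eq_symm E G
  exact (lieExpChart E G).bchInt_bracket_assoc (S.modelSplitting hm) h0 he X Y Z

theorem dilatationGerm_log : DilatationGerm (0 : LieAlg E G) (logLocalGroup E G).mul
    (logLocalGroup E G).inv (fun ε X => S.dil ε X) (S.limitMul hm) := by
  have : IsTopologicalGroup G := topologicalGroup_of_lieGroup 𝓘(ℝ, E) ∞
  obtain ⟨e, h0, he, hlog⟩ := exists_lieLog_eq_symm E G
  have hgerm := (lieExpChart E G).dilatationGerm_log (S.modelSplitting hm) h0 he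
  rw [← hlog] at hgerm
  rw [S.dil_eq_modelSplitting_dil hm]
  exact hgerm

theorem tendsto_limitMul (X Y : LieAlg E G) :
    Tendsto (fun ε : ℝ => S.dil ε⁻¹ ((logLocalGroup E G).mul (S.dil ε X) (S.dil ε Y))) (𝓝[>] 0)
      (𝓝 (S.limitMul hm X Y)) := by
  have : IsTopologicalGroup G := topologicalGroup_of_lieGroup 𝓘(ℝ, E) ∞
  obtain ⟨e, h0, he, hlog⟩ := exists_lieLog_eq_symm E G
  have hlim := (lieExpChart E G).tendsto_dil_mul (S.modelSplitting hm) h0 he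
    (tendsto_const_nhds (x := (X : E))) (tendsto_const_nhds (x := (Y : E)))
  rw [← hlog] at hlim
  have hdil := congrFun₂ (S.dil_eq_modelSplitting_dil hm)
  exact hlim.congr fun ε => ((hdil _ _).trans (congrArg _ (congrArg₂ _ (hdil ε X) (hdil ε Y)))).symm

theorem virtualMul_log (X Y : LieAlg E G) :
    (logLocalGroup E G).virtualMul (fun ε X => S.dil ε X) X Y = S.limitMul hm X Y := by
  let _ := (logLocalGroup E G).unif
  have : T2Space (LieAlg E G) := inferInstanceAs (T2Space E)
  exact (S.tendsto_limitMul hm X Y).limUnder_eq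

theorem ident_virtualTangent_log_mul (hm : lieFiltration D m = ⊤) (X Y : LieAlg E G) :
    S.ident (((logLocalGroup E G).virtualTangent (fun ε X => S.dil ε X)).mul X Y) =
      (nilpotentisation D).mul (S.ident X) (S.ident Y) :=
  (congrArg S.ident (S.virtualMul_log hm X Y)).trans (S.ident_limitMul hm X Y)

/-- The identification `θ` of `𝔤` with `𝔫(𝔤, D)`, as a homeomorphism of vector spaces. -/
noncomputable def identHomeomorph :
    letI : TopologicalSpace (NilAlgebra D) := moduleTopology ℝ (NilAlgebra D)
    LieAlg E G ≃ₜ NilAlgebra D :=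
  letI : TopologicalSpace (NilAlgebra D) := moduleTopology ℝ (NilAlgebra D)
  haveI : IsModuleTopology ℝ (NilAlgebra D) := ⟨rfl⟩
  haveI : IsTopologicalAddGroup (NilAlgebra D) := IsModuleTopology.topologicalAddGroup ℝ _
  haveI : ContinuousSMul ℝ (NilAlgebra D) := IsModuleTopology.toContinuousSMul ℝ _
  { toEquiv := S.ident.toEquiv
    continuous_toFun := LinearMap.continuous_of_finiteDimensional
      (S.ident.toLinearMap ∘ₗ (modelEquivLieAlg E G).toLinearMap)
    continuous_invFun := IsModuleTopology.continuous_of_linearMap S.ident.symm.toLinearMap }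

theorem isLocalIso_virtualTangent_log (hm : lieFiltration D m = ⊤) :
    ((logLocalGroup E G).virtualTangent (fun ε X => S.dil ε X)).IsLocalIso
      (nilpotentisation D) S.ident := by
  have : LocallyCompactSpace (LieAlg E G) := inferInstanceAs (LocallyCompactSpace E)
  let _ : TopologicalSpace (NilAlgebra D) := moduleTopology ℝ (NilAlgebra D)
  exact LocalGroupData.isLocalIso_of_openPartialHomeomorph
    ((logLocalGroup E G).virtualTangent fun ε X => S.dil ε X) (nilpotentisation D) (by rfl)
    (by rfl) S.identHomeomorph.toOpenPartialHomeomorph (mem_univ _) (map_zero S.ident)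
    (Eventually.of_forall fun p => S.ident_virtualTangent_log_mul hm p.1 p.2)

theorem virtualTranslation_log_injective (hm : lieFiltration D m = ⊤) :
    Function.Injective ((logLocalGroup E G).virtualTranslation (fun ε X => S.dil ε X)) := by
  have htranslate : ∀ X : LieAlg E G,
      (logLocalGroup E G).virtualTranslation (fun ε X => S.dil ε X) X 0 = X :=
    fun X => (S.virtualMul_log hm X 0).trans (S.limitMul_zero hm X)
  intro X Y hXY
  rw [← htranslate X, hXY, htranslate Y]

theorem virtualTranslation_log_mul (hm : lieFiltration D m = ⊤) (X Y : LieAlg E G) :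
    (logLocalGroup E G).virtualTranslation (fun ε X => S.dil ε X)
        (S.ident.symm ((nilpotentisation D).mul (S.ident X) (S.ident Y))) =
      (logLocalGroup E G).virtualTranslation (fun ε X => S.dil ε X) X ∘
        (logLocalGroup E G).virtualTranslation (fun ε X => S.dil ε X) Y := by
  have htranslate : (logLocalGroup E G).virtualTranslation (fun ε X => S.dil ε X) =
      S.limitMul hm := funext₂ (S.virtualMul_log hm)
  rw [htranslate, S.ident_symm_mul hm]
  exact funext fun Z => S.limitMul_assoc hm X Y Z

theorem exists_dilatationGerm_exp : ∃ e : OpenPartialHomeomorph (LieAlg E G) G,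
    0 ∈ e.source ∧ e 0 = 1 ∧ lieLog E G = e.symm ∧
      DilatationGerm (1 : G) (fun x y => x * y) (fun x => x⁻¹) S.groupDil
        (fun g h => e (S.limitMul hm (e.symm g) (e.symm h))) := by
  have : IsTopologicalGroup G := topologicalGroup_of_lieGroup 𝓘(ℝ, E) ∞
  obtain ⟨e, h0, he, hlog⟩ := exists_lieLog_eq_symm E G
  refine ⟨e, h0, (lieExpChart E G).openPartialHomeomorph_zero h0 he, hlog, ?_⟩
  have hgerm := (lieExpChart E G).dilatationGerm_exp (S.modelSplitting hm) h0 he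
  have hdil : S.groupDil = fun (ε : ℝ) (g : G) =>
      (lieExpChart E G).exp ((S.modelSplitting hm).dil ε (e.symm g)) := by
    funext ε g
    rw [← hlog]
    exact congrArg lieExp (congrFun₂ (S.dil_eq_modelSplitting_dil hm) ε (lieLog E G g))
  rw [hdil]
  exact hgerm

theorem isLocalIso_virtualTangent_lieLocalGroup (hm : lieFiltration D m = ⊤) :
    ((lieLocalGroup E G).virtualTangent S.groupDil).IsLocalIso
      (nilpotentisation D) (fun g => S.ident (lieLog E G g)) := by
  have : IsTopologicalGroup G := topologicalGroup_of_lieGroup 𝓘(ℝ, E) ∞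
  have : T2Space G := t2Space_of_lieGroup E G
  have : LocallyCompactSpace G := ChartedSpace.locallyCompactSpace E G
  let _ : TopologicalSpace (NilAlgebra D) := moduleTopology ℝ (NilAlgebra D)
  obtain ⟨e, h0, he0, hlog, hgerm⟩ := S.exists_dilatationGerm_exp hm
  rw [hlog]
  have hsymm1 : e.symm 1 = 0 := (congrArg e.symm he0).symm.trans (e.left_inv h0)
  have h1 : (1 : G) ∈ e.symm.source := he0 ▸ e.map_source h0
  have hsymm : Tendsto e.symm (𝓝 1) (𝓝 0) := hsymm1 ▸ e.symm.continuousAt h1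
  have hsource : ∀ᶠ p : G × G in 𝓝 (1, 1), S.limitMul hm (e.symm p.1) (e.symm p.2) ∈ e.source :=
    ((S.dilatationGerm_log hm).tangent.tendsto_mul
      (hsymm.comp (continuous_fst.tendsto ((1 : G), (1 : G))))
      (hsymm.comp (continuous_snd.tendsto ((1 : G), (1 : G))))).eventually
      (e.open_source.mem_nhds h0)
  refine LocalGroupData.isLocalIso_of_openPartialHomeomorph
    ((lieLocalGroup E G).virtualTangent S.groupDil) (nilpotentisation D) (by rfl) (by rfl)
    (e.symm.trans S.identHomeomorph.toOpenPartialHomeomorph) ⟨h1, mem_univ _⟩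
    ((congrArg S.ident hsymm1).trans (map_zero S.ident)) ?_
  filter_upwards [hsource, hgerm.eventually_virtualMul_eq (lieLocalGroup E G).unif (by rfl)]
    with p hmem hmul
  refine (congrArg (fun g => S.ident (e.symm g)) hmul).trans ?_
  exact (congrArg S.ident (e.left_inv hmem)).trans (S.ident_limitMul hm _ _)

end Strata

end VirtualTangent

theorem mainTheorem1_general
    {E : Type*} [NormedAddCommGroup E] [NormedSpace ℝ E] [FiniteDimensional ℝ E]
    {G : Type*} [TopologicalSpace G] [ChartedSpace E G] [Group G] [LieGroup 𝓘(ℝ, E) ∞ G]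
    (D : Submodule ℝ (LieAlg E G)) (hD : BracketGenerating D) (S : Strata D) :
    (logLocalGroup E G).HasVirtualTangent (fun ε X => S.dil ε X) ∧
    (lieLocalGroup E G).HasVirtualTangent S.groupDil ∧
    ((logLocalGroup E G).virtualTangent (fun ε X => S.dil ε X)).IsLocalGroup ∧
    ((lieLocalGroup E G).virtualTangent S.groupDil).IsLocalGroup ∧
    (∀ X Y : LieAlg E G,
      Tendsto (fun ε : ℝ => S.dil ε⁻¹ ((logLocalGroup E G).mul (S.dil ε X) (S.dil ε Y)))
        (𝓝[>] 0)
        (𝓝 (S.ident.symm ((nilpotentisation D).mul (S.ident X) (S.ident Y))))) ∧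
    (∀ X Y : LieAlg E G,
      S.ident (((logLocalGroup E G).virtualTangent (fun ε X => S.dil ε X)).mul X Y) =
        (nilpotentisation D).mul (S.ident X) (S.ident Y)) ∧
    ((logLocalGroup E G).virtualTangent (fun ε X => S.dil ε X)).IsLocalIso
      (nilpotentisation D) S.ident ∧
    Function.Injective ((logLocalGroup E G).virtualTranslation (fun ε X => S.dil ε X)) ∧
    (∀ X Y : LieAlg E G,
      (logLocalGroup E G).virtualTranslation (fun ε X => S.dil ε X)
          (S.ident.symm ((nilpotentisation D).mul (S.ident X) (S.ident Y))) =
        (logLocalGroup E G).virtualTranslation (fun ε X => S.dil ε X) X ∘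
          (logLocalGroup E G).virtualTranslation (fun ε X => S.dil ε X) Y) ∧
    ((lieLocalGroup E G).virtualTangent S.groupDil).IsLocalIso
      (nilpotentisation D) (fun g => S.ident (lieLog E G g)) := by
  obtain ⟨m, hm⟩ := hD
  have : IsTopologicalGroup G := topologicalGroup_of_lieGroup 𝓘(ℝ, E) ∞
  have : T2Space (LieAlg E G) := inferInstanceAs (T2Space E)
  have : LocallyCompactSpace (LieAlg E G) := inferInstanceAs (LocallyCompactSpace E)
  have : T2Space G := t2Space_of_lieGroup E G
  have : LocallyCompactSpace G := ChartedSpace.locallyCompactSpace E G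
  have hlog := S.dilatationGerm_log hm
  obtain ⟨_, -, -, -, hexp⟩ := S.exists_dilatationGerm_exp hm
  exact ⟨hlog.hasVirtualTangent _ rfl, hexp.hasVirtualTangent _ rfl,
    hlog.isLocalGroup_virtualTangent _ rfl, hexp.isLocalGroup_virtualTangent _ rfl,
    fun X Y => S.ident_symm_mul hm X Y ▸ S.tendsto_limitMul hm X Y,
    S.ident_virtualTangent_log_mul hm, S.isLocalIso_virtualTangent_log hm,
    S.virtualTranslation_log_injective hm, S.virtualTranslation_log_mul hm,
    S.isLocalIso_virtualTangent_lieLocalGroup hm⟩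

theorem mainTheorem1
    {E : Type*} [NormedAddCommGroup E] [NormedSpace ℝ E] [FiniteDimensional ℝ E]
    {G : Type*} [TopologicalSpace G] [ChartedSpace E G] [Group G]
    [LieGroup 𝓘(ℝ, E) ∞ G] [ConnectedSpace G]
    (D : Submodule ℝ (LieAlg E G)) (hD : BracketGenerating D) (S : Strata D) :
    -- the virtual tangent spaces of `log G` and of `G` are defined, and are local groups
    (logLocalGroup E G).HasVirtualTangent (fun ε X => S.dil ε X) ∧
    (lieLocalGroup E G).HasVirtualTangent S.groupDil ∧
    ((logLocalGroup E G).virtualTangent (fun ε X => S.dil ε X)).IsLocalGroup ∧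
    ((lieLocalGroup E G).virtualTangent S.groupDil).IsLocalGroup ∧
    -- the limit that defines `β` is the nilpotent product, for all `X` and `Y`
    (∀ X Y : LieAlg E G,
      Tendsto (fun ε : ℝ => S.dil ε⁻¹ ((logLocalGroup E G).mul (S.dil ε X) (S.dil ε Y)))
        (𝓝[>] 0)
        (𝓝 (S.ident.symm ((nilpotentisation D).mul (S.ident X) (S.ident Y))))) ∧
    (∀ X Y : LieAlg E G,
      S.ident (((logLocalGroup E G).virtualTangent (fun ε X => S.dil ε X)).mul X Y) =
        (nilpotentisation D).mul (S.ident X) (S.ident Y)) ∧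
    -- under the identification of `𝔤` with `𝔫(𝔤, D)`, `N(G, D)` is `VT_0 log G`
    ((logLocalGroup E G).virtualTangent (fun ε X => S.dil ε X)).IsLocalIso
      (nilpotentisation D) S.ident ∧
    -- the same in terms of the infinitesimal translations that form `VT_0 log G`
    Function.Injective ((logLocalGroup E G).virtualTranslation (fun ε X => S.dil ε X)) ∧
    (∀ X Y : LieAlg E G,
      (logLocalGroup E G).virtualTranslation (fun ε X => S.dil ε X)
          (S.ident.symm ((nilpotentisation D).mul (S.ident X) (S.ident Y))) =
        (logLocalGroup E G).virtualTranslation (fun ε X => S.dil ε X) X ∘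
          (logLocalGroup E G).virtualTranslation (fun ε X => S.dil ε X) Y) ∧
    -- `VT_e G` is isomorphic to `N(G, D)`
    ((lieLocalGroup E G).virtualTangent S.groupDil).IsLocalIso
      (nilpotentisation D) (fun g => S.ident (lieLog E G g)) :=
  mainTheorem1_general D hD S
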